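/- **Conventions.** All gradings are by $\mathbb Z_2$. In formulas involving degrees $|\cdot|$ the elements are homogeneous and the formula is extended additively. Let $K$ be a unital supercommutative superring with $\frac12\in K$, and let $A$ be a unital associative supercommutative superalgebra over $K$. An $A$-supermodule $M$ is a graded $A$-bimodule with $am=(-1)^{|a||m|}ma$; $\operatorname{End}_A M$ (resp. $\operatorname{End}_K M$) is the set of additive maps $f$ with $f(ma)=f(m)a$ for $a\in A$ (resp. $a\in K$), and $[f,g]=fg-(-1)^{|f||g|}gf$. An $A$-quadratic form on $M$ is a map $q:M\times M\to A$ of degree $\bar 0$ that is biadditive with $q(ma,n)=q(m,an)$, $q(m,na)=q(m,n)a$ and $q(m,n)=(-1)^{|m||n|}q(n,m)$. Put $$\operatorname{osp}(q)=\{x\in\operatorname{End}_AM: q(x(m),n)+(-1)^{|m||n|}q(x(n),m)=0\ \ \forall m,n\},$$ $$\mathbf E_{m,n}(p)=m\,q(n,p)-(-1)^{|n||p|}q(m,p)\,n,\qquad \operatorname{eosp}(q)=\operatorname{span}_{\mathbb Z}\{\mathbf E_{m,n}\}.$$ For a $K$-subalgebra $\mathcal E$ of $\operatorname{osp}(q)$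 containing $\operatorname{eosp}(q)$, let $\mathcal E_\infty=A\oplus M\oplus M\oplus\mathcal E$ be the Lie superalgebra with product $$[(a,m,n,x),(a',m',n',x')]=\bigl(q(m,n')-q(n,m'),\ am'+xm'-ma'-(-1)^{|x'||m|}x'm,$$ $$-an'+xn'+na'-(-1)^{|x'||n|}x'n,\ \mathbf E_{m,n'}+\mathbf E_{n,m'}+[x,x']\bigr).$$ $\operatorname{Der}_K$ of a superalgebra is the sum of the spaces ($\alpha\in\mathbb Z_2$) of $K$-linear maps $d$ of degree $\alpha$ with $d(xy)=d(x)y+(-1)^{\alpha|x|}x\,d(y)$. Let $\mathcal S_{\mathcal E}\subseteq\operatorname{End}_KM$ be the span of the homogeneous $S$ with $[S,A\cdot\mathrm{Id}]\subseteq A\cdot\mathrm{Id}$, $[S,q(m,n)\mathrm{Id}]=(q(S(m),n)+(-1)^{|m||n|}q(S(n),m))\mathrm{Id}$ for all homogeneous $m,n$, and $[S,\mathcal E]\subseteq\mathcal E$. If $A$ acts faithfully on $M$, then for $S\in\mathcal S_{\mathcal E}$ define $d_{S,0}(a,m,n,x)=([S,a\,\mathrm{Id}],S(m),S(n),[S,x])$,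 identifying $A$ with $A\cdot\mathrm{Id}$. **Setting.** Let $I=\mathbb Z$ or $I=\frac12\mathbb Z$, let $M=\bigoplus_{i\in I}Am_i$ be a free $A$-supermodule with homogeneous basis $(m_i)$, and let $q$ be an $A$-quadratic form on $M$ with $$q(m_i,m_j)=(-1)^i\delta_{i,-j}\ (i,j\in\mathbb Z),\quad q(m_i,m_j)=(-1)^{i+\frac12}\delta_{i,-j}\ (i,j\in\tfrac12+\mathbb Z),\quad q(m_i,m_j)=0\ (i\in\mathbb Z,\ j\in\tfrac12+\mathbb Z).$$ Let $\operatorname{osp}_{fd}(q)$ be the set of $x\in\operatorname{osp}(q)$ whose matrix $(a_{ij})$, $x(m_j)=\sum_i a_{ij}m_i$, has finitely many nonzero diagonals, i.e. $\{j-i: a_{ij}\ne0\}$ is finite. For $\Delta\in\operatorname{Der}_KA$ put $$\Delta_M\Bigl(\sum_i a_im_i\Bigr)=\sum_i\bigl(\tfrac12\Delta(q(m_i,m_{-i}))\,q(m_i,m_{-i})^{-1}a_i+\Delta(a_i)\bigr)m_i,$$ and $(\operatorname{Der}_KA)_M=\{\Delta_M:\Delta\in\operatorname{Der}_KA\}$.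 **Corollary.** Suppose that every nonzero integer is invertible in $A$. Then $\mathcal E=\operatorname{osp}_{fd}(q)$ is a $K$-subalgebra of $\operatorname{osp}(q)$ containing $\operatorname{eosp}(q)$, and it is self-normalizing in $\operatorname{osp}(q)$: $$\{x\in\operatorname{osp}(q): [x,\mathcal E]\subseteq\mathcal E\}=\mathcal E.$$ Moreover $(\operatorname{Der}_KA)_M\subseteq\mathcal S_{\mathcal E}$, and $$\operatorname{Der}_K\mathcal E_\infty=\operatorname{ad}(\mathcal E_\infty)\rtimes\{d_{S,0}: S\in(\operatorname{Der}_KA)_M\},$$ that is, $\operatorname{ad}(\mathcal E_\infty)$ is an ideal of $\operatorname{Der}_K\mathcal E_\infty$, $\{d_{S,0}\}$ is a subalgebra (both graded and closed under $K$), and $\operatorname{Der}_K\mathcal E_\infty$ is their direct sum. -/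

import Mathlib

open MulOpposite

namespace Super

/-! ### Signs, gradings and endomorphisms

Every `ZMod 2`-graded object is an additive group `V` with a family `𝒱 : ZMod 2 → AddSubgroup V` of
homogeneous components. -/

theorem end_add_apply {V : Type*} [AddCommGroup V] (f g : AddMonoid.End V) (v : V) :
    (f + g) v = f v + g v := rfl

theorem end_neg_apply {V : Type*} [AddCommGroup V] (f : AddMonoid.End V) (v : V) :
    (-f) v = -f v := rfl

theorem end_ext {V : Type*} [AddCommGroup V] {f g : AddMonoid.End V} (h : ∀ v, f v = g v) :
    f = g := AddMonoidHom.ext h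

/-- The sign `(-1)^(αβ)`. -/
def sgn (α β : ZMod 2) : ℤ := (-1) ^ (α.val * β.val)

/-- The additive endomorphisms of degree `α` of a graded group. -/
def endDeg {V : Type*} [AddCommGroup V] (𝒱 : ZMod 2 → AddSubgroup V) (α : ZMod 2) :
    AddSubgroup (AddMonoid.End V) where
  carrier := {f | ∀ β, ∀ v ∈ 𝒱 β, f v ∈ 𝒱 (α + β)}
  add_mem' hf hg β v hv := add_mem (hf β v hv) (hg β v hv)
  zero_mem' _ _ _ := zero_mem _
  neg_mem' hf β v hv := neg_mem (hf β v hv)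

/-- The subgroup `N` is graded: it is spanned by its homogeneous elements. -/
def IsGradedSub {V : Type*} [AddCommGroup V] (𝒱 : ZMod 2 → AddSubgroup V) (N : AddSubgroup V) :
    Prop :=
  N ≤ ⨆ α, N ⊓ 𝒱 α

section Graded

variable {V : Type*} [AddCommGroup V] (𝒱 : ZMod 2 → AddSubgroup V) [DirectSum.Decomposition 𝒱]

/-- The projection `v ↦ v_α` onto the homogeneous component of degree `α`. -/
def proj (α : ZMod 2) : AddMonoid.End V where
  toFun v := (DirectSum.decompose 𝒱 v α : V)
  map_zero' := by simp
  map_add' := by simp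

/-- The component of degree `α` of an additive endomorphism. -/
def part (α : ZMod 2) : AddMonoid.End V →+ AddMonoid.End V where
  toFun f := ∑ β, proj 𝒱 (α + β) * f * proj 𝒱 β
  map_zero' := by simp
  map_add' f g := by simp [mul_add, add_mul, Finset.sum_add_distrib]

/-- The supercommutator: the biadditive extension of `[f, g] = f g - (-1)^(|f||g|) g f`. -/
def sbr : AddMonoid.End V →+ AddMonoid.End V →+ AddMonoid.End V :=
  AddMonoidHom.mk' (fun f => AddMonoidHom.mk'
    (fun g => ∑ α, ∑ β, (part 𝒱 α f * part 𝒱 β g - sgn α β • (part 𝒱 β g * part 𝒱 α f)))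
    (fun g g' => by
      simp only [← Finset.sum_add_distrib]
      refine Finset.sum_congr rfl fun α _ => Finset.sum_congr rfl fun β _ => ?_
      simp only [map_add, mul_add, add_mul, zsmul_add]; abel))
    (fun f f' => by
      ext1 g
      simp only [AddMonoidHom.mk'_apply, AddMonoidHom.add_apply, ← Finset.sum_add_distrib]
      refine Finset.sum_congr rfl fun α _ => Finset.sum_congr rfl fun β _ => ?_
      simp only [map_add, mul_add, add_mul, zsmul_add]; abel)

/-- The biadditive extension of `(x, v) ↦ (-1)^(|x||v|) x(v)`. -/
def sact : AddMonoid.End V →+ V →+ V :=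
  AddMonoidHom.mk' (fun x => AddMonoidHom.mk'
    (fun v => ∑ α, ∑ β, sgn α β • part 𝒱 α x (proj 𝒱 β v))
    (fun v v' => by simp only [map_add, smul_add, Finset.sum_add_distrib]))
    (fun x x' => by
      ext v
      simp only [AddMonoidHom.mk'_apply, AddMonoidHom.add_apply, map_add, end_add_apply, smul_add,
        Finset.sum_add_distrib])

end Graded

/-- A graded ring is supercommutative: `ab = (-1)^(|a||b|) ba`. -/
def IsSupercommutative {A : Type*} [Ring A] (𝒜 : ZMod 2 → AddSubgroup A) : Prop :=
  ∀ α β, ∀ a ∈ 𝒜 α, ∀ b ∈ 𝒜 β, a * b = sgn α β • (b * a)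

/-- Homogeneous derivations of degree `α` of a group with a biadditive product `μ`, within a set
`Lin` of maps (the linear maps over the base superring). -/
def IsDerivationDeg {V : Type*} [AddCommGroup V] (𝒱 : ZMod 2 → AddSubgroup V) (μ : V →+ V →+ V)
    (Lin : Set (AddMonoid.End V)) (α : ZMod 2) (d : AddMonoid.End V) : Prop :=
  d ∈ Lin ∧ d ∈ endDeg 𝒱 α ∧
    ∀ β, ∀ x ∈ 𝒱 β, ∀ y, d (μ x y) = μ (d x) y + sgn α β • μ x (d y)

/-- `Der = Der_0 ⊕ Der_1`, the additive span of the homogeneous derivations. -/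
def Der {V : Type*} [AddCommGroup V] (𝒱 : ZMod 2 → AddSubgroup V) (μ : V →+ V →+ V)
    (Lin : Set (AddMonoid.End V)) : AddSubgroup (AddMonoid.End V) :=
  AddSubgroup.closure {d | ∃ α, IsDerivationDeg 𝒱 μ Lin α d}

/-- `N` is a graded subgroup, closed under left and right multiplication with the scalar
multiplications `κ k` : a subsupermodule of the endomorphisms. -/
structure IsSubsupermodule {K V : Type*} [AddCommGroup V] (𝒱 : ZMod 2 → AddSubgroup V)
    (κ : K → AddMonoid.End V) (N : AddSubgroup (AddMonoid.End V)) : Prop where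
  graded : IsGradedSub (endDeg 𝒱) N
  smul_mem : ∀ k, ∀ f ∈ N, κ k * f ∈ N
  mul_smul_mem : ∀ k, ∀ f ∈ N, f * κ k ∈ N

/-- `G = N ⋊ H` inside the Lie superalgebra of endomorphisms of a graded `V`:
`N` and `H` are subsupermodules with `G = N ⊕ H`, `N` is an ideal of `G` and `H` a subalgebra.
Brackets are tested on homogeneous elements. -/
structure IsSemidirect {K V : Type*} [AddCommGroup V] (𝒱 : ZMod 2 → AddSubgroup V)
    (κ : K → AddMonoid.End V) (G N H : AddSubgroup (AddMonoid.End V)) : Prop where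
  subN : IsSubsupermodule 𝒱 κ N
  subH : IsSubsupermodule 𝒱 κ H
  sup_eq : G = N ⊔ H
  disjoint : Disjoint N H
  ideal : ∀ α β, ∀ f ∈ G ⊓ endDeg 𝒱 α, ∀ g ∈ N ⊓ endDeg 𝒱 β, f * g - sgn α β • (g * f) ∈ N
  subalgebra : ∀ α β, ∀ f ∈ H ⊓ endDeg 𝒱 α, ∀ g ∈ H ⊓ endDeg 𝒱 β,
    f * g - sgn α β • (g * f) ∈ H

/-! ### Supermodules, quadratic forms, orthosymplectic algebras

The right action of `a` on `m` is `op a • m`. -/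

section Modules

variable {K A M : Type*} [Ring K] [Ring A] [AddCommGroup M]
  [Module A M] [Module Aᵐᵒᵖ M]

/-- A graded `A`-bimodule with `a m = (-1)^(|a||m|) m a`. -/
structure IsSupermodule [SMulCommClass A Aᵐᵒᵖ M] (𝒜 : ZMod 2 → AddSubgroup A)
    (ℳ : ZMod 2 → AddSubgroup M) : Prop where
  smul_mem : ∀ α β, ∀ a ∈ 𝒜 α, ∀ m ∈ ℳ β, a • m ∈ ℳ (α + β)
  smul_eq : ∀ α β, ∀ a ∈ 𝒜 α, ∀ m ∈ ℳ β, a • m = sgn α β • (op a • m)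

/-- An `A`-quadratic form: an `A`-bilinear supersymmetric map `M × M → A` of degree `0`. -/
structure IsQuadraticForm (𝒜 : ZMod 2 → AddSubgroup A) (ℳ : ZMod 2 → AddSubgroup M)
    (q : M →+ M →+ A) : Prop where
  balanced : ∀ m n (a : A), q (op a • m) n = q m (a • n)
  map_right : ∀ m n (a : A), q m (op a • n) = q m n * a
  degree : ∀ α β, ∀ m ∈ ℳ α, ∀ n ∈ ℳ β, q m n ∈ 𝒜 (α + β)
  supersymm : ∀ α β, ∀ m ∈ ℳ α, ∀ n ∈ ℳ β, q m n = sgn α β • q n m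

/-- The endomorphisms of `M` linear over `K`, acting through `ι : K → A`: `f (m k) = f (m) k`. -/
def linEnd (M : Type*) [AddCommGroup M] [Module Aᵐᵒᵖ M] (ι : K →+* A) :
    AddSubgroup (AddMonoid.End M) where
  carrier := {f | ∀ k m, f (op (ι k) • m) = op (ι k) • f m}
  add_mem' hf hg k m := by
    rw [end_add_apply, end_add_apply, hf k m, hg k m, smul_add]
  zero_mem' k m := by simp
  neg_mem' hf k m := by
    rw [end_neg_apply, end_neg_apply, hf k m, smul_neg]

/-- `osp(q)`, inside `End_A M`. -/
def osp (ℳ : ZMod 2 → AddSubgroup M) (q : M →+ M →+ A) : AddSubgroup (AddMonoid.End M) where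
  carrier := {x | x ∈ linEnd M (RingHom.id A) ∧
    ∀ α β, ∀ m ∈ ℳ α, ∀ n ∈ ℳ β, q (x m) n + sgn α β • q (x n) m = 0}
  add_mem' := by
    rintro x y ⟨hx, hx'⟩ ⟨hy, hy'⟩
    refine ⟨add_mem hx hy, fun α β m hm n hn => ?_⟩
    have h := congrArg₂ (· + ·) (hx' α β m hm n hn) (hy' α β m hm n hn)
    simp only [add_zero] at h
    rw [← h]
    simp only [end_add_apply, map_add, AddMonoidHom.add_apply, smul_add]
    abel
  zero_mem' := ⟨zero_mem _, by simp⟩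
  neg_mem' := by
    rintro x ⟨hx, hx'⟩
    refine ⟨neg_mem hx, fun α β m hm n hn => ?_⟩
    have h := congrArg (fun t => -t) (hx' α β m hm n hn)
    simp only [neg_zero] at h
    rw [← h]
    simp only [end_neg_apply, map_neg, AddMonoidHom.neg_apply, smul_neg]
    abel

/-- `a · Id`, the left multiplication by `a` on `M`. -/
abbrev idA (M : Type*) [AddCommGroup M] [Module A M] (a : A) : AddMonoid.End M :=
  Module.toAddMonoidEnd A M a

variable (ℳ : ZMod 2 → AddSubgroup M) [DirectSum.Decomposition ℳ] (q : M →+ M →+ A)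

/-- The map `E_{m,n}`, the biadditive extension of `E_{m,n}(p) = m q(n,p) - (-1)^(|n||p|) q(m,p) n`
from homogeneous `n`, `p`. -/
def EEmap (m n : M) : AddMonoid.End M :=
  AddMonoidHom.mk' (fun p => op (q n p) • m - ∑ β, ∑ γ, sgn β γ • (q m (proj ℳ γ p) • proj ℳ β n))
    (fun p p' => by
      simp only [map_add, op_add, add_smul, smul_add, Finset.sum_add_distrib]; abel)

theorem EEmap_apply (m n p : M) : EEmap ℳ q m n p =
    op (q n p) • m - ∑ β, ∑ γ, sgn β γ • (q m (proj ℳ γ p) • proj ℳ β n) := rfl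

/-- The map `E : M × M → End_A M`, `(m, n) ↦ E_{m,n}`. -/
def EE : M →+ M →+ AddMonoid.End M :=
  AddMonoidHom.mk' (fun m => AddMonoidHom.mk' (EEmap ℳ q m)
    (fun n n' => by
      refine end_ext fun p => ?_
      rw [end_add_apply, EEmap_apply, EEmap_apply, EEmap_apply]
      simp only [map_add, AddMonoidHom.add_apply, op_add, add_smul, smul_add,
        Finset.sum_add_distrib]
      abel))
    (fun m m' => by
      refine AddMonoidHom.ext fun n => end_ext fun p => ?_
      rw [AddMonoidHom.add_apply, end_add_apply]
      simp only [AddMonoidHom.mk'_apply, EEmap_apply]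
      simp only [map_add, AddMonoidHom.add_apply, add_smul, smul_add, Finset.sum_add_distrib]
      abel)

/-- `eosp(q)`, the `ℤ`-span of the maps `E_{m,n}`. -/
def eosp : AddSubgroup (AddMonoid.End M) :=
  AddSubgroup.closure {f | ∃ m n, f = EE ℳ q m n}

/-- `E` is a `K`-subalgebra of `osp(q)` containing `eosp(q)`. -/
structure IsOspSubalgebra (ι : K →+* A) (E : AddSubgroup (AddMonoid.End M)) : Prop where
  le_osp : E ≤ osp ℳ q
  eosp_le : eosp ℳ q ≤ E
  submodule : IsSubsupermodule ℳ (fun k => idA M (ι k)) E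
  bracket_mem : ∀ x ∈ E, ∀ y ∈ E, sbr ℳ x y ∈ E

/-- The normalizer of `E` in `osp(q)`. -/
def normalizer (E : AddSubgroup (AddMonoid.End M)) : Set (AddMonoid.End M) :=
  {x | x ∈ osp ℳ q ∧ ∀ y ∈ E, sbr ℳ x y ∈ E}

/-! ### The algebra `E_∞` and its derivations -/

/-- The underlying group of `E_∞ = {(a, m, n, x)}`. -/
abbrev EInf (A : Type*) {M : Type*} [Ring A] [AddCommGroup M]
    (E : AddSubgroup (AddMonoid.End M)) : Type _ :=
  A × M × M × E

/-- The grading of `E_∞`. -/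
def gradInf (𝒜 : ZMod 2 → AddSubgroup A) (ℳ : ZMod 2 → AddSubgroup M)
    (E : AddSubgroup (AddMonoid.End M)) (α : ZMod 2) : AddSubgroup (EInf A E) where
  carrier := {u | u.1 ∈ 𝒜 α ∧ u.2.1 ∈ ℳ α ∧ u.2.2.1 ∈ ℳ α ∧
    (u.2.2.2 : AddMonoid.End M) ∈ endDeg ℳ α}
  add_mem' hu hv := ⟨add_mem hu.1 hv.1, add_mem hu.2.1 hv.2.1, add_mem hu.2.2.1 hv.2.2.1,
    add_mem hu.2.2.2 hv.2.2.2⟩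
  zero_mem' := ⟨zero_mem _, zero_mem _, zero_mem _, zero_mem _⟩
  neg_mem' hu := ⟨neg_mem hu.1, neg_mem hu.2.1, neg_mem hu.2.2.1, neg_mem hu.2.2.2⟩

variable {ℳ q} {ι : K →+* A} {E : AddSubgroup (AddMonoid.End M)}

theorem EE_mem (hE : IsOspSubalgebra ℳ q ι E) (m n : M) : EE ℳ q m n ∈ E :=
  hE.eosp_le (AddSubgroup.subset_closure ⟨m, n, rfl⟩)

/-- The product of `E_∞`. -/
def brInf (hE : IsOspSubalgebra ℳ q ι E) : EInf A E →+ EInf A E →+ EInf A E :=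
  AddMonoidHom.mk' (fun u => AddMonoidHom.mk'
    (fun v => match u, v with
      | (a, m, n, x), (a', m', n', x') =>
        (q m n' - q n m',
         a • m' + (x : AddMonoid.End M) m' - op a' • m - sact ℳ x' m,
         -(a • n') + (x : AddMonoid.End M) n' + op a' • n - sact ℳ x' n,
         ⟨EE ℳ q m n' + EE ℳ q n m' + sbr ℳ x x',
          add_mem (add_mem (EE_mem hE _ _) (EE_mem hE _ _))
            (hE.bracket_mem _ x.2 _ x'.2)⟩))
    (by
      rintro ⟨a₁, m₁, n₁, x₁⟩ ⟨a₂, m₂, n₂, x₂⟩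
      refine Prod.ext ?_ (Prod.ext ?_ (Prod.ext ?_ (Subtype.ext ?_))) <;>
      simp only [Prod.mk_add_mk, map_add, op_add, smul_add, add_smul, AddSubgroup.coe_add,
        AddMonoidHom.add_apply] <;> abel))
    (by
      rintro ⟨a₁, m₁, n₁, x₁⟩ ⟨a₂, m₂, n₂, x₂⟩
      refine AddMonoidHom.ext ?_
      rintro ⟨a₃, m₃, n₃, x₃⟩
      refine Prod.ext ?_ (Prod.ext ?_ (Prod.ext ?_ (Subtype.ext ?_))) <;>
      simp only [AddMonoidHom.mk'_apply, AddMonoidHom.add_apply, Prod.mk_add_mk, map_add, end_add_apply, smul_add,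
        add_smul, AddSubgroup.coe_add] <;> abel)

/-- The left action of `K` on `E_∞`, with `(k x)(m) = k x(m)` on `E`. -/
def lsmulInf (hE : IsOspSubalgebra ℳ q ι E) (k : K) : AddMonoid.End (EInf A E) :=
  AddMonoidHom.mk' (fun u => (ι k * u.1, ι k • u.2.1, ι k • u.2.2.1,
      ⟨idA M (ι k) * u.2.2.2, hE.submodule.smul_mem k _ u.2.2.2.2⟩))
    (fun u v => by
      refine Prod.ext ?_ (Prod.ext ?_ (Prod.ext ?_ (Subtype.ext ?_))) <;>
      simp [mul_add])

/-- The right action of `K` on `E_∞`, with `(x k)(m) = x(k m)` on `E`. -/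
def rsmulInf (hE : IsOspSubalgebra ℳ q ι E) (k : K) : AddMonoid.End (EInf A E) :=
  AddMonoidHom.mk' (fun u => (u.1 * ι k, op (ι k) • u.2.1, op (ι k) • u.2.2.1,
      ⟨u.2.2.2 * idA M (ι k), hE.submodule.mul_smul_mem k _ u.2.2.2.2⟩))
    (fun u v => by
      refine Prod.ext ?_ (Prod.ext ?_ (Prod.ext ?_ (Subtype.ext ?_))) <;>
      simp [add_mul])

/-- `Der_K E_∞`. -/
def derInf (𝒜 : ZMod 2 → AddSubgroup A) (hE : IsOspSubalgebra ℳ q ι E) :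
    AddSubgroup (AddMonoid.End (EInf A E)) :=
  Der (gradInf 𝒜 ℳ E) (brInf hE) {d | ∀ k u, d (rsmulInf hE k u) = rsmulInf hE k (d u)}

/-- `ad E_∞`, the inner derivations. -/
def adInf (hE : IsOspSubalgebra ℳ q ι E) : AddSubgroup (AddMonoid.End (EInf A E)) where
  carrier := {d | ∃ u, ∀ v, d v = brInf hE u v}
  add_mem' := by
    rintro d d' ⟨u, h⟩ ⟨u', h'⟩
    exact ⟨u + u', fun v => by rw [end_add_apply, h v, h' v, map_add, AddMonoidHom.add_apply]⟩
  zero_mem' := ⟨0, fun v => by rw [map_zero]; rfl⟩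
  neg_mem' := by
    rintro d ⟨u, h⟩
    exact ⟨-u, fun v => by rw [end_neg_apply, h v, map_neg, AddMonoidHom.neg_apply]⟩

/-- `Der_K A`. -/
def derA (𝒜 : ZMod 2 → AddSubgroup A) (ι : K →+* A) : AddSubgroup (AddMonoid.End A) :=
  Der 𝒜 AddMonoidHom.mul (linEnd A ι)

variable (ℳ q ι E) in
/-- The superalgebra `𝒮_E`, the span of the `K`-linear homogeneous `S` with (S1)
`[S, A·Id] ⊆ A·Id`, (S2) `[S, q(m,n)·Id] = (q(S(m),n) + (-1)^(|m||n|) q(S(n),m))·Id` and (S3)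
`[S, E] ⊆ E`. -/
def SS : AddSubgroup (AddMonoid.End M) :=
  AddSubgroup.closure {S | S ∈ linEnd M ι ∧ (∃ α, S ∈ endDeg ℳ α) ∧
    (∀ a : A, ∃ a' : A, sbr ℳ S (idA M a) = idA M a') ∧
    (∀ α β, ∀ m ∈ ℳ α, ∀ n ∈ ℳ β,
      sbr ℳ S (idA M (q m n)) = idA M (q (S m) n + sgn α β • q (S n) m)) ∧
    (∀ x ∈ E, sbr ℳ S x ∈ E)}

variable (ℳ) in
/-- `d = d_{S,0}`, that is `d (a, m, n, x) = ([S, a·Id], S m, S n, [S, x])`, where `A` is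
identified with `A·Id`. -/
def IsD (S : AddMonoid.End M) (d : AddMonoid.End (EInf A E)) : Prop :=
  ∀ u : EInf A E, idA M (d u).1 = sbr ℳ S (idA M u.1) ∧ (d u).2.1 = S u.2.1 ∧
    (d u).2.2.1 = S u.2.2.1 ∧ ((d u).2.2.2 : AddMonoid.End M) = sbr ℳ S u.2.2.2

/-! ### Free modules indexed by `ℤ` or `½ℤ` -/

variable {I : AddSubgroup ℚ} (b : Module.Basis I A M)

variable (q) in
/-- The values of the form on the basis: `(-1)^i δ_{i,-j}` for `i, j ∈ ℤ`,
`(-1)^(i+1/2) δ_{i,-j}` for `i, j ∈ 1/2 + ℤ`, and `0` for indices of different kinds. -/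
structure IsKacForm : Prop where
  int_int : ∀ (i j : I) (k l : ℤ), (i : ℚ) = k → (j : ℚ) = l →
    q (b i) (b j) = if i = -j then ((k.negOnePow : ℤ) : A) else 0
  half_half : ∀ (i j : I) (k l : ℤ), (i : ℚ) + 1 / 2 = k → (j : ℚ) + 1 / 2 = l →
    q (b i) (b j) = if i = -j then ((k.negOnePow : ℤ) : A) else 0
  int_half : ∀ (i j : I) (k l : ℤ), (i : ℚ) = k → (j : ℚ) + 1 / 2 = l → q (b i) (b j) = 0

/-- The indices `j - i` of the nonzero diagonals of the matrix `(a_ij)` of `x`, where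
`x(m_j) = ∑ a_ij m_i`. -/
def diagonals (x : AddMonoid.End M) : Set ℚ :=
  {c | ∃ i j : I, (j : ℚ) - i = c ∧ b.repr (x (b j)) i ≠ 0}

variable (ℳ q) in
/-- `osp_fd(q)`: elements of `osp(q)` with finitely many nonzero diagonals. -/
def ospFd : AddSubgroup (AddMonoid.End M) where
  carrier := {x | x ∈ osp ℳ q ∧ (diagonals b x).Finite}
  add_mem' := by
    rintro x y ⟨hx, hx'⟩ ⟨hy, hy'⟩
    refine ⟨add_mem hx hy, (hx'.union hy').subset ?_⟩
    rintro c ⟨i, j, hc, h⟩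
    by_cases h0 : b.repr (x (b j)) i = 0
    · right
      refine ⟨i, j, hc, ?_⟩
      simpa [end_add_apply, h0] using h
    · exact Or.inl ⟨i, j, hc, h0⟩
  zero_mem' := ⟨zero_mem _, by simp [diagonals]⟩
  neg_mem' := by
    rintro x ⟨hx, hx'⟩
    exact ⟨neg_mem hx, by simpa [diagonals, end_neg_apply] using hx'⟩

variable (q) in
/-- `Δ_M`, the extension of a derivation `Δ` of `A` to `M`:
`Δ_M (∑ a_i m_i) = ∑ ((1/2) Δ(q(m_i,m_{-i})) q(m_i,m_{-i})⁻¹ a_i + Δ(a_i)) m_i`. -/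
noncomputable def deltaM (Δ : AddMonoid.End A) : AddMonoid.End M :=
  AddMonoidHom.mk' (fun m => (b.repr m).sum fun i a =>
      (Ring.inverse 2 * Δ (q (b i) (b (-i))) * Ring.inverse (q (b i) (b (-i))) * a + Δ a) • b i)
    (fun m m' => by
      rw [map_add]
      refine Finsupp.sum_add_index (by simp) fun i _ a a' => ?_
      rw [map_add, mul_add, ← add_smul]
      congr 1
      abel)

variable (q) in
theorem deltaM_apply (Δ : AddMonoid.End A) (m : M) :
    deltaM q b Δ m = (b.repr m).sum fun i a =>
      (Ring.inverse 2 * Δ (q (b i) (b (-i))) * Ring.inverse (q (b i) (b (-i))) * a + Δ a) • b i :=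
  rfl

variable (q ι) in
/-- `(Der_K A)_M = {Δ_M | Δ ∈ Der_K A}`. -/
noncomputable def derAM (𝒜 : ZMod 2 → AddSubgroup A) : AddSubgroup (AddMonoid.End M) :=
  (derA 𝒜 ι).map (AddMonoidHom.mk' (deltaM q b) (fun Δ Δ' => by
    refine end_ext fun m => ?_
    rw [end_add_apply, deltaM_apply, deltaM_apply, deltaM_apply, ← Finsupp.sum_add]
    refine Finsupp.sum_congr fun i _ => ?_
    simp only [end_add_apply, mul_add, add_mul, add_smul]
    abel))

/-- `{d_{S,0} | S ∈ 𝒮_E, S ∈ (Der_K A)_M}`. -/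
def outer (𝒜 : ZMod 2 → AddSubgroup A) (_ : IsOspSubalgebra ℳ q ι E) :
    AddSubgroup (AddMonoid.End (EInf A E)) where
  carrier := {d | ∃ S ∈ SS ℳ q ι E, S ∈ derAM q ι b 𝒜 ∧ IsD ℳ S d}
  add_mem' := by
    rintro d d' ⟨S, hS, hS', h⟩ ⟨T, hT, hT', h'⟩
    refine ⟨S + T, add_mem hS hT, add_mem hS' hT', fun u => ?_⟩
    obtain ⟨h1, h2, h3, h4⟩ := h u
    obtain ⟨k1, k2, k3, k4⟩ := h' u
    refine ⟨?_, ?_, ?_, ?_⟩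
    · rw [map_add, AddMonoidHom.add_apply, ← h1, ← k1, ← map_add, end_add_apply]; rfl
    · rw [end_add_apply, end_add_apply, ← h2, ← k2]; rfl
    · rw [end_add_apply, end_add_apply, ← h3, ← k3]; rfl
    · rw [end_add_apply, map_add, AddMonoidHom.add_apply]; exact congrArg₂ (· + ·) h4 k4
  zero_mem' := ⟨0, zero_mem _, zero_mem _, fun u => by simp⟩
  neg_mem' := by
    rintro d ⟨S, hS, hS', h⟩
    refine ⟨-S, neg_mem hS, neg_mem hS', fun u => ?_⟩
    obtain ⟨h1, h2, h3, h4⟩ := h u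
    refine ⟨?_, ?_, ?_, ?_⟩
    · rw [map_neg, AddMonoidHom.neg_apply, ← h1, ← map_neg]; rfl
    · rw [end_neg_apply, end_neg_apply, ← h2]; rfl
    · rw [end_neg_apply, end_neg_apply, ← h3]; rfl
    · rw [end_neg_apply, map_neg, AddMonoidHom.neg_apply]; exact congrArg (fun t => -t) h4

end Modules

end Super

set_option linter.unusedSimpArgs false
set_option linter.unusedSectionVars false

namespace Super

/-! Let `e = (1, 0, 0, 0)`. Its adjoint action is `0` on `A ⊕ 𝓔`, `1` on the first copy of `M` and
`-1` on the second, so it records a three-term grading of `𝓔_∞`. The proof normalises a homogeneous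
derivation `d` by inner ones until only a lift `Δ_M` is left.

Write `d e = (a, m, n, x)`. Subtracting `ad (0, -m, n, 0)` removes the two `M`-components of `d e`.
Applying `d` to `[e, v] = ±v` for `v` in either copy of `M` then gives `a v' ± x v' = 0`, and since
`2` is invertible, `d e = 0`. Now `d` commutes with `ad e`, hence preserves its eigenspaces: it acts
by maps `S`, `T` on the two copies of `M`, by `f` on `A` modulo an `𝓔`-component, and on `𝓔` with a
possible `A`-component.

The remaining defects are killed by one rigidity statement, `exists_eq_idA`: an `A`-linear `R` whose
brackets with `osp_fd(q)` are all scalars is itself a scalar. Bracketing with the diagonal operator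
`D` of weights `2i` makes `R` diagonal, because nonzero integers are invertible; bracketing with the
maps `E` of pairs of basis vectors makes its entries equal. The `𝓔`-component of `d` on `A`
centralises `𝓔`, so it is a scalar inside `osp(q)`, that is `0`. The difference `S - T` satisfies
the hypothesis too, so `S - T = r · Id`, and subtracting `ad (r/2, 0, 0, 0)` gives `S = T`. Then the
`A`-component on `𝓔` vanishes and `d = d_{S,0}`.

Here `S` differentiates the scalar action and the form through `f`, and `f` is a `K`-derivation of
`A`. The lift `f_M` does the same, so `S - f_M` is `A`-linear, skew for `q`, and normalises `𝓔`. By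
`normalizer_ospFd` it lies in `𝓔`, whence `d = ad (0, 0, 0, S - f_M) + d_{f_M,0}`.

The normaliser is computed with the same `D`, which lies in `osp_fd(q)`: the `(i, j)` entry of `[x,
D]` is `2(j - i)` times that of `x`, so away from the main diagonal `x` and `[x, D]` have the same
nonzero diagonals.

In the other direction, the Jacobi identity of `𝓔_∞` (`jacobi_fst` to `jacobi_fth`) makes `ad u` a
derivation, and `diagInf_leibniz` does so for `d_{S,0}`. Both rest on `IsDifferential`, which covers
the elements of `osp(q)` (with `f = 0`) and the lifts `Δ_M` at once. -/

theorem sgn_eq_one_or (α β : ZMod 2) : sgn α β = 1 ∨ sgn α β = -1 := by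
  revert α β; decide

theorem sgn_add_left (α β γ : ZMod 2) : sgn (α + β) γ = sgn α γ * sgn β γ := by
  revert α β γ; decide

theorem sgn_add_right (α β γ : ZMod 2) : sgn α (β + γ) = sgn α β * sgn α γ := by
  revert α β γ; decide

theorem sgn_comm (α β : ZMod 2) : sgn α β = sgn β α := by
  revert α β; decide

theorem sgn_zero_left (α : ZMod 2) : sgn 0 α = 1 := by
  revert α; decide

theorem sgn_zero_right (α : ZMod 2) : sgn α 0 = 1 := by
  revert α; decide

theorem sgn_mul_self (α β : ZMod 2) : sgn α β * sgn α β = 1 := by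
  revert α β; decide

theorem sgn_smul_smul {V : Type*} [AddCommGroup V] (α β : ZMod 2) (v : V) :
    sgn α β • sgn α β • v = v := by
  rw [smul_smul, sgn_mul_self, one_smul]

theorem end_mul_apply {V : Type*} [AddCommGroup V] (f g : AddMonoid.End V) (v : V) :
    (f * g) v = f (g v) := rfl

theorem end_sub_apply {V : Type*} [AddCommGroup V] (f g : AddMonoid.End V) (v : V) :
    (f - g) v = f v - g v := rfl

theorem end_zero_apply {V : Type*} [AddCommGroup V] (v : V) :
    (0 : AddMonoid.End V) v = 0 := rfl

theorem end_zsmul_apply {V : Type*} [AddCommGroup V] (n : ℤ) (f : AddMonoid.End V) (v : V) :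
    (n • f) v = n • f v := rfl

theorem end_sum_apply {V ι : Type*} [AddCommGroup V] (s : Finset ι) (f : ι → AddMonoid.End V)
    (v : V) : (∑ i ∈ s, f i) v = ∑ i ∈ s, f i v :=
  map_sum (AddMonoidHom.eval v : AddMonoid.End V →+ V) f s

/-! ### Homogeneous components, degrees of endomorphisms, and the supercommutator -/

section Graded

variable {V : Type*} [AddCommGroup V] (𝒱 : ZMod 2 → AddSubgroup V)

theorem mul_mem_endDeg {f g : AddMonoid.End V} {α β : ZMod 2} (hf : f ∈ endDeg 𝒱 α)
    (hg : g ∈ endDeg 𝒱 β) : f * g ∈ endDeg 𝒱 (α + β) := fun γ v hv => by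
  rw [add_assoc]; exact hf _ _ (hg _ _ hv)

theorem bracket_mem_endDeg {f g : AddMonoid.End V} {α β : ZMod 2} (hf : f ∈ endDeg 𝒱 α)
    (hg : g ∈ endDeg 𝒱 β) : f * g - sgn α β • (g * f) ∈ endDeg 𝒱 (α + β) := by
  refine sub_mem (mul_mem_endDeg 𝒱 hf hg) (zsmul_mem ?_ _)
  rw [add_comm]; exact mul_mem_endDeg 𝒱 hg hf

variable [DirectSum.Decomposition 𝒱]

theorem proj_mem (α : ZMod 2) (v : V) : proj 𝒱 α v ∈ 𝒱 α := SetLike.coe_mem _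

theorem proj_same {α : ZMod 2} {v : V} (hv : v ∈ 𝒱 α) : proj 𝒱 α v = v :=
  DirectSum.decompose_of_mem_same 𝒱 hv

theorem proj_ne {α β : ZMod 2} {v : V} (hv : v ∈ 𝒱 α) (h : α ≠ β) : proj 𝒱 β v = 0 :=
  DirectSum.decompose_of_mem_ne 𝒱 hv h

theorem sum_proj (v : V) : ∑ α, proj 𝒱 α v = v := by
  classical
  conv_rhs => rw [← DirectSum.sum_support_decompose 𝒱 v]
  refine (Finset.sum_subset (Finset.subset_univ _) fun α _ h => ?_).symm
  exact (ZeroMemClass.coe_eq_zero).2 (DFinsupp.notMem_support_iff.1 h)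

theorem proj_add_proj (v : V) : proj 𝒱 0 v + proj 𝒱 1 v = v := by
  conv_rhs => rw [← sum_proj 𝒱 v]
  exact (Fin.sum_univ_two (fun α => proj 𝒱 α v)).symm

theorem eq_zero_of_mem_mem {α β : ZMod 2} (h : α ≠ β) {v : V} (hα : v ∈ 𝒱 α) (hβ : v ∈ 𝒱 β) :
    v = 0 := by
  rw [← proj_same 𝒱 hβ, proj_ne 𝒱 hα h]

/-- Two additive maps that agree on homogeneous elements are equal. -/
theorem hom_ext_homogeneous {W : Type*} [AddCommGroup W] {f g : V →+ W}
    (h : ∀ α, ∀ v ∈ 𝒱 α, f v = g v) : f = g := by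
  ext v
  rw [← proj_add_proj 𝒱 v, map_add, map_add, h _ _ (proj_mem 𝒱 0 v), h _ _ (proj_mem 𝒱 1 v)]

theorem end_ext_homogeneous {f g : AddMonoid.End V}
    (h : ∀ α, ∀ v ∈ 𝒱 α, f v = g v) : f = g := hom_ext_homogeneous 𝒱 (f := f) (g := g) h

theorem end_eq_zero_of_mem_mem {α β : ZMod 2} (h : α ≠ β) {f : AddMonoid.End V}
    (hα : f ∈ endDeg 𝒱 α) (hβ : f ∈ endDeg 𝒱 β) : f = 0 :=
  end_ext_homogeneous 𝒱 fun γ v hv =>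
    eq_zero_of_mem_mem 𝒱 (fun e => h (add_right_cancel e)) (hα γ v hv) (hβ γ v hv)

theorem part_apply_of_mem (α : ZMod 2) (f : AddMonoid.End V) {β : ZMod 2} {v : V}
    (hv : v ∈ 𝒱 β) : part 𝒱 α f v = proj 𝒱 (α + β) (f v) := by
  change (∑ γ, proj 𝒱 (α + γ) * f * proj 𝒱 γ) v = _
  rw [end_sum_apply, Finset.sum_eq_single β]
  · rw [end_mul_apply, end_mul_apply, proj_same 𝒱 hv]
  · intro γ _ h
    rw [end_mul_apply, proj_ne 𝒱 hv h.symm, map_zero]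
  · simp

theorem part_mem (α : ZMod 2) (f : AddMonoid.End V) : part 𝒱 α f ∈ endDeg 𝒱 α :=
  fun β v hv => by rw [part_apply_of_mem 𝒱 α f hv]; exact proj_mem 𝒱 _ _

theorem part_same {α : ZMod 2} {f : AddMonoid.End V} (hf : f ∈ endDeg 𝒱 α) : part 𝒱 α f = f :=
  end_ext_homogeneous 𝒱 fun β v hv => by
    rw [part_apply_of_mem 𝒱 α f hv, proj_same 𝒱 (hf β v hv)]

theorem part_ne {α β : ZMod 2} {f : AddMonoid.End V} (hf : f ∈ endDeg 𝒱 α) (h : α ≠ β) :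
    part 𝒱 β f = 0 :=
  end_ext_homogeneous 𝒱 fun γ v hv => by
    rw [part_apply_of_mem 𝒱 β f hv, proj_ne 𝒱 (hf γ v hv) (fun e => h (add_right_cancel e)),
      end_zero_apply]

theorem part_add_part (f : AddMonoid.End V) : part 𝒱 0 f + part 𝒱 1 f = f :=
  end_ext_homogeneous 𝒱 fun β v hv => by
    rw [end_add_apply, part_apply_of_mem 𝒱 _ f hv, part_apply_of_mem 𝒱 _ f hv]
    conv_rhs => rw [← proj_add_proj 𝒱 (f v)]
    have : ∀ β : ZMod 2, β = 0 ∨ β = 1 := by decide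
    rcases this β with rfl | rfl
    · rfl
    · rw [add_comm]; rfl

theorem sbr_of_mem {α β : ZMod 2} {f g : AddMonoid.End V} (hf : f ∈ endDeg 𝒱 α)
    (hg : g ∈ endDeg 𝒱 β) : sbr 𝒱 f g = f * g - sgn α β • (g * f) := by
  change ∑ γ, ∑ δ, (part 𝒱 γ f * part 𝒱 δ g - sgn γ δ • (part 𝒱 δ g * part 𝒱 γ f)) = _
  rw [Finset.sum_eq_single α, Finset.sum_eq_single β]
  · rw [part_same 𝒱 hf, part_same 𝒱 hg]
  · intro δ _ h; rw [part_ne 𝒱 hg h.symm]; simp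
  · simp
  · intro γ _ h; rw [part_ne 𝒱 hf h.symm]; simp
  · simp

theorem sact_of_mem {α β : ZMod 2} {f : AddMonoid.End V} {v : V} (hf : f ∈ endDeg 𝒱 α)
    (hv : v ∈ 𝒱 β) : sact 𝒱 f v = sgn α β • f v := by
  change ∑ γ, ∑ δ, sgn γ δ • part 𝒱 γ f (proj 𝒱 δ v) = _
  rw [Finset.sum_eq_single α, Finset.sum_eq_single β]
  · rw [part_same 𝒱 hf, proj_same 𝒱 hv]
  · intro δ _ h; rw [proj_ne 𝒱 hv h.symm]; simp
  · simp
  · intro γ _ h; rw [part_ne 𝒱 hf h.symm]; simp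
  · simp

theorem sbr_mem_endDeg {α β : ZMod 2} {f g : AddMonoid.End V} (hf : f ∈ endDeg 𝒱 α)
    (hg : g ∈ endDeg 𝒱 β) : sbr 𝒱 f g ∈ endDeg 𝒱 (α + β) := by
  rw [sbr_of_mem 𝒱 hf hg]; exact bracket_mem_endDeg 𝒱 hf hg

/-- The super Jacobi identity for homogeneous endomorphisms. -/
theorem sbr_sbr {α β γ : ZMod 2} {f g h : AddMonoid.End V} (hf : f ∈ endDeg 𝒱 α)
    (hg : g ∈ endDeg 𝒱 β) (hh : h ∈ endDeg 𝒱 γ) :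
    sbr 𝒱 f (sbr 𝒱 g h) = sbr 𝒱 (sbr 𝒱 f g) h + sgn α β • sbr 𝒱 g (sbr 𝒱 f h) := by
  rw [sbr_of_mem 𝒱 hf (sbr_mem_endDeg 𝒱 hg hh), sbr_of_mem 𝒱 (sbr_mem_endDeg 𝒱 hf hg) hh,
    sbr_of_mem 𝒱 hg (sbr_mem_endDeg 𝒱 hf hh), sbr_of_mem 𝒱 hf hg, sbr_of_mem 𝒱 hg hh,
    sbr_of_mem 𝒱 hf hh, sgn_add_left, sgn_add_right, sgn_add_right, sgn_comm β α]
  -- The Koszul signs have been expanded into pairwise signs of the original degrees. Each of these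
  -- is `1` or `-1`, so every case is an identity in an abelian group. The sign computations below
  -- follow this pattern.
  rcases sgn_eq_one_or α β with h1 | h1 <;> rcases sgn_eq_one_or α γ with h2 | h2 <;>
    rcases sgn_eq_one_or β γ with h3 | h3 <;> simp only [h1, h2, h3] <;>
    simp only [one_smul, neg_smul, mul_neg, mul_one, neg_neg, mul_add, add_mul, mul_sub, sub_mul,
      sub_neg_eq_add, mul_assoc] <;> abel

theorem isGradedSub_of_part_mem {N : AddSubgroup (AddMonoid.End V)}
    (h : ∀ f ∈ N, ∀ α, part 𝒱 α f ∈ N) : IsGradedSub (endDeg 𝒱) N := fun f hf => by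
  rw [← part_add_part 𝒱 f]
  exact add_mem (AddSubgroup.mem_iSup_of_mem 0 ⟨h f hf 0, part_mem 𝒱 0 f⟩)
    (AddSubgroup.mem_iSup_of_mem 1 ⟨h f hf 1, part_mem 𝒱 1 f⟩)

/-- On each homogeneous piece of `N` the map `part 𝒱 α` is either the identity or zero, so it sends
the span of these pieces into `N`. -/
theorem part_mem_of_isGradedSub {N : AddSubgroup (AddMonoid.End V)}
    (h : IsGradedSub (endDeg 𝒱) N) {f : AddMonoid.End V} (hf : f ∈ N) (α : ZMod 2) :
    part 𝒱 α f ∈ N := by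
  have h1 : (⨆ β, N ⊓ endDeg 𝒱 β) ≤ N.comap (part 𝒱 α) := by
    refine iSup_le fun β g hg => ?_
    by_cases e : β = α
    · subst e
      rw [AddSubgroup.mem_comap, part_same 𝒱 hg.2]; exact hg.1
    · rw [AddSubgroup.mem_comap, part_ne 𝒱 hg.2 e]; exact zero_mem _
  exact h1 (h hf)

end Graded

theorem exists_add_of_isGradedSub {V : Type*} [AddCommGroup V] {𝒱 : ZMod 2 → AddSubgroup V}
    {N : AddSubgroup V} (h : IsGradedSub 𝒱 N) {v : V} (hv : v ∈ N) :
    ∃ v₀ ∈ N ⊓ 𝒱 0, ∃ v₁ ∈ N ⊓ 𝒱 1, v = v₀ + v₁ := by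
  have h1 : (⨆ α, N ⊓ 𝒱 α) ≤ (N ⊓ 𝒱 0) ⊔ (N ⊓ 𝒱 1) := by
    refine iSup_le fun α => ?_
    have : ∀ β : ZMod 2, β = 0 ∨ β = 1 := by decide
    rcases this α with rfl | rfl
    · exact le_sup_left
    · exact le_sup_right
  obtain ⟨y, hy, z, hz, e⟩ := AddSubgroup.mem_sup.1 (h1 (h hv))
  exact ⟨y, hy, z, hz, e.symm⟩

/-- Additive conditions on a graded subgroup may be tested on homogeneous elements. -/
theorem IsGradedSub.induction {V : Type*} [AddCommGroup V] {𝒱 : ZMod 2 → AddSubgroup V}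
    {N : AddSubgroup V} (h : IsGradedSub 𝒱 N) {P : V → Prop}
    (hom : ∀ α, ∀ v ∈ N, v ∈ 𝒱 α → P v) (add : ∀ v w, P v → P w → P (v + w)) {v : V}
    (hv : v ∈ N) : P v := by
  obtain ⟨y, hy, z, hz, rfl⟩ := exists_add_of_isGradedSub h hv
  exact add _ _ (hom _ _ hy.1 hy.2) (hom _ _ hz.1 hz.2)

theorem homogeneous_induction {V : Type*} [AddCommGroup V] (𝒱 : ZMod 2 → AddSubgroup V)
    [DirectSum.Decomposition 𝒱] {P : V → Prop}
    (hom : ∀ α, ∀ v ∈ 𝒱 α, P v) (add : ∀ v w, P v → P w → P (v + w)) (v : V) : P v := by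
  rw [← proj_add_proj 𝒱 v]
  exact add _ _ (hom _ _ (proj_mem 𝒱 _ _)) (hom _ _ (proj_mem 𝒱 _ _))

/-! ### Spans and brackets of homogeneous derivations -/

section Derivations

variable {V : Type*} [AddCommGroup V] {𝒱 : ZMod 2 → AddSubgroup V} {μ : V →+ V →+ V}
  {L : AddSubgroup (AddMonoid.End V)}

theorem IsDerivationDeg.add {α : ZMod 2} {d d' : AddMonoid.End V}
    (h : IsDerivationDeg 𝒱 μ L α d) (h' : IsDerivationDeg 𝒱 μ L α d') :
    IsDerivationDeg 𝒱 μ L α (d + d') :=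
  ⟨add_mem h.1 h'.1, add_mem h.2.1 h'.2.1, fun β x hx y => by
    simp only [end_add_apply, map_add, AddMonoidHom.add_apply, h.2.2 β x hx y, h'.2.2 β x hx y,
      smul_add]
    abel⟩

theorem IsDerivationDeg.neg {α : ZMod 2} {d : AddMonoid.End V}
    (h : IsDerivationDeg 𝒱 μ L α d) : IsDerivationDeg 𝒱 μ L α (-d) :=
  ⟨neg_mem h.1, neg_mem h.2.1, fun β x hx y => by
    simp only [end_neg_apply, map_neg, AddMonoidHom.neg_apply, h.2.2 β x hx y, smul_neg]
    abel⟩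

theorem IsDerivationDeg.zero (α : ZMod 2) : IsDerivationDeg 𝒱 μ L α 0 :=
  ⟨zero_mem _, zero_mem _, fun β x hx y => by simp⟩

theorem IsDerivationDeg.mem_Der {α : ZMod 2} {d : AddMonoid.End V}
    (h : IsDerivationDeg 𝒱 μ L α d) : d ∈ Der 𝒱 μ L :=
  AddSubgroup.subset_closure ⟨α, h⟩

theorem exists_of_mem_Der {d : AddMonoid.End V} (h : d ∈ Der 𝒱 μ L) :
    ∃ d₀ d₁, IsDerivationDeg 𝒱 μ L 0 d₀ ∧ IsDerivationDeg 𝒱 μ L 1 d₁ ∧ d = d₀ + d₁ := by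
  have hz : ∀ β : ZMod 2, β = 0 ∨ β = 1 := by decide
  refine AddSubgroup.closure_induction (fun x hx => ?_) ?_ ?_ ?_ h
  · obtain ⟨α, hx⟩ := hx
    rcases hz α with rfl | rfl
    · exact ⟨x, 0, hx, .zero 1, (add_zero _).symm⟩
    · exact ⟨0, x, .zero 0, hx, (zero_add _).symm⟩
  · exact ⟨0, 0, .zero 0, .zero 1, (add_zero _).symm⟩
  · rintro x y _ _ ⟨x₀, x₁, h0, h1, rfl⟩ ⟨y₀, y₁, k0, k1, rfl⟩
    exact ⟨_, _, h0.add k0, h1.add k1, add_add_add_comm _ _ _ _⟩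
  · rintro x _ ⟨x₀, x₁, h0, h1, rfl⟩
    exact ⟨_, _, h0.neg, h1.neg, neg_add _ _⟩

theorem Der_le {H : AddSubgroup (AddMonoid.End V)}
    (h : ∀ α d, IsDerivationDeg 𝒱 μ L α d → d ∈ H) : Der 𝒱 μ L ≤ H :=
  (AddSubgroup.closure_le _).2 fun d ⟨α, hd⟩ => h α d hd

/-- Split into an even and an odd derivation: the part of the wrong degree is a difference of maps
of degree `α`, hence of both degrees, hence zero. Disjointness of the degrees is a hypothesis, so
that the lemma applies to `gradInf`, which carries no decomposition instance. -/
theorem isDerivationDeg_of_mem_Der {α : ZMod 2} {d : AddMonoid.End V}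
    (hdis : ∀ f ∈ endDeg 𝒱 0, f ∈ endDeg 𝒱 1 → f = 0) (h : d ∈ Der 𝒱 μ L) (hd : d ∈ endDeg 𝒱 α) :
    IsDerivationDeg 𝒱 μ L α d := by
  obtain ⟨d₀, d₁, h0, h1, rfl⟩ := exists_of_mem_Der h
  have hz : ∀ β : ZMod 2, β = 0 ∨ β = 1 := by decide
  rcases hz α with rfl | rfl
  · have : d₁ ∈ endDeg 𝒱 0 := by simpa using sub_mem hd h0.2.1
    rw [hdis _ this h1.2.1, add_zero]
    exact h0
  · have : d₀ ∈ endDeg 𝒱 1 := by simpa using sub_mem hd h1.2.1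
    rw [hdis _ h0.2.1 this, zero_add]
    exact h1

theorem IsDerivationDeg.bracket {α β : ZMod 2} {d d' : AddMonoid.End V}
    (hL : ∀ f ∈ L, ∀ g ∈ L, f * g ∈ L)
    (h : IsDerivationDeg 𝒱 μ L α d) (h' : IsDerivationDeg 𝒱 μ L β d') :
    IsDerivationDeg 𝒱 μ L (α + β) (d * d' - sgn α β • (d' * d)) := by
  refine ⟨sub_mem (hL _ h.1 _ h'.1) (zsmul_mem (hL _ h'.1 _ h.1) _),
    bracket_mem_endDeg 𝒱 h.2.1 h'.2.1, fun γ x hx y => ?_⟩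
  simp only [end_sub_apply, end_zsmul_apply, end_mul_apply, h.2.2 γ x hx y, h'.2.2 γ x hx y,
    map_add, map_sub, map_zsmul, h.2.2 _ _ (h'.2.1 _ _ hx) y, h'.2.2 _ _ (h.2.1 _ _ hx) y,
    h.2.2 γ x hx (d' y), h'.2.2 γ x hx (d y), sgn_add_left, sgn_add_right,
    AddMonoidHom.sub_apply, AddMonoidHom.smul_apply, sgn_comm β α]
  rcases sgn_eq_one_or α β with h1 | h1 <;> rcases sgn_eq_one_or α γ with h2 | h2 <;>
    rcases sgn_eq_one_or β γ with h3 | h3 <;> simp only [h1, h2, h3] <;>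
    simp only [one_smul, neg_smul, mul_neg, mul_one, neg_neg, smul_add, sub_neg_eq_add,
      smul_sub, smul_neg] <;> abel

end Derivations

/-! ### Supermodules, quadratic forms and skew-adjoint maps -/

section Modules

variable {K A M : Type*} [Ring K] [Ring A] [AddCommGroup M] [Module A M] [Module Aᵐᵒᵖ M]
  [SMulCommClass A Aᵐᵒᵖ M]
  {𝒜 : ZMod 2 → AddSubgroup A} {ℳ : ZMod 2 → AddSubgroup M} {q : M →+ M →+ A}

omit [Module Aᵐᵒᵖ M] [SMulCommClass A Aᵐᵒᵖ M] in
theorem idA_add (a b : A) : idA M (a + b) = idA M a + idA M b := map_add _ a b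

omit [Module Aᵐᵒᵖ M] [SMulCommClass A Aᵐᵒᵖ M] in
theorem idA_mul (a b : A) : idA M (a * b) = idA M a * idA M b := map_mul _ a b

omit [Module Aᵐᵒᵖ M] [SMulCommClass A Aᵐᵒᵖ M] in
theorem idA_apply (a : A) (m : M) : idA M a m = a • m := rfl

omit [Module A M] [SMulCommClass A Aᵐᵒᵖ M] in
theorem linEnd_id_apply {f : AddMonoid.End M} (hf : f ∈ linEnd M (RingHom.id A)) (a : A) (m : M) :
    f (op a • m) = op a • f m := hf a m

omit [Module A M] [SMulCommClass A Aᵐᵒᵖ M] in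
theorem linEnd_mul_mem {ι : K →+* A} {f g : AddMonoid.End M} (hf : f ∈ linEnd M ι)
    (hg : g ∈ linEnd M ι) : f * g ∈ linEnd M ι := fun k m => by
  rw [end_mul_apply, end_mul_apply, hg k m, hf k]

theorem idA_mem_linEnd (a : A) : idA M a ∈ linEnd M (RingHom.id A) := fun b m =>
  smul_comm a (op b) m

section Supermodule

variable (hM : IsSupermodule 𝒜 ℳ)
include hM

theorem IsSupermodule.op_smul {α β : ZMod 2} {a : A} (ha : a ∈ 𝒜 α) {m : M} (hm : m ∈ ℳ β) :
    op a • m = sgn α β • (a • m) := by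
  rw [hM.smul_eq α β a ha m hm, sgn_smul_smul]

theorem IsSupermodule.op_smul_mem {α β : ZMod 2} {a : A} (ha : a ∈ 𝒜 α) {m : M} (hm : m ∈ ℳ β) :
    op a • m ∈ ℳ (α + β) := by
  rw [hM.op_smul ha hm]; exact zsmul_mem (hM.smul_mem α β a ha m hm) _

theorem IsSupermodule.idA_mem {α : ZMod 2} {a : A} (ha : a ∈ 𝒜 α) : idA M a ∈ endDeg ℳ α :=
  fun β m hm => hM.smul_mem α β a ha m hm

/-- Right linear homogeneous maps are left linear up to sign. -/
theorem IsSupermodule.map_smul [DirectSum.Decomposition ℳ] {ξ α : ZMod 2} {x : AddMonoid.End M}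
    (hx : x ∈ endDeg ℳ ξ) {a : A} (hxa : ∀ m, x (op a • m) = op a • x m) (ha : a ∈ 𝒜 α) (m : M) :
    x (a • m) = sgn ξ α • (a • x m) := by
  revert m
  refine homogeneous_induction ℳ (fun β m hm => ?_) fun m n h h' => ?_
  · rw [hM.smul_eq α β a ha m hm, map_zsmul, hxa, hM.op_smul ha (hx β m hm), smul_smul,
      sgn_add_right, sgn_comm ξ α]
    rcases sgn_eq_one_or α β with h1 | h1 <;> simp [h1]
  · rw [smul_add, map_add, map_add, h, h', smul_add, smul_add]

theorem IsSupermodule.mul_idA [DirectSum.Decomposition ℳ] {ξ α : ZMod 2} {x : AddMonoid.End M}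
    (hx : x ∈ endDeg ℳ ξ) (hxl : x ∈ linEnd M (RingHom.id A)) {a : A} (ha : a ∈ 𝒜 α) :
    x * idA M a = sgn ξ α • (idA M a * x) :=
  end_ext fun m => hM.map_smul hx (hxl a) ha m

theorem IsSupermodule.proj_op_smul [DirectSum.Decomposition ℳ] {α β : ZMod 2} {a : A}
    (ha : a ∈ 𝒜 α) (m : M) : proj ℳ (α + β) (op a • m) = op a • proj ℳ β m := by
  revert m
  refine homogeneous_induction ℳ (fun γ m hm => ?_) fun m n h h' => ?_
  · by_cases h : γ = β
    · subst h
      rw [proj_same ℳ hm, proj_same ℳ (hM.op_smul_mem ha hm)]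
    · rw [proj_ne ℳ hm h, proj_ne ℳ (hM.op_smul_mem ha hm) (by simpa using h), smul_zero]
  · rw [smul_add, map_add, map_add, h, h', smul_add]

theorem IsSupermodule.part_map_op_smul [DirectSum.Decomposition ℳ]
    {α ξ : ZMod 2} {x : AddMonoid.End M} {a : A} (hxa : ∀ m, x (op a • m) = op a • x m)
    (ha : a ∈ 𝒜 α) (m : M) : part ℳ ξ x (op a • m) = op a • part ℳ ξ x m := by
  revert m
  refine homogeneous_induction ℳ (fun γ m hm => ?_) fun m n h h' => ?_
  · rw [part_apply_of_mem ℳ ξ x hm, part_apply_of_mem ℳ ξ x (hM.op_smul_mem ha hm), hxa,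
      ← hM.proj_op_smul ha]
    congr 2
    abel
  · rw [smul_add, map_add, map_add, h, h', smul_add]

/-- Taking a component of degree `ξ` commutes with the right action of a homogeneous scalar, because
that action shifts degrees by a constant; general scalars follow by additivity. -/
theorem IsSupermodule.part_mem_linEnd [DirectSum.Decomposition 𝒜] [DirectSum.Decomposition ℳ]
    {x : AddMonoid.End M} (hx : x ∈ linEnd M (RingHom.id A)) (ξ : ZMod 2) :
    part ℳ ξ x ∈ linEnd M (RingHom.id A) := fun a => by
  refine homogeneous_induction 𝒜 (P := fun a => ∀ m, part ℳ ξ x (op a • m) = op a • part ℳ ξ x m)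
    (fun α a ha m => hM.part_map_op_smul (hx a) ha m) (fun a b h h' m => ?_) a
  rw [op_add, add_smul, map_add, h, h', add_smul]

end Supermodule

section Form

variable [GradedRing 𝒜] [DirectSum.Decomposition ℳ] (hA : IsSupercommutative 𝒜)
  (hM : IsSupermodule 𝒜 ℳ) (hq : IsQuadraticForm 𝒜 ℳ q)

include hA hM hq

/-- Left linearity is not an axiom of the form. It comes from right linearity in the second
variable: swap the arguments by supersymmetry, move the scalar to the right and back by
supercommutativity, and check that the signs cancel. -/
theorem IsQuadraticForm.smul_left (a : A) (m n : M) : q (a • m) n = a * q m n := by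
  revert a
  refine homogeneous_induction 𝒜 (fun α a ha => ?_) fun a b h h' => ?_
  · revert m
    refine homogeneous_induction ℳ (fun β m hm => ?_) fun m m' h h' => ?_
    · revert n
      refine homogeneous_induction ℳ (fun γ n hn => ?_) fun n n' h h' => ?_
      · rw [hq.supersymm _ _ _ (hM.smul_mem α β a ha m hm) _ hn, hM.smul_eq α β a ha m hm,
          map_zsmul, hq.map_right, hq.supersymm _ _ _ hn _ hm, hA α _ a ha _ (hq.degree _ _ m hm n hn),
          sgn_add_left, sgn_add_right, sgn_comm γ β]
        rcases sgn_eq_one_or α β with h1 | h1 <;> rcases sgn_eq_one_or α γ with h2 | h2 <;>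
          rcases sgn_eq_one_or β γ with h3 | h3 <;> simp [h1, h2, h3]
      · rw [map_add, map_add, h, h', mul_add]
    · rw [smul_add, map_add, map_add, AddMonoidHom.add_apply, AddMonoidHom.add_apply, h, h',
        mul_add]
  · rw [add_smul, map_add, AddMonoidHom.add_apply, h, h', add_mul]

theorem IsQuadraticForm.smul_right {α β : ZMod 2} {a : A} (ha : a ∈ 𝒜 α) {m : M} (hm : m ∈ ℳ β)
    (n : M) : q m (a • n) = sgn α β • (a * q m n) := by
  rw [← hq.balanced, hM.op_smul ha hm, map_zsmul, AddMonoidHom.smul_apply, hq.smul_left hA hM]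

theorem IsQuadraticForm.proj_left {β γ : ZMod 2} (v : M) {n : M} (hn : n ∈ ℳ γ) :
    q (proj ℳ β v) n = proj 𝒜 (β + γ) (q v n) := by
  have := hA
  have := hM
  revert v
  refine homogeneous_induction ℳ (fun δ v hv => ?_) fun v w h h' => ?_
  · by_cases h : δ = β
    · subst h
      rw [proj_same ℳ hv, proj_same 𝒜 (hq.degree _ _ v hv n hn)]
    · rw [proj_ne ℳ hv h, proj_ne 𝒜 (hq.degree _ _ v hv n hn) (by simpa using h), map_zero,
        AddMonoidHom.zero_apply]
  · rw [map_add, map_add, AddMonoidHom.add_apply, h, h', map_add, AddMonoidHom.add_apply, map_add]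

omit hA hM [GradedRing 𝒜] [SMulCommClass A Aᵐᵒᵖ M] in
-- The defining relation of `osp(q)`, with the second term turned round by supersymmetry: `x` is
-- skew-adjoint with its own Koszul sign. In this form `n` need not be homogeneous, and compositions
-- are easy to handle.
theorem osp_adjoint {ξ β : ZMod 2} {x : AddMonoid.End M} (hx : x ∈ osp ℳ q) (hξ : x ∈ endDeg ℳ ξ)
    {m : M} (hm : m ∈ ℳ β) (n : M) : q (x m) n = -(sgn ξ β • q m (x n)) := by
  revert n
  refine homogeneous_induction ℳ (fun γ n hn => ?_) fun v w h h' => ?_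
  · have h := hx.2 β γ m hm n hn
    rw [hq.supersymm _ _ _ (hξ γ n hn) _ hm, smul_smul, sgn_add_left, sgn_comm γ β] at h
    rw [eq_neg_iff_add_eq_zero, ← h]
    rcases sgn_eq_one_or β γ with h1 | h1 <;> simp [h1]
  · rw [map_add, map_add, map_add, h, h', smul_add]; abel

omit hA hM [GradedRing 𝒜] [SMulCommClass A Aᵐᵒᵖ M] [DirectSum.Decomposition ℳ] in
theorem mem_osp_of_adjoint {ξ : ZMod 2} {x : AddMonoid.End M}
    (hl : x ∈ linEnd M (RingHom.id A)) (hξ : x ∈ endDeg ℳ ξ)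
    (h : ∀ β, ∀ m ∈ ℳ β, ∀ γ, ∀ n ∈ ℳ γ, q (x m) n = -(sgn ξ β • q m (x n))) : x ∈ osp ℳ q := by
  refine ⟨hl, fun β γ m hm n hn => ?_⟩
  rw [h β m hm γ n hn, hq.supersymm _ _ _ (hξ γ n hn) _ hm, smul_smul, sgn_add_left, sgn_comm γ β]
  rcases sgn_eq_one_or β γ with h1 | h1 <;> simp [h1]

theorem part_mem_osp {x : AddMonoid.End M} (hx : x ∈ osp ℳ q) (ξ : ZMod 2) :
    part ℳ ξ x ∈ osp ℳ q := by
  refine ⟨hM.part_mem_linEnd hx.1 ξ, fun β γ m hm n hn => ?_⟩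
  rw [part_apply_of_mem ℳ ξ x hm, part_apply_of_mem ℳ ξ x hn, hq.proj_left hA hM _ hn,
    hq.proj_left hA hM _ hm, add_assoc, add_assoc, add_comm γ β, ← map_zsmul, ← map_add,
    hx.2 β γ m hm n hn, map_zero]

theorem idA_mul_mem_osp (a : A) {x : AddMonoid.End M} (hx : x ∈ osp ℳ q) :
    idA M a * x ∈ osp ℳ q := by
  refine ⟨linEnd_mul_mem (idA_mem_linEnd a) hx.1, fun β γ m hm n hn => ?_⟩
  rw [end_mul_apply, end_mul_apply, idA_apply, idA_apply, hq.smul_left hA hM, hq.smul_left hA hM,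
    ← mul_smul_comm, ← mul_add, hx.2 β γ m hm n hn, mul_zero]

omit hA hM [SMulCommClass A Aᵐᵒᵖ M] [GradedRing 𝒜] in
theorem bracket_mem_osp {ξ η : ZMod 2} {x y : AddMonoid.End M} (hx : x ∈ osp ℳ q)
    (hξ : x ∈ endDeg ℳ ξ) (hy : y ∈ osp ℳ q) (hη : y ∈ endDeg ℳ η) : sbr ℳ x y ∈ osp ℳ q := by
  rw [sbr_of_mem ℳ hξ hη]
  refine mem_osp_of_adjoint hq (sub_mem (linEnd_mul_mem hx.1 hy.1)
    (zsmul_mem (linEnd_mul_mem hy.1 hx.1) _)) (bracket_mem_endDeg ℳ hξ hη) fun β m hm γ n hn => ?_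
  simp only [end_sub_apply, end_zsmul_apply, end_mul_apply, map_sub, map_zsmul,
    AddMonoidHom.sub_apply, AddMonoidHom.smul_apply, osp_adjoint hq hx hξ (hη β m hm),
    osp_adjoint hq hy hη (hξ β m hm), osp_adjoint hq hx hξ hm, osp_adjoint hq hy hη hm,
    sgn_add_left, sgn_add_right, sgn_comm η ξ]
  rcases sgn_eq_one_or ξ η with h1 | h1 <;> rcases sgn_eq_one_or ξ β with h2 | h2 <;>
    rcases sgn_eq_one_or η β with h3 | h3 <;> simp only [h1, h2, h3] <;>
    simp only [one_smul, neg_smul, mul_neg, mul_one, neg_neg, sub_neg_eq_add] <;> abel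

end Form

/-! ### The maps E and their symmetry, linearity and skewness -/

section EE

variable [DirectSum.Decomposition ℳ]

omit [SMulCommClass A Aᵐᵒᵖ M] in
theorem EE_apply_of_mem {β γ : ZMod 2} (m : M) {n p : M} (hn : n ∈ ℳ β) (hp : p ∈ ℳ γ) :
    EE ℳ q m n p = op (q n p) • m - sgn β γ • (q m p • n) := by
  change op (q n p) • m - ∑ β, ∑ γ, sgn β γ • (q m (proj ℳ γ p) • proj ℳ β n) = _
  rw [Finset.sum_eq_single β, Finset.sum_eq_single γ]
  · rw [proj_same ℳ hn, proj_same ℳ hp]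
  · intro δ _ h; rw [proj_ne ℳ hp h.symm]; simp
  · simp
  · intro δ _ h; rw [proj_ne ℳ hn h.symm]; simp
  · simp

variable [GradedRing 𝒜] (hA : IsSupercommutative 𝒜)
  (hM : IsSupermodule 𝒜 ℳ) (hq : IsQuadraticForm 𝒜 ℳ q)

include hM hq

omit [GradedRing 𝒜] in
/-- `E_{m,n}` with all scalars on the left. -/
theorem EE_apply_left {α β γ : ZMod 2} {m n p : M} (hm : m ∈ ℳ α) (hn : n ∈ ℳ β) (hp : p ∈ ℳ γ) :
    EE ℳ q m n p = (sgn β α * sgn γ α) • (q n p • m) - sgn β γ • (q m p • n) := by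
  rw [EE_apply_of_mem m hn hp, hM.op_smul (hq.degree _ _ n hn p hp) hm, sgn_add_left]

omit [GradedRing 𝒜] in
theorem EE_mem_endDeg {α β : ZMod 2} {m n : M} (hm : m ∈ ℳ α) (hn : n ∈ ℳ β) :
    EE ℳ q m n ∈ endDeg ℳ (α + β) := fun γ p hp => by
  rw [EE_apply_of_mem m hn hp]
  refine sub_mem ?_ (zsmul_mem ?_ _)
  · rw [show α + β + γ = (β + γ) + α by abel]
    exact hM.op_smul_mem (hq.degree _ _ n hn p hp) hm
  · rw [show α + β + γ = (α + γ) + β by abel]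
    exact hM.smul_mem _ _ _ (hq.degree _ _ m hm p hp) n hn

omit [GradedRing 𝒜] in
theorem EE_symm {α β : ZMod 2} {m n : M} (hm : m ∈ ℳ α) (hn : n ∈ ℳ β) :
    EE ℳ q m n = -(sgn α β • EE ℳ q n m) := by
  refine end_ext_homogeneous ℳ fun γ p hp => ?_
  rw [end_neg_apply, end_zsmul_apply, EE_apply_left hM hq hm hn hp, EE_apply_left hM hq hn hm hp,
    sgn_comm β α, sgn_comm γ α, sgn_comm γ β]
  rcases sgn_eq_one_or α β with h1 | h1 <;> rcases sgn_eq_one_or α γ with h2 | h2 <;>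
    rcases sgn_eq_one_or β γ with h3 | h3 <;> simp only [h1, h2, h3] <;>
    simp only [one_smul, neg_smul, mul_neg, mul_one, neg_neg, sub_neg_eq_add] <;> abel

include hA

theorem EE_smul_left (a : A) (m n : M) : EE ℳ q (a • m) n = idA M a * EE ℳ q m n := by
  revert n
  refine homogeneous_induction ℳ (fun β n hn => ?_) fun n n' h h' => ?_
  · refine end_ext_homogeneous ℳ fun γ p hp => ?_
    rw [end_mul_apply, idA_apply, EE_apply_of_mem _ hn hp, EE_apply_of_mem _ hn hp,
      hq.smul_left hA hM, smul_sub, smul_comm a (op _), mul_smul, smul_comm (sgn β γ) a]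
  · rw [map_add, map_add, h, h', mul_add]

omit hA in
theorem EE_op_smul_right (a : A) (m n : M) : EE ℳ q m (op a • n) = EE ℳ q m n * idA M a := by
  revert a
  refine homogeneous_induction 𝒜 (fun α a ha => ?_) fun a b h h' => ?_
  · revert n
    refine homogeneous_induction ℳ (fun β n hn => ?_) fun n n' h h' => ?_
    · refine end_ext_homogeneous ℳ fun γ p hp => ?_
      rw [end_mul_apply, idA_apply, EE_apply_of_mem _ hn (hM.smul_mem _ _ a ha p hp),
        EE_apply_of_mem _ (hM.op_smul_mem ha hn) hp, hq.balanced, hM.smul_eq _ _ _ ha p hp,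
        map_zsmul (q m), hq.map_right, hM.op_smul ha hn, sgn_add_right, sgn_add_left, sgn_comm β α]
      congr 1
      simp only [smul_assoc, mul_smul]
      rw [smul_comm (q m p) (sgn α β)]
      rcases sgn_eq_one_or α β with h1 | h1 <;> rcases sgn_eq_one_or α γ with h2 | h2 <;>
        rcases sgn_eq_one_or β γ with h3 | h3 <;> simp [h1, h2, h3]
    · rw [smul_add, map_add, map_add, h, h', add_mul]
  · rw [op_add, add_smul, map_add, h, h', idA_add, mul_add]

omit hA in
theorem EE_mem_linEnd (m n : M) : EE ℳ q m n ∈ linEnd M (RingHom.id A) := by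
  revert m
  refine homogeneous_induction ℳ (fun δ m hm => ?_) fun m m' h h' => ?_
  swap
  · rw [map_add, AddMonoidHom.add_apply]; exact add_mem h h'
  revert n
  refine homogeneous_induction ℳ (fun β n hn => ?_) fun n n' h h' => ?_
  swap
  · rw [map_add]; exact add_mem h h'
  refine fun a => homogeneous_induction 𝒜
    (P := fun a => ∀ p, EE ℳ q m n (op a • p) = op a • EE ℳ q m n p) (fun α a ha => ?_) ?_ a
  · refine homogeneous_induction ℳ (fun γ p hp => ?_) fun p p' h h' => ?_
    · rw [EE_apply_of_mem m hn (hM.op_smul_mem ha hp), EE_apply_of_mem m hn hp, hq.map_right,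
        hq.map_right, op_mul, mul_smul, smul_sub, mul_smul, hM.smul_eq _ _ a ha n hn,
        smul_comm (op a) (sgn β γ), ← smul_comm (q m p) (op a), smul_comm (q m p) (sgn α β),
        smul_smul, sgn_add_right, sgn_comm β α]
      rcases sgn_eq_one_or α β with h1 | h1 <;> simp [h1]
    · rw [smul_add, map_add, h, h', map_add, smul_add]
  · intro a b h h' p
    rw [op_add, add_smul, map_add, h, h', add_smul]

theorem EE_mem_osp (m n : M) : EE ℳ q m n ∈ osp ℳ q := by
  revert m
  refine homogeneous_induction ℳ (fun α m hm => ?_) fun m m' h h' => ?_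
  swap
  · rw [map_add, AddMonoidHom.add_apply]; exact add_mem h h'
  revert n
  refine homogeneous_induction ℳ (fun β n hn => ?_) fun n n' h h' => ?_
  swap
  · rw [map_add]; exact add_mem h h'
  refine ⟨EE_mem_linEnd hM hq m n, fun γ δ p hp r hr => ?_⟩
  rw [EE_apply_left hM hq hm hn hp, EE_apply_left hM hq hm hn hr]
  simp only [map_sub, map_zsmul, AddMonoidHom.sub_apply, AddMonoidHom.smul_apply,
    hq.smul_left hA hM]
  -- The four terms are products of two values of `q`. Commuting two of these products brings them
  -- to the same monomials as the other two, after which they cancel by signs.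
  rw [hA _ _ (q n r) (hq.degree _ _ n hn r hr) (q m p) (hq.degree _ _ m hm p hp),
    hA _ _ (q m r) (hq.degree _ _ m hm r hr) (q n p) (hq.degree _ _ n hn p hp)]
  simp only [sgn_add_left, sgn_add_right, sgn_comm β α, sgn_comm γ α,
    sgn_comm δ α, sgn_comm δ β, sgn_comm δ γ]
  rcases sgn_eq_one_or α β with h1 | h1 <;> rcases sgn_eq_one_or α γ with h2 | h2 <;>
    rcases sgn_eq_one_or β γ with h3 | h3 <;> rcases sgn_eq_one_or α δ with h4 | h4 <;>
    rcases sgn_eq_one_or β δ with h5 | h5 <;> rcases sgn_eq_one_or γ δ with h6 | h6 <;>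
    simp only [h1, h2, h3, h4, h5, h6] <;>
    simp only [one_smul, neg_smul, mul_neg, mul_one, neg_neg, sub_neg_eq_add] <;> abel

end EE

end Modules

/-! ### Differentials of the form, and linearity rules for brackets and actions -/

section Modules

variable {K A M : Type*} [Ring K] [Ring A] [AddCommGroup M] [Module A M] [Module Aᵐᵒᵖ M]
  [SMulCommClass A Aᵐᵒᵖ M]
  {𝒜 : ZMod 2 → AddSubgroup A} {ℳ : ZMod 2 → AddSubgroup M} {q : M →+ M →+ A}
  [GradedRing 𝒜] [DirectSum.Decomposition ℳ]

/-- A homogeneous endomorphism `S` of `M` of degree `ξ` which differentiates the module structure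
and the form through the endomorphism `f` of `A`. -/
structure IsDifferential (𝒜 : ZMod 2 → AddSubgroup A) (ℳ : ZMod 2 → AddSubgroup M)
    (q : M →+ M →+ A) (ξ : ZMod 2) (S : AddMonoid.End M) (f : AddMonoid.End A) : Prop where
  degree : S ∈ endDeg ℳ ξ
  degree_base : f ∈ endDeg 𝒜 ξ
  map_smul : ∀ α, ∀ a ∈ 𝒜 α, ∀ m, S (a • m) = f a • m + sgn ξ α • (a • S m)
  map_form : ∀ α, ∀ m ∈ ℳ α, ∀ n, f (q m n) = q (S m) n + sgn ξ α • q m (S n)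

omit [GradedRing 𝒜] in
theorem IsDifferential.of_osp (hM : IsSupermodule 𝒜 ℳ)
    (hq : IsQuadraticForm 𝒜 ℳ q) {ξ : ZMod 2} {x : AddMonoid.End M} (hx : x ∈ osp ℳ q)
    (hξ : x ∈ endDeg ℳ ξ) : IsDifferential 𝒜 ℳ q ξ x 0 where
  degree := hξ
  degree_base := zero_mem _
  map_smul α a ha m := by
    rw [hM.map_smul hξ (linEnd_id_apply hx.1 a) ha, end_zero_apply, zero_smul, zero_add]
  map_form α m hm n := by rw [osp_adjoint hq hx hξ hm, end_zero_apply, neg_add_cancel]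

omit [GradedRing 𝒜] in
theorem IsDifferential.bracket_EE (hM : IsSupermodule 𝒜 ℳ)
    -- The Leibniz rules for scalars and for `q` differentiate every factor of `E_{m,n}(p)`. The
    -- terms where `S` falls on `p` are exactly those subtracted by the supercommutator, so only the
    -- derivatives of `m` and `n` survive.
    (hq : IsQuadraticForm 𝒜 ℳ q) {ξ α β : ZMod 2} {S : AddMonoid.End M} {f : AddMonoid.End A}
    (h : IsDifferential 𝒜 ℳ q ξ S f) {m n : M} (hm : m ∈ ℳ α) (hn : n ∈ ℳ β) :
    sbr ℳ S (EE ℳ q m n) = EE ℳ q (S m) n + sgn ξ α • EE ℳ q m (S n) := by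
  rw [sbr_of_mem ℳ h.degree (EE_mem_endDeg hM hq hm hn)]
  refine end_ext_homogeneous ℳ fun γ p hp => ?_
  simp only [end_sub_apply, end_zsmul_apply, end_mul_apply, end_add_apply,
    EE_apply_left hM hq hm hn hp, EE_apply_left hM hq (h.degree α m hm) hn hp,
    EE_apply_left hM hq hm (h.degree β n hn) hp, EE_apply_left hM hq hm hn (h.degree γ p hp),
    map_sub, map_zsmul, h.map_smul _ _ (hq.degree _ _ n hn p hp),
    h.map_smul _ _ (hq.degree _ _ m hm p hp), h.map_form _ n hn, h.map_form _ m hm, add_smul,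
    sgn_add_left, sgn_add_right, sgn_comm β α, sgn_comm γ α, sgn_comm β ξ, sgn_comm γ ξ,
    smul_assoc]
  rcases sgn_eq_one_or α β with h1 | h1 <;> rcases sgn_eq_one_or α γ with h2 | h2 <;>
    rcases sgn_eq_one_or β γ with h3 | h3 <;> rcases sgn_eq_one_or ξ α with h4 | h4 <;>
    rcases sgn_eq_one_or ξ β with h5 | h5 <;> rcases sgn_eq_one_or ξ γ with h6 | h6 <;>
    simp only [h1, h2, h3, h4, h5, h6] <;>
    simp only [one_smul, neg_smul, mul_neg, mul_one, neg_neg, sub_neg_eq_add, smul_add, smul_sub,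
      smul_neg] <;> abel

section Linear

variable (hM : IsSupermodule 𝒜 ℳ)
include hM

/-- Additive conditions on right linear maps may be tested on homogeneous ones. -/
theorem linEnd_induction {P : AddMonoid.End M → Prop}
    (hom : ∀ ξ, ∀ x ∈ linEnd M (RingHom.id A), x ∈ endDeg ℳ ξ → P x)
    (add : ∀ x y, P x → P y → P (x + y)) {x : AddMonoid.End M}
    (hx : x ∈ linEnd M (RingHom.id A)) : P x := by
  rw [← part_add_part ℳ x]
  exact add _ _ (hom _ _ (hM.part_mem_linEnd hx 0) (part_mem ℳ 0 x))
    (hom _ _ (hM.part_mem_linEnd hx 1) (part_mem ℳ 1 x))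

theorem sact_mul_idA {x : AddMonoid.End M} (hx : x ∈ linEnd M (RingHom.id A)) (a : A) (m : M) :
    sact ℳ (x * idA M a) m = op a • sact ℳ x m := by
  refine linEnd_induction hM (P := fun x => sact ℳ (x * idA M a) m = op a • sact ℳ x m)
    (fun ξ x hx hξ => ?_) (fun x y h h' => ?_) hx
  · revert a
    refine homogeneous_induction 𝒜 (fun α a ha => ?_) fun a b h h' => ?_
    · revert m
      refine homogeneous_induction ℳ (fun β m hm => ?_) fun m n h h' => ?_
      · rw [sact_of_mem ℳ (mul_mem_endDeg ℳ hξ (hM.idA_mem ha)) hm, sact_of_mem ℳ hξ hm,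
          end_mul_apply, idA_apply, hM.smul_eq _ _ a ha m hm, map_zsmul, linEnd_id_apply hx,
          sgn_add_left, smul_comm (op a)]
        rcases sgn_eq_one_or α β with h1 | h1 <;> simp [h1]
      · rw [map_add, map_add, h, h', smul_add]
    · rw [idA_add, mul_add, map_add, AddMonoidHom.add_apply, h, h', op_add, add_smul]
  · rw [add_mul, map_add, map_add, AddMonoidHom.add_apply, AddMonoidHom.add_apply, h, h', smul_add]

theorem sact_smul {x : AddMonoid.End M} (hx : x ∈ linEnd M (RingHom.id A)) (a : A) (m : M) :
    sact ℳ x (a • m) = a • sact ℳ x m := by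
  refine linEnd_induction hM (P := fun x => sact ℳ x (a • m) = a • sact ℳ x m)
    (fun ξ x hx hξ => ?_) (fun x y h h' => ?_) hx
  · revert a
    refine homogeneous_induction 𝒜 (fun α a ha => ?_) fun a b h h' => ?_
    · revert m
      refine homogeneous_induction ℳ (fun β m hm => ?_) fun m n h h' => ?_
      · rw [sact_of_mem ℳ hξ (hM.smul_mem _ _ a ha m hm), sact_of_mem ℳ hξ hm,
          hM.map_smul hξ (linEnd_id_apply hx a) ha, sgn_add_right, smul_comm a]
        rcases sgn_eq_one_or ξ α with h1 | h1 <;> simp [h1]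
      · rw [map_add, smul_add, map_add, h, h', smul_add]
    · rw [add_smul, map_add, h, h', add_smul]
  · rw [map_add, AddMonoidHom.add_apply, AddMonoidHom.add_apply, h, h', smul_add]

theorem sact_op_smul {x : AddMonoid.End M} (hx : x ∈ linEnd M (RingHom.id A)) (a : A) (m : M) :
    sact ℳ x (op a • m) = sact ℳ (idA M a * x) m := by
  refine linEnd_induction hM (P := fun x => sact ℳ x (op a • m) = sact ℳ (idA M a * x) m)
    (fun ξ x hx hξ => ?_) (fun x y h h' => ?_) hx
  · revert a
    refine homogeneous_induction 𝒜 (fun α a ha => ?_) fun a b h h' => ?_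
    · revert m
      refine homogeneous_induction ℳ (fun β m hm => ?_) fun m n h h' => ?_
      · rw [sact_of_mem ℳ hξ (hM.op_smul_mem ha hm),
          sact_of_mem ℳ (mul_mem_endDeg ℳ (hM.idA_mem ha) hξ) hm, end_mul_apply, idA_apply,
          linEnd_id_apply hx, hM.smul_eq _ _ a ha _ (hξ _ m hm), smul_smul, sgn_add_left,
          sgn_add_right, sgn_add_right, sgn_comm ξ α]
        rcases sgn_eq_one_or α β with h1 | h1 <;> rcases sgn_eq_one_or α ξ with h2 | h2 <;>
          simp [h1, h2]
      · rw [map_add, smul_add, map_add, h, h']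
    · rw [op_add, add_smul, map_add, h, h', idA_add, add_mul, map_add, AddMonoidHom.add_apply]
  · rw [map_add, AddMonoidHom.add_apply, h, h', mul_add, map_add, AddMonoidHom.add_apply]

theorem sbr_mul_idA {x y : AddMonoid.End M} (hx : x ∈ linEnd M (RingHom.id A))
    (hy : y ∈ linEnd M (RingHom.id A)) (a : A) :
    sbr ℳ x (y * idA M a) = sbr ℳ x y * idA M a := by
  refine linEnd_induction hM (P := fun x => sbr ℳ x (y * idA M a) = sbr ℳ x y * idA M a)
    (fun ξ x hx hξ => ?_) (fun x y h h' => ?_) hx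
  · refine linEnd_induction hM (P := fun y => sbr ℳ x (y * idA M a) = sbr ℳ x y * idA M a)
      (fun η y hy hη => ?_) (fun x y h h' => ?_) hy
    · revert a
      refine homogeneous_induction 𝒜 (fun α a ha => ?_) fun a b h h' => ?_
      · rw [sbr_of_mem ℳ hξ hη, sbr_of_mem ℳ hξ (mul_mem_endDeg ℳ hη (hM.idA_mem ha)), sub_mul,
          smul_mul_assoc, mul_assoc y x, hM.mul_idA hξ hx ha, mul_smul_comm, sgn_add_right,
          mul_assoc, mul_assoc, mul_smul]
      · rw [idA_add, mul_add, map_add, h, h', mul_add]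
    · rw [add_mul, map_add, map_add, h, h', add_mul]
  · rw [map_add, AddMonoidHom.add_apply, AddMonoidHom.add_apply, h, h', add_mul]

theorem sbr_idA_mul (x : AddMonoid.End M) {y : AddMonoid.End M}
    (hy : y ∈ linEnd M (RingHom.id A)) (a : A) :
    sbr ℳ (idA M a * x) y = idA M a * sbr ℳ x y := by
  have key : ∀ ξ, sbr ℳ (idA M a * part ℳ ξ x) y = idA M a * sbr ℳ (part ℳ ξ x) y := fun ξ => by
    have hξ := part_mem ℳ ξ x
    refine linEnd_induction hM
      (P := fun y => sbr ℳ (idA M a * part ℳ ξ x) y = idA M a * sbr ℳ (part ℳ ξ x) y)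
      (fun η y hy hη => ?_) (fun x y h h' => ?_) hy
    · revert a
      refine homogeneous_induction 𝒜 (fun α a ha => ?_) fun a b h h' => ?_
      · rw [sbr_of_mem ℳ hξ hη, sbr_of_mem ℳ (mul_mem_endDeg ℳ (hM.idA_mem ha) hξ) hη, mul_sub,
          mul_smul_comm, ← mul_assoc y, hM.mul_idA hη hy ha, smul_mul_assoc, sgn_add_left,
          mul_assoc, mul_assoc, sgn_comm η α]
        rcases sgn_eq_one_or α η with h1 | h1 <;> simp [h1]
      · rw [idA_add, add_mul, map_add, AddMonoidHom.add_apply, h, h', add_mul]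
    · rw [map_add, map_add, h, h', mul_add]
  rw [← part_add_part ℳ x, mul_add, map_add, map_add, AddMonoidHom.add_apply,
    AddMonoidHom.add_apply, key, key, mul_add]

theorem sbr_mul_idA_left {x y : AddMonoid.End M} (hx : x ∈ linEnd M (RingHom.id A))
    (hy : y ∈ linEnd M (RingHom.id A)) (a : A) :
    sbr ℳ (x * idA M a) y = sbr ℳ x (idA M a * y) := by
  refine linEnd_induction hM (P := fun x => sbr ℳ (x * idA M a) y = sbr ℳ x (idA M a * y))
    (fun ξ x hx hξ => ?_) (fun x y h h' => ?_) hx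
  · refine linEnd_induction hM (P := fun y => sbr ℳ (x * idA M a) y = sbr ℳ x (idA M a * y))
      (fun η y hy hη => ?_) (fun x y h h' => ?_) hy
    · revert a
      refine homogeneous_induction 𝒜 (fun α a ha => ?_) fun a b h h' => ?_
      · rw [sbr_of_mem ℳ (mul_mem_endDeg ℳ hξ (hM.idA_mem ha)) hη,
          sbr_of_mem ℳ hξ (mul_mem_endDeg ℳ (hM.idA_mem ha) hη), ← mul_assoc y,
          hM.mul_idA (mul_mem_endDeg ℳ hη hξ) (linEnd_mul_mem hy hx) ha, sgn_add_left,
          sgn_add_right, sgn_add_left, mul_assoc, mul_assoc, sgn_comm η α]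
        rcases sgn_eq_one_or α η with h1 | h1 <;> rcases sgn_eq_one_or ξ η with h2 | h2 <;>
          rcases sgn_eq_one_or ξ α with h3 | h3 <;> simp [h1, h2, h3]
      · rw [idA_add, mul_add, map_add, AddMonoidHom.add_apply, h, h', add_mul, map_add]
    · rw [map_add, h, h', mul_add, map_add]
  · rw [add_mul, map_add, map_add, AddMonoidHom.add_apply, AddMonoidHom.add_apply, h, h']

end Linear

theorem EE_op_smul_left (hM : IsSupermodule 𝒜 ℳ) (hq : IsQuadraticForm 𝒜 ℳ q)
    (hA : IsSupercommutative 𝒜) (a : A) (m n : M) :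
    EE ℳ q (op a • m) n = EE ℳ q m (a • n) := by
  revert a
  refine homogeneous_induction 𝒜 (fun α a ha => ?_) fun a b h h' => ?_
  · revert n
    refine homogeneous_induction ℳ (fun β n hn => ?_) fun n n' h h' => ?_
    · refine end_ext_homogeneous ℳ fun γ p hp => ?_
      rw [EE_apply_of_mem _ (hM.smul_mem _ _ a ha n hn) hp, EE_apply_of_mem _ hn hp,
        hq.smul_left hA hM, op_mul, mul_smul, hq.balanced, hM.smul_eq _ _ a ha p hp,
        map_zsmul, hq.map_right, sgn_add_left, smul_assoc, mul_smul, mul_smul,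
        smul_comm (sgn α γ) (sgn β γ)]
    · rw [smul_add, map_add, map_add, h, h']
  · rw [op_add, add_smul, map_add, AddMonoidHom.add_apply, h, h', add_smul, map_add]

end Modules

/-! ### The product of the extended algebra and its Jacobi identity -/

section Modules

variable {K A M : Type*} [Ring K] [Ring A] [AddCommGroup M] [Module A M] [Module Aᵐᵒᵖ M]
  [SMulCommClass A Aᵐᵒᵖ M]
  {𝒜 : ZMod 2 → AddSubgroup A} {ℳ : ZMod 2 → AddSubgroup M} {q : M →+ M →+ A}
  [DirectSum.Decomposition ℳ] {ι : K →+* A} {E : AddSubgroup (AddMonoid.End M)}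

omit [SMulCommClass A Aᵐᵒᵖ M] [Module A M] [Module Aᵐᵒᵖ M] [DirectSum.Decomposition ℳ] in
theorem hom_zsmul_apply {V W : Type*} [AddCommGroup V] [AddCommGroup W] (k : ℤ)
    (f : V →+ AddMonoid.End W) (v : V) : (k • f) v = k • f v := rfl

theorem eInf_ext {u v : EInf A E} (h1 : u.1 = v.1) (h2 : u.2.1 = v.2.1) (h3 : u.2.2.1 = v.2.2.1)
    (h4 : (u.2.2.2 : AddMonoid.End M) = v.2.2.2) : u = v :=
  Prod.ext h1 (Prod.ext h2 (Prod.ext h3 (Subtype.ext h4)))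

variable (hE : IsOspSubalgebra ℳ q ι E)

theorem brInf_fst (u v : EInf A E) :
    (brInf hE u v).1 = q u.2.1 v.2.2.1 - q u.2.2.1 v.2.1 := rfl

theorem brInf_snd (u v : EInf A E) :
    (brInf hE u v).2.1 = u.1 • v.2.1 + (u.2.2.2 : AddMonoid.End M) v.2.1 - op v.1 • u.2.1
      - sact ℳ v.2.2.2 u.2.1 := rfl

theorem brInf_thd (u v : EInf A E) :
    (brInf hE u v).2.2.1 = -(u.1 • v.2.2.1) + (u.2.2.2 : AddMonoid.End M) v.2.2.1
      + op v.1 • u.2.2.1 - sact ℳ v.2.2.2 u.2.2.1 := rfl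

theorem brInf_fth (u v : EInf A E) :
    ((brInf hE u v).2.2.2 : AddMonoid.End M) = EE ℳ q u.2.1 v.2.2.1 + EE ℳ q u.2.2.1 v.2.1
      + sbr ℳ u.2.2.2 v.2.2.2 := rfl

/-- On homogeneous elements the right action and `sact` become left actions with the single sign of
the pair. This antisymmetric shape is what makes the degree and Jacobi computations uniform. -/
theorem brInf_snd_of_mem (hM : IsSupermodule 𝒜 ℳ) {α β : ZMod 2} {u v : EInf A E}
    (hu : u ∈ gradInf 𝒜 ℳ E α) (hv : v ∈ gradInf 𝒜 ℳ E β) :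
    (brInf hE u v).2.1 = u.1 • v.2.1 + (u.2.2.2 : AddMonoid.End M) v.2.1
      - sgn α β • (v.1 • u.2.1 + (v.2.2.2 : AddMonoid.End M) u.2.1) := by
  rw [brInf_snd, hM.op_smul hv.1 hu.2.1, sact_of_mem ℳ hv.2.2.2 hu.2.1, sgn_comm β α, smul_add]
  abel

theorem brInf_thd_of_mem (hM : IsSupermodule 𝒜 ℳ) {α β : ZMod 2} {u v : EInf A E}
    (hu : u ∈ gradInf 𝒜 ℳ E α) (hv : v ∈ gradInf 𝒜 ℳ E β) :
    (brInf hE u v).2.2.1 = -(u.1 • v.2.2.1) + (u.2.2.2 : AddMonoid.End M) v.2.2.1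
      - sgn α β • (-(v.1 • u.2.2.1) + (v.2.2.2 : AddMonoid.End M) u.2.2.1) := by
  rw [brInf_thd, hM.op_smul hv.1 hu.2.2.1, sact_of_mem ℳ hv.2.2.2 hu.2.2.1, sgn_comm β α, smul_add,
    smul_neg]
  abel

theorem brInf_mem (hM : IsSupermodule 𝒜 ℳ) (hq : IsQuadraticForm 𝒜 ℳ q) {α β : ZMod 2}
    {u v : EInf A E} (hu : u ∈ gradInf 𝒜 ℳ E α) (hv : v ∈ gradInf 𝒜 ℳ E β) :
    brInf hE u v ∈ gradInf 𝒜 ℳ E (α + β) := by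
  refine ⟨?_, ?_, ?_, ?_⟩
  · exact sub_mem (hq.degree _ _ _ hu.2.1 _ hv.2.2.1) (hq.degree _ _ _ hu.2.2.1 _ hv.2.1)
  · rw [brInf_snd_of_mem hE hM hu hv]
    refine sub_mem (add_mem (hM.smul_mem _ _ _ hu.1 _ hv.2.1) (hu.2.2.2 _ _ hv.2.1))
      (zsmul_mem ?_ _)
    rw [add_comm]
    exact add_mem (hM.smul_mem _ _ _ hv.1 _ hu.2.1) (hv.2.2.2 _ _ hu.2.1)
  · rw [brInf_thd_of_mem hE hM hu hv]
    refine sub_mem (add_mem (neg_mem (hM.smul_mem _ _ _ hu.1 _ hv.2.2.1)) (hu.2.2.2 _ _ hv.2.2.1))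
      (zsmul_mem ?_ _)
    rw [add_comm]
    exact add_mem (neg_mem (hM.smul_mem _ _ _ hv.1 _ hu.2.2.1)) (hv.2.2.2 _ _ hu.2.2.1)
  · exact add_mem (add_mem (EE_mem_endDeg hM hq hu.2.1 hv.2.2.1)
      (EE_mem_endDeg hM hq hu.2.2.1 hv.2.1)) (sbr_mem_endDeg ℳ hu.2.2.2 hv.2.2.2)

section Grading

variable [GradedRing 𝒜]

variable (𝒜) in
include hE in
theorem exists_add_gradInf (u : EInf A E) :
    ∃ v ∈ gradInf 𝒜 ℳ E 0, ∃ w ∈ gradInf 𝒜 ℳ E 1, u = v + w :=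
  ⟨(proj 𝒜 0 u.1, proj ℳ 0 u.2.1, proj ℳ 0 u.2.2.1,
      ⟨part ℳ 0 u.2.2.2, part_mem_of_isGradedSub ℳ hE.submodule.graded u.2.2.2.2 0⟩),
    ⟨proj_mem _ _ _, proj_mem _ _ _, proj_mem _ _ _, part_mem _ _ _⟩,
    (proj 𝒜 1 u.1, proj ℳ 1 u.2.1, proj ℳ 1 u.2.2.1,
      ⟨part ℳ 1 u.2.2.2, part_mem_of_isGradedSub ℳ hE.submodule.graded u.2.2.2.2 1⟩),
    ⟨proj_mem _ _ _, proj_mem _ _ _, proj_mem _ _ _, part_mem _ _ _⟩,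
    eInf_ext (proj_add_proj 𝒜 _).symm (proj_add_proj ℳ _).symm (proj_add_proj ℳ _).symm
      (part_add_part ℳ _).symm⟩

include hE in
theorem gradInf_induction {P : EInf A E → Prop} (hom : ∀ α, ∀ u ∈ gradInf 𝒜 ℳ E α, P u)
    (add : ∀ u v, P u → P v → P (u + v)) (u : EInf A E) : P u := by
  obtain ⟨v, hv, w, hw, rfl⟩ := exists_add_gradInf 𝒜 hE u
  exact add _ _ (hom _ _ hv) (hom _ _ hw)

theorem eq_zero_of_mem_gradInf {α β : ZMod 2} (h : α ≠ β) {u : EInf A E}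
    (hu : u ∈ gradInf 𝒜 ℳ E α) (hv : u ∈ gradInf 𝒜 ℳ E β) : u = 0 :=
  eInf_ext (eq_zero_of_mem_mem 𝒜 h hu.1 hv.1) (eq_zero_of_mem_mem ℳ h hu.2.1 hv.2.1)
    (eq_zero_of_mem_mem ℳ h hu.2.2.1 hv.2.2.1) (end_eq_zero_of_mem_mem ℳ h hu.2.2.2 hv.2.2.2)

include hE in
theorem endDeg_gradInf_disjoint (f : AddMonoid.End (EInf A E))
    (h0 : f ∈ endDeg (gradInf 𝒜 ℳ E) 0) (h1 : f ∈ endDeg (gradInf 𝒜 ℳ E) 1) : f = 0 :=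
  end_ext fun u => gradInf_induction hE (𝒜 := 𝒜) (P := fun u => f u = (0 : AddMonoid.End _) u)
    (fun α u hu => eq_zero_of_mem_gradInf (𝒜 := 𝒜) (ℳ := ℳ) (by simp) (h0 α u hu) (h1 α u hu))
    (fun u v hu hv => by rw [map_add, map_add, hu, hv]) u

end Grading

section Jacobi

variable [GradedRing 𝒜] (hA : IsSupercommutative 𝒜)
  (hM : IsSupermodule 𝒜 ℳ) (hq : IsQuadraticForm 𝒜 ℳ q)
include hA hM hq

theorem IsQuadraticForm.swap_smul {α β γ : ZMod 2} {a : A} (ha : a ∈ 𝒜 α) {m n : M}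
    (hm : m ∈ ℳ β) (hn : n ∈ ℳ γ) : q m (a • n) = (sgn α β * sgn β γ) • (a * q n m) := by
  rw [hq.smul_right hA hM ha hm, hq.supersymm _ _ m hm n hn, mul_smul_comm, smul_smul]

omit hA hM [SMulCommClass A Aᵐᵒᵖ M] [GradedRing 𝒜] in
theorem IsQuadraticForm.swap_osp {ξ β γ : ZMod 2} {x : AddMonoid.End M} (hx : x ∈ osp ℳ q)
    (hξ : x ∈ endDeg ℳ ξ) {m n : M} (hm : m ∈ ℳ β) (hn : n ∈ ℳ γ) :
    q m (x n) = -((sgn ξ β * sgn β γ * sgn ξ γ) • q n (x m)) := by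
  rw [hq.supersymm _ _ m hm _ (hξ _ n hn), osp_adjoint hq hx hξ hn, smul_neg, smul_smul,
    sgn_add_right, sgn_comm β ξ]

theorem jacobi_fst {α β γ : ZMod 2} {u v w : EInf A E} (hu : u ∈ gradInf 𝒜 ℳ E α)
    (hv : v ∈ gradInf 𝒜 ℳ E β) (hw : w ∈ gradInf 𝒜 ℳ E γ) :
    (brInf hE u (brInf hE v w)).1 =
      (brInf hE (brInf hE u v) w + sgn α β • brInf hE v (brInf hE u w)).1 := by
  have o := fun x : E => hE.le_osp x.2
  rw [Prod.fst_add, Prod.smul_fst]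
  simp only [brInf_fst, brInf_snd_of_mem hE hM hu hv, brInf_snd_of_mem hE hM hu hw,
    brInf_snd_of_mem hE hM hv hw, brInf_thd_of_mem hE hM hu hv, brInf_thd_of_mem hE hM hu hw,
    brInf_thd_of_mem hE hM hv hw, map_add, map_sub, map_neg, map_zsmul, AddMonoidHom.add_apply,
    AddMonoidHom.sub_apply, AddMonoidHom.neg_apply, AddMonoidHom.smul_apply]
  obtain ⟨a, m, n, x⟩ := u
  obtain ⟨a', m', n', x'⟩ := v
  obtain ⟨a'', m'', n'', x''⟩ := w
  obtain ⟨hu1, hu2, hu3, hu4⟩ := hu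
  obtain ⟨hv1, hv2, hv3, hv4⟩ := hv
  obtain ⟨hw1, hw2, hw3, hw4⟩ := hw
  dsimp only at *
  -- These rewrites choose one orientation for each pairing, moving scalars and skew maps to fixed
  -- positions, so that equal terms become literally equal up to sign.
  simp only [hq.smul_left hA hM, hq.smul_right hA hM hu1 hv2, hq.swap_smul hA hM hu1 hv3 hw2,
    hq.swap_smul hA hM hv1 hu3 hw2, hq.smul_right hA hM hv1 hu2, hq.smul_right hA hM hw1 hu2,
    hq.swap_smul hA hM hw1 hu3 hv2, hq.smul_right hA hM hu1 hv2, hq.smul_right hA hM hw1 hv2,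
    hq.swap_smul hA hM hw1 hv3 hu2,
    osp_adjoint hq (o _) hu4 hv2, osp_adjoint hq (o _) hu4 hv3, osp_adjoint hq (o _) hv4 hu2,
    osp_adjoint hq (o _) hv4 hu3, hq.swap_osp (o _) hu4 hv3 hw2, hq.swap_osp (o _) hv4 hu3 hw2,
    hq.swap_osp (o _) hw4 hu3 hv2, hq.swap_osp (o _) hw4 hv3 hu2,
    hq.supersymm _ _ _ hv3 _ hw2, hq.supersymm _ _ _ hu3 _ hw2,
    sgn_comm β α, sgn_comm γ α, sgn_comm γ β]
  rcases sgn_eq_one_or α β with h1 | h1 <;> rcases sgn_eq_one_or α γ with h2 | h2 <;>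
    rcases sgn_eq_one_or β γ with h3 | h3 <;> simp only [h1, h2, h3] <;>
    simp only [one_smul, neg_smul, mul_neg, mul_one, neg_neg, sub_neg_eq_add, smul_add, smul_sub,
      smul_neg] <;> abel

omit hM hq [DirectSum.Decomposition ℳ] [Module Aᵐᵒᵖ M] [SMulCommClass A Aᵐᵒᵖ M] [GradedRing 𝒜] in
theorem smul_smul_swap {α β : ZMod 2} {a b : A} (ha : a ∈ 𝒜 α) (hb : b ∈ 𝒜 β) (m : M) :
    b • a • m = sgn α β • (a • b • m) := by
  rw [← mul_smul, hA _ _ b hb a ha, sgn_comm, smul_assoc, mul_smul]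

theorem jacobi_snd {α β γ : ZMod 2} {u v w : EInf A E} (hu : u ∈ gradInf 𝒜 ℳ E α)
    (hv : v ∈ gradInf 𝒜 ℳ E β) (hw : w ∈ gradInf 𝒜 ℳ E γ) :
    (brInf hE u (brInf hE v w)).2.1 =
      (brInf hE (brInf hE u v) w + sgn α β • brInf hE v (brInf hE u w)).2.1 := by
  have o := fun x : E => hE.le_osp x.2
  rw [Prod.snd_add, Prod.fst_add, Prod.smul_snd, Prod.smul_fst]
  rw [brInf_snd_of_mem hE hM hu (brInf_mem hE hM hq hv hw),
    brInf_snd_of_mem hE hM (brInf_mem hE hM hq hu hv) hw,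
    brInf_snd_of_mem hE hM hv (brInf_mem hE hM hq hu hw)]
  simp only [brInf_fst, brInf_fth, brInf_snd_of_mem hE hM hu hv, brInf_snd_of_mem hE hM hu hw,
    brInf_snd_of_mem hE hM hv hw, sbr_of_mem ℳ hu.2.2.2 hv.2.2.2, sbr_of_mem ℳ hu.2.2.2 hw.2.2.2,
    sbr_of_mem ℳ hv.2.2.2 hw.2.2.2]
  obtain ⟨a, m, n, x⟩ := u
  obtain ⟨a', m', n', x'⟩ := v
  obtain ⟨a'', m'', n'', x''⟩ := w
  obtain ⟨hu1, hu2, hu3, hu4⟩ := hu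
  obtain ⟨hv1, hv2, hv3, hv4⟩ := hv
  obtain ⟨hw1, hw2, hw3, hw4⟩ := hw
  dsimp only at *
  -- Once the signs are fixed, these three identities act as rewriting rules that put two successive
  -- scalars in the order `u`, `v`, `w`. They are kept aside until then because their right-hand
  -- sides contain signs.
  have s1 := smul_smul_swap (M := M) hA hu1 hv1
  have s2 := smul_smul_swap (M := M) hA hu1 hw1
  have s3 := smul_smul_swap (M := M) hA hv1 hw1
  simp only [end_add_apply, end_sub_apply, end_zsmul_apply, end_mul_apply, map_add, map_sub,
    map_neg, map_zsmul, add_smul, sub_smul, smul_add, smul_sub,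
    hM.map_smul hu4 (linEnd_id_apply (o x).1 _) hv1, hM.map_smul hu4 (linEnd_id_apply (o x).1 _) hw1,
    hM.map_smul hv4 (linEnd_id_apply (o x').1 _) hu1,
    hM.map_smul hv4 (linEnd_id_apply (o x').1 _) hw1,
    hM.map_smul hw4 (linEnd_id_apply (o x'').1 _) hu1,
    hM.map_smul hw4 (linEnd_id_apply (o x'').1 _) hv1,
    EE_apply_left hM hq hu2 hv3 hw2, EE_apply_left hM hq hu3 hv2 hw2,
    EE_apply_left hM hq hu2 hw3 hv2, EE_apply_left hM hq hu3 hw2 hv2,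
    EE_apply_left hM hq hv2 hw3 hu2, EE_apply_left hM hq hv3 hw2 hu2,
    hq.supersymm _ _ _ hv2 _ hu3, hq.supersymm _ _ _ hw2 _ hu3, hq.supersymm _ _ _ hu2 _ hv3,
    hq.supersymm _ _ _ hw2 _ hv3, hq.supersymm _ _ _ hv2 _ hw3, hq.supersymm _ _ _ hu2 _ hw3,
    hq.supersymm _ _ _ hv2 _ hu2, hq.supersymm _ _ _ hw2 _ hu2, hq.supersymm _ _ _ hw2 _ hv2,
    sgn_add_left, sgn_add_right, sgn_comm β α, sgn_comm γ α, sgn_comm γ β, smul_assoc]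
  rcases sgn_eq_one_or α β with h1 | h1 <;> rcases sgn_eq_one_or α γ with h2 | h2 <;>
    rcases sgn_eq_one_or β γ with h3 | h3 <;> simp only [h1, h2, h3] at s1 s2 s3 ⊢ <;>
    simp only [one_smul, neg_smul, mul_neg, mul_one, neg_neg, sub_neg_eq_add, smul_add, smul_sub,
      smul_neg, s1, s2, s3] <;> abel

theorem jacobi_thd {α β γ : ZMod 2} {u v w : EInf A E} (hu : u ∈ gradInf 𝒜 ℳ E α)
    (hv : v ∈ gradInf 𝒜 ℳ E β) (hw : w ∈ gradInf 𝒜 ℳ E γ) :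
    (brInf hE u (brInf hE v w)).2.2.1 =
      (brInf hE (brInf hE u v) w + sgn α β • brInf hE v (brInf hE u w)).2.2.1 := by
  have o := fun x : E => hE.le_osp x.2
  rw [Prod.snd_add, Prod.snd_add, Prod.fst_add, Prod.smul_snd, Prod.smul_snd, Prod.smul_fst]
  rw [brInf_thd_of_mem hE hM hu (brInf_mem hE hM hq hv hw),
    brInf_thd_of_mem hE hM (brInf_mem hE hM hq hu hv) hw,
    brInf_thd_of_mem hE hM hv (brInf_mem hE hM hq hu hw)]
  simp only [brInf_fst, brInf_fth, brInf_thd_of_mem hE hM hu hv, brInf_thd_of_mem hE hM hu hw,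
    brInf_thd_of_mem hE hM hv hw, sbr_of_mem ℳ hu.2.2.2 hv.2.2.2, sbr_of_mem ℳ hu.2.2.2 hw.2.2.2,
    sbr_of_mem ℳ hv.2.2.2 hw.2.2.2]
  obtain ⟨a, m, n, x⟩ := u
  obtain ⟨a', m', n', x'⟩ := v
  obtain ⟨a'', m'', n'', x''⟩ := w
  obtain ⟨hu1, hu2, hu3, hu4⟩ := hu
  obtain ⟨hv1, hv2, hv3, hv4⟩ := hv
  obtain ⟨hw1, hw2, hw3, hw4⟩ := hw
  dsimp only at *
  have s1 := smul_smul_swap (M := M) hA hu1 hv1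
  have s2 := smul_smul_swap (M := M) hA hu1 hw1
  have s3 := smul_smul_swap (M := M) hA hv1 hw1
  simp only [end_add_apply, end_sub_apply, end_zsmul_apply, end_mul_apply, map_add, map_sub,
    map_neg, map_zsmul, add_smul, sub_smul, smul_add, smul_sub, smul_neg,
    hM.map_smul hu4 (linEnd_id_apply (o x).1 _) hv1, hM.map_smul hu4 (linEnd_id_apply (o x).1 _) hw1,
    hM.map_smul hv4 (linEnd_id_apply (o x').1 _) hu1,
    hM.map_smul hv4 (linEnd_id_apply (o x').1 _) hw1,
    hM.map_smul hw4 (linEnd_id_apply (o x'').1 _) hu1,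
    hM.map_smul hw4 (linEnd_id_apply (o x'').1 _) hv1,
    EE_apply_left hM hq hu2 hv3 hw3, EE_apply_left hM hq hu3 hv2 hw3,
    EE_apply_left hM hq hu2 hw3 hv3, EE_apply_left hM hq hu3 hw2 hv3,
    EE_apply_left hM hq hv2 hw3 hu3, EE_apply_left hM hq hv3 hw2 hu3,
    hq.supersymm _ _ _ hv2 _ hu3, hq.supersymm _ _ _ hw2 _ hu3, hq.supersymm _ _ _ hu2 _ hv3,
    hq.supersymm _ _ _ hw2 _ hv3, hq.supersymm _ _ _ hv2 _ hw3, hq.supersymm _ _ _ hu2 _ hw3,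
    hq.supersymm _ _ _ hv3 _ hu3, hq.supersymm _ _ _ hw3 _ hu3, hq.supersymm _ _ _ hw3 _ hv3,
    sgn_add_left, sgn_add_right, sgn_comm β α, sgn_comm γ α, sgn_comm γ β, smul_assoc]
  rcases sgn_eq_one_or α β with h1 | h1 <;> rcases sgn_eq_one_or α γ with h2 | h2 <;>
    rcases sgn_eq_one_or β γ with h3 | h3 <;> simp only [h1, h2, h3] at s1 s2 s3 ⊢ <;>
    simp only [one_smul, neg_smul, mul_neg, mul_one, neg_neg, sub_neg_eq_add, smul_add, smul_sub,
      smul_neg, s1, s2, s3] <;> abel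

/-- `E_{m,an}` with the scalar in front. -/
theorem EE_smul_right {α β : ZMod 2} {a : A} (ha : a ∈ 𝒜 α) {m : M} (hm : m ∈ ℳ β) (n : M) :
    EE ℳ q m (a • n) = sgn α β • (idA M a * EE ℳ q m n) := by
  rw [← EE_op_smul_left hM hq hA, hM.op_smul ha hm, map_zsmul, hom_zsmul_apply,
    EE_smul_left hA hM hq]

omit hA [GradedRing 𝒜] in
theorem sbr_osp_EE {ξ α β : ZMod 2} {x : AddMonoid.End M} (hx : x ∈ osp ℳ q)
    (hξ : x ∈ endDeg ℳ ξ) {m n : M} (hm : m ∈ ℳ α) (hn : n ∈ ℳ β) :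
    sbr ℳ x (EE ℳ q m n) = EE ℳ q (x m) n + sgn ξ α • EE ℳ q m (x n) :=
  (IsDifferential.of_osp hM hq hx hξ).bracket_EE hM hq hm hn

omit hA [GradedRing 𝒜] in
theorem sbr_EE_osp {ξ α β : ZMod 2} {x : AddMonoid.End M} (hx : x ∈ osp ℳ q)
    (hξ : x ∈ endDeg ℳ ξ) {m n : M} (hm : m ∈ ℳ α) (hn : n ∈ ℳ β) :
    sbr ℳ (EE ℳ q m n) x =
      -((sgn ξ α * sgn ξ β) • (EE ℳ q (x m) n + sgn ξ α • EE ℳ q m (x n))) := by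
  rw [← sbr_osp_EE hM hq hx hξ hm hn, sbr_of_mem ℳ (EE_mem_endDeg hM hq hm hn) hξ,
    sbr_of_mem ℳ hξ (EE_mem_endDeg hM hq hm hn), sgn_add_left, sgn_add_right, sgn_comm α ξ,
    sgn_comm β ξ, zsmul_sub, smul_smul]
  rcases sgn_eq_one_or ξ α with h1 | h1 <;> rcases sgn_eq_one_or ξ β with h2 | h2 <;>
    simp [h1, h2]

/-- The part with all entries in `𝓔` is the Jacobi identity for endomorphisms. Mixed terms reduce to
the fact that `osp(q)` acts on the maps `E` as derivations, and terms with scalars to the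
bilinearity and supersymmetry of `E`. -/
theorem jacobi_fth {α β γ : ZMod 2} {u v w : EInf A E} (hu : u ∈ gradInf 𝒜 ℳ E α)
    (hv : v ∈ gradInf 𝒜 ℳ E β) (hw : w ∈ gradInf 𝒜 ℳ E γ) :
    ((brInf hE u (brInf hE v w)).2.2.2 : AddMonoid.End M) =
      (brInf hE (brInf hE u v) w).2.2.2 + sgn α β • (brInf hE v (brInf hE u w)).2.2.2 := by
  have o := fun x : E => hE.le_osp x.2
  simp only [brInf_fth, brInf_snd_of_mem hE hM hu hv, brInf_snd_of_mem hE hM hu hw,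
    brInf_snd_of_mem hE hM hv hw, brInf_thd_of_mem hE hM hu hv, brInf_thd_of_mem hE hM hu hw,
    brInf_thd_of_mem hE hM hv hw]
  obtain ⟨a, m, n, x⟩ := u
  obtain ⟨a', m', n', x'⟩ := v
  obtain ⟨a'', m'', n'', x''⟩ := w
  obtain ⟨hu1, hu2, hu3, hu4⟩ := hu
  obtain ⟨hv1, hv2, hv3, hv4⟩ := hv
  obtain ⟨hw1, hw2, hw3, hw4⟩ := hw
  dsimp only at *
  simp only [map_add, map_sub, map_neg, map_zsmul, AddMonoidHom.add_apply,
    AddMonoidHom.sub_apply, AddMonoidHom.neg_apply, hom_zsmul_apply,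
    EE_smul_left hA hM hq, EE_smul_right hA hM hq hv1 hu2, EE_smul_right hA hM hq hv1 hu3,
    EE_smul_right hA hM hq hw1 hu2, EE_smul_right hA hM hq hw1 hu3,
    EE_smul_right hA hM hq hu1 hv2, EE_smul_right hA hM hq hu1 hv3,
    EE_smul_right hA hM hq hw1 hv2, EE_smul_right hA hM hq hw1 hv3,
    sbr_osp_EE hM hq (o x) hu4 hv2 hw3, sbr_osp_EE hM hq (o x) hu4 hv3 hw2,
    sbr_osp_EE hM hq (o x') hv4 hu2 hw3, sbr_osp_EE hM hq (o x') hv4 hu3 hw2,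
    sbr_EE_osp hM hq (o x'') hw4 hu2 hv3, sbr_EE_osp hM hq (o x'') hw4 hu3 hv2,
    sbr_sbr ℳ hu4 hv4 hw4,
    EE_symm hM hq hv2 hu3, EE_symm hM hq hv3 hu2, EE_symm hM hq (hw4 _ _ hv2) hu3,
    EE_symm hM hq (hw4 _ _ hv3) hu2, EE_symm hM hq hv2 (hw4 _ _ hu3),
    EE_symm hM hq hv3 (hw4 _ _ hu2),
    sgn_add_left, sgn_add_right, sgn_comm β α, sgn_comm γ α, sgn_comm γ β]
  rcases sgn_eq_one_or α β with h1 | h1 <;> rcases sgn_eq_one_or α γ with h2 | h2 <;>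
    rcases sgn_eq_one_or β γ with h3 | h3 <;> simp only [h1, h2, h3] <;>
    simp only [one_smul, neg_smul, mul_neg, mul_one, neg_neg, sub_neg_eq_add, smul_add, smul_sub,
      smul_neg] <;> abel

end Jacobi
end Modules

/-! ### Inner derivations, and derivations acting diagonally -/

section Modules

variable {K A M : Type*} [Ring K] [Ring A] [AddCommGroup M] [Module A M] [Module Aᵐᵒᵖ M]
  [SMulCommClass A Aᵐᵒᵖ M]
  {𝒜 : ZMod 2 → AddSubgroup A} {ℳ : ZMod 2 → AddSubgroup M} {q : M →+ M →+ A}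
  [DirectSum.Decomposition ℳ] {ι : K →+* A} {E : AddSubgroup (AddMonoid.End M)}
  (hE : IsOspSubalgebra ℳ q ι E)

/-- The endomorphisms of `E_∞` that are linear over `K`. -/
def rsmulLin : AddSubgroup (AddMonoid.End (EInf A E)) where
  carrier := {d | ∀ k u, d (rsmulInf hE k u) = rsmulInf hE k (d u)}
  add_mem' hf hg k u := by rw [end_add_apply, end_add_apply, hf k u, hg k u, map_add]
  zero_mem' k u := by rw [end_zero_apply, end_zero_apply, map_zero]
  neg_mem' hf k u := by rw [end_neg_apply, end_neg_apply, hf k u, map_neg]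

/-- This presents the set of `K`-linear maps as a subgroup, which the general results on `Der`
require. -/
theorem derInf_eq : derInf 𝒜 hE = Der (gradInf 𝒜 ℳ E) (brInf hE) (rsmulLin hE) := rfl

theorem brInf_mem_adInf (u : EInf A E) : (brInf hE u : AddMonoid.End (EInf A E)) ∈ adInf hE :=
  ⟨u, fun _ => rfl⟩

theorem exists_eq_brInf {d : AddMonoid.End (EInf A E)} (hd : d ∈ adInf hE) :
    ∃ u, d = brInf hE u := by
  obtain ⟨u, hu⟩ := hd
  exact ⟨u, end_ext hu⟩

variable [GradedRing 𝒜] (hA : IsSupercommutative 𝒜)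
  (hM : IsSupermodule 𝒜 ℳ) (hq : IsQuadraticForm 𝒜 ℳ q)
include hA hM hq

omit hA in
theorem brInf_rsmul (k : K) (u v : EInf A E) :
    brInf hE u (rsmulInf hE k v) = rsmulInf hE k (brInf hE u v) := by
  obtain ⟨a, m, n, x⟩ := u
  obtain ⟨a', m', n', x'⟩ := v
  have hx := (hE.le_osp x.2).1
  have hx' := (hE.le_osp x'.2).1
  refine eInf_ext ?_ ?_ ?_ ?_
  · change q m (op (ι k) • n') - q n (op (ι k) • m') = (q m n' - q n m') * ι k
    rw [hq.map_right, hq.map_right, sub_mul]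
  · change a • op (ι k) • m' + (x : AddMonoid.End M) (op (ι k) • m') - op (a' * ι k) • m
      - sact ℳ (x' * idA M (ι k)) m = op (ι k) • (a • m' + (x : AddMonoid.End M) m' - op a' • m
      - sact ℳ x' m)
    rw [sact_mul_idA hM hx', linEnd_id_apply hx, op_mul, mul_smul, smul_sub, smul_sub, smul_add,
      smul_comm a (op _)]
  · change -(a • op (ι k) • n') + (x : AddMonoid.End M) (op (ι k) • n') + op (a' * ι k) • n
      - sact ℳ (x' * idA M (ι k)) n = op (ι k) • (-(a • n') + (x : AddMonoid.End M) n' + op a' • n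
      - sact ℳ x' n)
    rw [sact_mul_idA hM hx', linEnd_id_apply hx, op_mul, mul_smul, smul_sub, smul_add, smul_add,
      smul_neg, smul_comm a (op _)]
  · change EE ℳ q m (op (ι k) • n') + EE ℳ q n (op (ι k) • m')
      + sbr ℳ x (x' * idA M (ι k)) = (EE ℳ q m n' + EE ℳ q n m' + sbr ℳ x x') * idA M (ι k)
    rw [EE_op_smul_right hM hq, EE_op_smul_right hM hq, sbr_mul_idA hM hx hx', add_mul, add_mul]

theorem lsmul_brInf (k : K) (u v : EInf A E) :
    brInf hE (lsmulInf hE k u) v = lsmulInf hE k (brInf hE u v) := by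
  obtain ⟨a, m, n, x⟩ := u
  obtain ⟨a', m', n', x'⟩ := v
  have hx := (hE.le_osp x.2).1
  have hx' := (hE.le_osp x'.2).1
  refine eInf_ext ?_ ?_ ?_ ?_
  · change q (ι k • m) n' - q (ι k • n) m' = ι k * (q m n' - q n m')
    rw [hq.smul_left hA hM, hq.smul_left hA hM, mul_sub]
  · change (ι k * a) • m' + ι k • (x : AddMonoid.End M) m' - op a' • ι k • m
      - sact ℳ x' (ι k • m) = ι k • (a • m' + (x : AddMonoid.End M) m' - op a' • m - sact ℳ x' m)
    rw [sact_smul hM hx', mul_smul, smul_sub, smul_sub, smul_add, smul_comm (ι k) (op a')]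
  · change -((ι k * a) • n') + ι k • (x : AddMonoid.End M) n' + op a' • ι k • n
      - sact ℳ x' (ι k • n) = ι k • (-(a • n') + (x : AddMonoid.End M) n' + op a' • n
      - sact ℳ x' n)
    rw [sact_smul hM hx', mul_smul, smul_sub, smul_add, smul_add, smul_neg,
      smul_comm (ι k) (op a')]
  · change EE ℳ q (ι k • m) n' + EE ℳ q (ι k • n) m' + sbr ℳ (idA M (ι k) * x) x' =
      idA M (ι k) * (EE ℳ q m n' + EE ℳ q n m' + sbr ℳ x x')
    rw [EE_smul_left hA hM hq, EE_smul_left hA hM hq, sbr_idA_mul hM _ hx', mul_add, mul_add]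

/-- This balancing of scalars across the product says that `ad u` followed after a left scalar is
`ad` of `u k`, which makes the inner derivations stable under composition with scalars on the right.
-/
theorem brInf_lsmul (k : K) (u v : EInf A E) :
    brInf hE u (lsmulInf hE k v) = brInf hE (rsmulInf hE k u) v := by
  obtain ⟨a, m, n, x⟩ := u
  obtain ⟨a', m', n', x'⟩ := v
  have hx := (hE.le_osp x.2).1
  have hx' := (hE.le_osp x'.2).1
  refine eInf_ext ?_ ?_ ?_ ?_
  · change q m (ι k • n') - q n (ι k • m') = q (op (ι k) • m) n' - q (op (ι k) • n) m'
    rw [hq.balanced, hq.balanced]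
  · change a • ι k • m' + (x : AddMonoid.End M) (ι k • m') - op (ι k * a') • m
      - sact ℳ (idA M (ι k) * x') m = (a * ι k) • m' + (x : AddMonoid.End M) (ι k • m')
      - op a' • op (ι k) • m - sact ℳ x' (op (ι k) • m)
    rw [sact_op_smul hM hx', mul_smul, op_mul, mul_smul]
  · change -(a • ι k • n') + (x : AddMonoid.End M) (ι k • n') + op (ι k * a') • n
      - sact ℳ (idA M (ι k) * x') n = -((a * ι k) • n') + (x : AddMonoid.End M) (ι k • n')
      + op a' • op (ι k) • n - sact ℳ x' (op (ι k) • n)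
    rw [sact_op_smul hM hx', mul_smul, op_mul, mul_smul]
  · change EE ℳ q m (ι k • n') + EE ℳ q n (ι k • m') + sbr ℳ x (idA M (ι k) * x') =
      EE ℳ q (op (ι k) • m) n' + EE ℳ q (op (ι k) • n) m' + sbr ℳ (x * idA M (ι k)) x'
    rw [EE_op_smul_left hM hq hA, EE_op_smul_left hM hq hA, sbr_mul_idA_left hM hx hx']

theorem isDerivationDeg_brInf {α : ZMod 2} {u : EInf A E} (hu : u ∈ gradInf 𝒜 ℳ E α) :
    IsDerivationDeg (gradInf 𝒜 ℳ E) (brInf hE) (rsmulLin hE) α (brInf hE u) := by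
  refine ⟨fun k v => brInf_rsmul hE hM hq k u v, fun β v hv => brInf_mem hE hM hq hu hv,
    fun β v hv w => ?_⟩
  refine gradInf_induction hE (𝒜 := 𝒜) (P := fun w => brInf hE u (brInf hE v w) =
    brInf hE (brInf hE u v) w + sgn α β • brInf hE v (brInf hE u w)) (fun γ w hw => ?_)
    (fun w w' h h' => ?_) w
  · exact eInf_ext (jacobi_fst hE hA hM hq hu hv hw) (jacobi_snd hE hA hM hq hu hv hw)
      (jacobi_thd hE hA hM hq hu hv hw) (jacobi_fth hE hA hM hq hu hv hw)
  · rw [map_add, map_add, map_add, h, h', map_add, map_add, smul_add]; abel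

theorem brInf_mem_derInf (u : EInf A E) :
    (brInf hE u : AddMonoid.End (EInf A E)) ∈ derInf 𝒜 hE :=
  gradInf_induction hE (𝒜 := 𝒜) (P := fun u => (brInf hE u : AddMonoid.End (EInf A E)) ∈ derInf 𝒜 hE)
    (fun _ _ hu => (isDerivationDeg_brInf hE hA hM hq hu).mem_Der)
    (fun u v hu hv => by rw [map_add]; exact add_mem hu hv) u

theorem adInf_le_derInf : adInf hE ≤ derInf 𝒜 hE := fun d hd => by
  obtain ⟨u, rfl⟩ := exists_eq_brInf hE hd
  exact brInf_mem_derInf hE hA hM hq u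

theorem isGradedSub_adInf : IsGradedSub (endDeg (gradInf 𝒜 ℳ E)) (adInf hE) := fun d hd => by
  obtain ⟨u, rfl⟩ := exists_eq_brInf hE hd
  obtain ⟨v, hv, w, hw, rfl⟩ := exists_add_gradInf 𝒜 hE u
  rw [map_add]
  exact add_mem
    (AddSubgroup.mem_iSup_of_mem 0 ⟨brInf_mem_adInf hE v, (isDerivationDeg_brInf hE hA hM hq hv).2.1⟩)
    (AddSubgroup.mem_iSup_of_mem 1 ⟨brInf_mem_adInf hE w, (isDerivationDeg_brInf hE hA hM hq hw).2.1⟩)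

theorem isSubsupermodule_adInf :
    IsSubsupermodule (gradInf 𝒜 ℳ E) (lsmulInf hE) (adInf hE) where
  graded := isGradedSub_adInf hE hA hM hq
  smul_mem k d hd := by
    obtain ⟨u, rfl⟩ := exists_eq_brInf hE hd
    exact ⟨lsmulInf hE k u, fun v => (lsmul_brInf hE hA hM hq k u v).symm⟩
  mul_smul_mem k d hd := by
    obtain ⟨u, rfl⟩ := exists_eq_brInf hE hd
    exact ⟨rsmulInf hE k u, fun v => brInf_lsmul hE hA hM hq k u v⟩

/-- No knowledge of the centre is needed: if `u = v + w` with `v` even and `w` odd, the adjoint map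
of the component of the wrong degree has both degrees and so vanishes, even if the component itself
does not. -/
theorem exists_eq_brInf_of_mem_endDeg {β : ZMod 2} {d : AddMonoid.End (EInf A E)}
    (hd : d ∈ adInf hE) (hβ : d ∈ endDeg (gradInf 𝒜 ℳ E) β) :
    ∃ u ∈ gradInf 𝒜 ℳ E β, d = brInf hE u := by
  obtain ⟨u, rfl⟩ := exists_eq_brInf hE hd
  obtain ⟨v, hv, w, hw, rfl⟩ := exists_add_gradInf 𝒜 hE u
  have hv' := (isDerivationDeg_brInf hE hA hM hq hv).2.1
  have hw' := (isDerivationDeg_brInf hE hA hM hq hw).2.1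
  have e := map_add (brInf hE) v w
  have hz : ∀ β : ZMod 2, β = 0 ∨ β = 1 := by decide
  rcases hz β with rfl | rfl
  · refine ⟨v, hv, ?_⟩
    have h0 : (brInf hE w : AddMonoid.End (EInf A E)) ∈ endDeg (gradInf 𝒜 ℳ E) 0 := by
      rw [show (brInf hE w : AddMonoid.End (EInf A E)) = brInf hE (v + w) - brInf hE v by
        rw [e]; abel]
      exact sub_mem hβ hv'
    rw [e, show brInf hE w = 0 from endDeg_gradInf_disjoint hE _ h0 hw', add_zero]
  · refine ⟨w, hw, ?_⟩
    have h0 : (brInf hE v : AddMonoid.End (EInf A E)) ∈ endDeg (gradInf 𝒜 ℳ E) 1 := by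
      rw [show (brInf hE v : AddMonoid.End (EInf A E)) = brInf hE (v + w) - brInf hE w by
        rw [e]; abel]
      exact sub_mem hβ hw'
    rw [e, show brInf hE v = 0 from endDeg_gradInf_disjoint hE _ hv' h0, zero_add]

theorem adInf_ideal {α β : ZMod 2} {f g : AddMonoid.End (EInf A E)}
    (hf : f ∈ derInf 𝒜 hE ⊓ endDeg (gradInf 𝒜 ℳ E) α)
    (hg : g ∈ adInf hE ⊓ endDeg (gradInf 𝒜 ℳ E) β) : f * g - sgn α β • (g * f) ∈ adInf hE := by
  obtain ⟨u, hu, rfl⟩ := exists_eq_brInf_of_mem_endDeg hE hA hM hq hg.1 hg.2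
  have h := isDerivationDeg_of_mem_Der (L := rsmulLin hE)
    (endDeg_gradInf_disjoint hE (𝒜 := 𝒜)) hf.1 hf.2
  -- The bracket of a derivation `f` with `ad u` is `ad (f u)`.
  refine ⟨f u, fun v => ?_⟩
  change f (brInf hE u v) - sgn α β • brInf hE u (f v) = _
  rw [h.2.2 β u hu v, add_sub_cancel_right]

omit hA hM hq [GradedRing 𝒜] in
/-- The endomorphism `(a, m, n, x) ↦ (f a, S m, S n, [S, x])` of `E_∞`. -/
def diagInf (S : AddMonoid.End M) (f : AddMonoid.End A) (hS : ∀ x ∈ E, sbr ℳ S x ∈ E) :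
    AddMonoid.End (EInf A E) :=
  AddMonoidHom.mk' (fun u => (f u.1, S u.2.1, S u.2.2.1, ⟨sbr ℳ S u.2.2.2, hS _ u.2.2.2.2⟩))
    (fun _ _ => eInf_ext (map_add f _ _) (map_add S _ _) (map_add S _ _) (map_add (sbr ℳ S) _ _))

omit hA [GradedRing 𝒜] in
theorem diagInf_leibniz {ξ : ZMod 2} {S : AddMonoid.End M} {f : AddMonoid.End A}
    (hS : ∀ x ∈ E, sbr ℳ S x ∈ E) (h : IsDifferential 𝒜 ℳ q ξ S f) {α β : ZMod 2}
    {u v : EInf A E} (hu : u ∈ gradInf 𝒜 ℳ E α) (hv : v ∈ gradInf 𝒜 ℳ E β) :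
    diagInf S f hS (brInf hE u v) = brInf hE (diagInf S f hS u) v
      + sgn ξ α • brInf hE u (diagInf S f hS v) := by
  have hd : ∀ γ, ∀ w ∈ gradInf 𝒜 ℳ E γ, diagInf S f hS w ∈ gradInf 𝒜 ℳ E (ξ + γ) :=
    fun γ w hw => ⟨h.degree_base _ _ hw.1, h.degree _ _ hw.2.1, h.degree _ _ hw.2.2.1,
      sbr_mem_endDeg ℳ h.degree hw.2.2.2⟩
  have d1 : ∀ w : EInf A E, (diagInf S f hS w).1 = f w.1 := fun _ => rfl
  have d2 : ∀ w : EInf A E, (diagInf S f hS w).2.1 = S w.2.1 := fun _ => rfl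
  have d3 : ∀ w : EInf A E, (diagInf S f hS w).2.2.1 = S w.2.2.1 := fun _ => rfl
  have d4 : ∀ w : EInf A E, ((diagInf S f hS w).2.2.2 : AddMonoid.End M) = sbr ℳ S w.2.2.2 :=
    fun _ => rfl
  refine eInf_ext ?_ ?_ ?_ ?_
  · rw [Prod.fst_add, Prod.smul_fst, d1]
    simp only [brInf_fst, d1, d2, d3, map_sub, h.map_form _ _ hu.2.1, h.map_form _ _ hu.2.2.1,
      smul_sub]
    abel
  · rw [Prod.snd_add, Prod.fst_add, Prod.smul_snd, Prod.smul_fst, d2]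
    rw [brInf_snd_of_mem hE hM hu hv, brInf_snd_of_mem hE hM (hd _ _ hu) hv,
      brInf_snd_of_mem hE hM hu (hd _ _ hv)]
    simp only [d1, d2, d3, d4, map_add, map_sub, map_zsmul, sbr_of_mem ℳ h.degree hu.2.2.2,
      sbr_of_mem ℳ h.degree hv.2.2.2, end_sub_apply, end_zsmul_apply, end_mul_apply,
      h.map_smul _ _ hu.1, h.map_smul _ _ hv.1, sgn_add_left, sgn_add_right, sgn_comm α ξ]
    rcases sgn_eq_one_or α β with h1 | h1 <;> rcases sgn_eq_one_or ξ α with h2 | h2 <;>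
      rcases sgn_eq_one_or ξ β with h3 | h3 <;> simp only [h1, h2, h3] <;>
      simp only [one_smul, neg_smul, mul_neg, mul_one, neg_neg, sub_neg_eq_add, smul_add, smul_sub,
        smul_neg] <;> abel
  · rw [Prod.snd_add, Prod.snd_add, Prod.fst_add, Prod.smul_snd, Prod.smul_snd, Prod.smul_fst, d3]
    rw [brInf_thd_of_mem hE hM hu hv, brInf_thd_of_mem hE hM (hd _ _ hu) hv,
      brInf_thd_of_mem hE hM hu (hd _ _ hv)]
    simp only [d1, d2, d3, d4, map_add, map_sub, map_neg, map_zsmul,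
      sbr_of_mem ℳ h.degree hu.2.2.2,
      sbr_of_mem ℳ h.degree hv.2.2.2, end_sub_apply, end_zsmul_apply, end_mul_apply,
      h.map_smul _ _ hu.1, h.map_smul _ _ hv.1, sgn_add_left, sgn_add_right, sgn_comm α ξ]
    rcases sgn_eq_one_or α β with h1 | h1 <;> rcases sgn_eq_one_or ξ α with h2 | h2 <;>
      rcases sgn_eq_one_or ξ β with h3 | h3 <;> simp only [h1, h2, h3] <;>
      simp only [one_smul, neg_smul, mul_neg, mul_one, neg_neg, sub_neg_eq_add, smul_add, smul_sub,
        smul_neg] <;> abel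
  · change ((diagInf S f hS (brInf hE u v)).2.2.2 : AddMonoid.End M) =
      (brInf hE (diagInf S f hS u) v).2.2.2 + sgn ξ α • (brInf hE u (diagInf S f hS v)).2.2.2
    rw [d4]
    simp only [brInf_fth, d2, d3, d4, map_add, h.bracket_EE hM hq hu.2.1 hv.2.2.1,
      h.bracket_EE hM hq hu.2.2.1 hv.2.1, sbr_sbr ℳ h.degree hu.2.2.2 hv.2.2.2, zsmul_add]
    abel

omit hA in
theorem isDerivationDeg_diagInf {ξ : ZMod 2} {S : AddMonoid.End M} {f : AddMonoid.End A}
    (hS : ∀ x ∈ E, sbr ℳ S x ∈ E) (h : IsDifferential 𝒜 ℳ q ξ S f)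
    (hl : ∀ k, ∀ x ∈ E, sbr ℳ S (x * idA M (ι k)) = sbr ℳ S x * idA M (ι k))
    (hSl : S ∈ linEnd M ι) (hfl : f ∈ linEnd A ι) :
    IsDerivationDeg (gradInf 𝒜 ℳ E) (brInf hE) (rsmulLin hE) ξ (diagInf S f hS) := by
  refine ⟨fun k u => ?_, fun α u hu => ⟨h.degree_base _ _ hu.1, h.degree _ _ hu.2.1,
    h.degree _ _ hu.2.2.1, sbr_mem_endDeg ℳ h.degree hu.2.2.2⟩, fun α u hu v => ?_⟩
  · exact eInf_ext (hfl k _) (hSl k _) (hSl k _) (hl k _ u.2.2.2.2)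
  · refine gradInf_induction hE (𝒜 := 𝒜) (P := fun v => diagInf S f hS (brInf hE u v) =
      brInf hE (diagInf S f hS u) v + sgn ξ α • brInf hE u (diagInf S f hS v))
      (fun β v hv => diagInf_leibniz hE hM hq hS h hu hv) (fun v w hv hw => ?_) v
    rw [map_add, map_add, map_add, hv, hw, map_add, map_add, smul_add]; abel

omit hA hq in
-- A variant of `sbr_mul_idA` for an `S` that commutes with one given scalar only. It is meant for
-- lifts of derivations, which are linear over `K` but not over `A`.
theorem sbr_mul_idA_of_commute {ξ : ZMod 2} {S : AddMonoid.End M} (hξ : S ∈ endDeg ℳ ξ)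
    {α : ZMod 2} {a : A} (ha : a ∈ 𝒜 α) (hS : ∀ m, S (op a • m) = op a • S m)
    {x : AddMonoid.End M} (hx : x ∈ linEnd M (RingHom.id A)) :
    sbr ℳ S (x * idA M a) = sbr ℳ S x * idA M a := by
  refine linEnd_induction hM (P := fun x => sbr ℳ S (x * idA M a) = sbr ℳ S x * idA M a)
    (fun η x hx hη => ?_) (fun x y h h' => ?_) hx
  · have e : S * idA M a = sgn ξ α • (idA M a * S) := end_ext fun m => hM.map_smul hξ hS ha m
    rw [sbr_of_mem ℳ hξ hη, sbr_of_mem ℳ hξ (mul_mem_endDeg ℳ hη (hM.idA_mem ha)), sub_mul,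
      smul_mul_assoc, mul_assoc x S, e, mul_smul_comm, sgn_add_right, mul_assoc, mul_assoc,
      mul_smul, smul_comm (sgn ξ η)]
  · rw [add_mul, map_add, map_add, h, h', add_mul]

end Modules

/-! ### Matrices with finitely many diagonals, and osp_fd as a subalgebra -/

section Modules

variable {K A M : Type*} [Ring K] [Ring A] [AddCommGroup M] [Module A M] [Module Aᵐᵒᵖ M]
  [SMulCommClass A Aᵐᵒᵖ M]
  {𝒜 : ZMod 2 → AddSubgroup A} {ℳ : ZMod 2 → AddSubgroup M} {q : M →+ M →+ A}
  {ι : K →+* A} {I : AddSubgroup ℚ} (b : Module.Basis I A M)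

/-- The additive endomorphisms with finitely many nonzero diagonals. -/
def finDiag : AddSubgroup (AddMonoid.End M) where
  carrier := {x | (diagonals b x).Finite}
  add_mem' := by
    rintro x y hx hy
    refine (hx.union hy).subset ?_
    rintro c ⟨i, j, hc, h⟩
    by_cases h0 : b.repr (x (b j)) i = 0
    · exact Or.inr ⟨i, j, hc, by simpa [end_add_apply, h0] using h⟩
    · exact Or.inl ⟨i, j, hc, h0⟩
  zero_mem' := by simp [diagonals]
  neg_mem' hx := by simpa [diagonals, end_neg_apply] using hx

theorem mem_finDiag {x : AddMonoid.End M} : x ∈ finDiag b ↔ (diagonals b x).Finite := Iff.rfl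

/-- If `x` has nonzero entries only where one of `y` or `z` does on the same diagonal, it has
finitely many diagonals. -/
theorem finDiag_of_subset {x y : AddMonoid.End M} (hy : y ∈ finDiag b)
    (h : ∀ i j, b.repr (y (b j)) i = 0 → b.repr (x (b j)) i = 0) : x ∈ finDiag b := by
  refine Set.Finite.subset ((mem_finDiag b).1 hy) ?_
  rintro c ⟨i, j, hc, h'⟩
  exact ⟨i, j, hc, fun h0 => h' (h i j h0)⟩

section FiniteDiagonals

variable [GradedRing 𝒜] (hM : IsSupermodule 𝒜 ℳ) {p : I → ZMod 2} (hp : ∀ i, b i ∈ ℳ (p i))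
include hp

/-- Additive statements hold on `M` if they hold on homogeneous multiples of basis vectors. -/
theorem basis_induction (𝒜 : ZMod 2 → AddSubgroup A) [GradedRing 𝒜] {P : M → Prop}
    (hom : ∀ α, ∀ a ∈ 𝒜 α, ∀ i, P (a • b i))
    (add : ∀ v w, P v → P w → P (v + w)) (v : M) : P v := by
  have := hp
  have h0 : P 0 := by simpa using hom 0 0 (zero_mem _) 0
  have hv := b.mem_span v
  induction hv using Submodule.span_induction with
  | mem x h =>
    obtain ⟨i, rfl⟩ := h
    simpa using hom 0 1 SetLike.GradedOne.one_mem i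
  | zero => exact h0
  | add x y _ _ hx hy => exact add x y hx hy
  | smul a x _ _ => 
    rw [← b.linearCombination_repr (a • x), Finsupp.linearCombination_apply, Finsupp.sum]
    refine Finset.sum_induction _ P add h0 fun i _ => ?_
    exact homogeneous_induction 𝒜 (P := fun c => P (c • b i)) (fun α c hc => hom α c hc i)
      (fun c d hc hd => by rw [add_smul]; exact add _ _ hc hd) _

include hM

theorem exists_op_smul_eq (a : A) (i : I) : ∃ c : A, op a • b i = c • b i := by
  refine homogeneous_induction 𝒜 (P := fun a => ∃ c : A, op a • b i = c • b i)
    (fun α a ha => ⟨sgn α (p i) • a, by rw [hM.op_smul ha (hp i), smul_assoc]⟩) ?_ a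
  rintro x y ⟨c, hc⟩ ⟨d, hd⟩
  exact ⟨c + d, by rw [op_add, add_smul, hc, hd, add_smul]⟩

/-- Matrix entries are left coordinates, while the maps considered are linear on the right. On a
homogeneous basis vector the two actions differ by signs on the components of the scalar, so one can
pass between them. -/
theorem exists_smul_eq_op (a : A) (i : I) : ∃ c : A, a • b i = op c • b i := by
  refine homogeneous_induction 𝒜 (P := fun a => ∃ c : A, a • b i = op c • b i)
    (fun α a ha => ⟨sgn α (p i) • a, by
      rw [hM.smul_eq _ _ a ha _ (hp i), op_smul, smul_assoc]⟩) ?_ a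
  rintro x y ⟨c, hc⟩ ⟨d, hd⟩
  exact ⟨c + d, by rw [add_smul, op_add, add_smul, hc, hd]⟩

theorem repr_op_smul_eq_zero (a : A) {v : M} {i : I} (h : b.repr v i = 0) :
    b.repr (op a • v) i = 0 := by
  have key : ∀ v, b.repr (op a • v) i = b.repr v i * b.repr (op a • b i) i := by
    refine basis_induction b hp 𝒜 (fun α c _ j => ?_) fun v w hv hw => ?_
    · obtain ⟨d, hd⟩ := exists_op_smul_eq b hM hp a j
      rw [← smul_comm c (op a), hd]
      by_cases e : j = i
      · subst e
        simp [hd]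
      · simp [Finsupp.single_apply, e]
    · rw [smul_add, map_add, Finsupp.add_apply, hv, hw, map_add, Finsupp.add_apply, add_mul]
  rw [key, h, zero_mul]

theorem mem_endDeg_of_basis [DirectSum.Decomposition ℳ] {ξ : ZMod 2} {f : AddMonoid.End M}
    (h : ∀ α, ∀ a ∈ 𝒜 α, ∀ i, f (a • b i) ∈ ℳ (ξ + (α + p i))) : f ∈ endDeg ℳ ξ := by
  intro β v hv
  -- Replacing `v` by its projection makes the claim additive in an arbitrary vector, so that the
  -- homogeneity hypothesis can be dropped and the induction over the basis applies.
  rw [← proj_same ℳ hv]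
  clear hv
  revert v
  refine basis_induction b hp 𝒜 (fun α a ha i => ?_) fun v w hv hw => ?_
  · by_cases e : α + p i = β
    · subst e
      rw [proj_same ℳ (hM.smul_mem _ _ a ha _ (hp i))]
      exact h α a ha i
    · rw [proj_ne ℳ (hM.smul_mem _ _ a ha _ (hp i)) e, map_zero]
      exact zero_mem _
  · rw [map_add, map_add]; exact add_mem hv hw

theorem repr_mul_eq_zero {x y : AddMonoid.End M} (hx : x ∈ linEnd M (RingHom.id A)) {i j : I}
    (h : ∀ k, b.repr (y (b j)) k = 0 ∨ b.repr (x (b k)) i = 0) :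
    b.repr ((x * y) (b j)) i = 0 := by
  rw [end_mul_apply, ← b.linearCombination_repr (y (b j)), Finsupp.linearCombination_apply,
    Finsupp.sum, map_sum, map_sum, Finsupp.finsetSum_apply]
  refine Finset.sum_eq_zero fun k hk => ?_
  obtain ⟨c, hc⟩ := exists_smul_eq_op b hM hp (b.repr (y (b j)) k) k
  rw [hc, linEnd_id_apply hx]
  exact repr_op_smul_eq_zero b hM hp c ((h k).resolve_left (Finsupp.mem_support_iff.1 hk))

theorem mul_mem_finDiag {x y : AddMonoid.End M} (hx : x ∈ linEnd M (RingHom.id A))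
    (hxf : x ∈ finDiag b) (hyf : y ∈ finDiag b) : x * y ∈ finDiag b := by
  -- A nonzero `(i, j)` entry of the product needs some `k` with nonzero entries `y_kj` and `x_ik`,
  -- and `j - i = (j - k) + (k - i)`. So the diagonals of the product are sums of diagonals of the
  -- factors.
  refine Set.Finite.subset (Set.Finite.image2 (· + ·) hyf hxf) ?_
  rintro c ⟨i, j, rfl, h⟩
  by_contra hc
  refine h (repr_mul_eq_zero b hM hp hx fun k => ?_)
  by_contra! hk
  exact hc ⟨_, ⟨k, j, rfl, hk.1⟩, _, ⟨i, k, rfl, hk.2⟩, by ring⟩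

omit hM hp [GradedRing 𝒜] in
theorem idA_mul_mem_finDiag (a : A) {x : AddMonoid.End M} (hx : x ∈ finDiag b) :
    idA M a * x ∈ finDiag b :=
  finDiag_of_subset b hx fun i j h => by
    rw [end_mul_apply, idA_apply, map_smul, Finsupp.smul_apply, h, smul_zero]

theorem mul_idA_mem_finDiag (a : A) {x : AddMonoid.End M} (hx : x ∈ linEnd M (RingHom.id A))
    (hxf : x ∈ finDiag b) : x * idA M a ∈ finDiag b :=
  finDiag_of_subset b hxf fun i j h => by
    obtain ⟨c, hc⟩ := exists_smul_eq_op b hM hp a j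
    rw [end_mul_apply, idA_apply, hc, linEnd_id_apply hx]
    exact repr_op_smul_eq_zero b hM hp c h

variable {ε : I → ℤ} (hε : ∀ i, ε i * ε i = 1)
  (hqε : ∀ i j, q (b i) (b j) = if i = -j then ((ε i : ℤ) : A) else 0)
  (hA : IsSupercommutative 𝒜) (hq : IsQuadraticForm 𝒜 ℳ q)

variable [DirectSum.Decomposition ℳ]

include hA hq hqε hε

/-- The basis is dual to itself up to `i ↦ -i` and a sign. Through this the projections onto
degrees, which commute with `q` against a homogeneous vector, can be followed on matrix entries. -/
theorem repr_eq (v : M) (i : I) : b.repr v i = q v (b (-i)) * ((ε i : ℤ) : A) := by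
  revert v
  refine basis_induction b hp 𝒜 (fun α a _ j => ?_) fun v w hv hw => ?_
  · rw [hq.smul_left hA hM, hqε, neg_neg]
    by_cases e : j = i
    · subst e
      rw [if_pos rfl, mul_assoc, ← Int.cast_mul, hε]
      simp
    · simp [Finsupp.single_apply, e]
  · rw [map_add, Finsupp.add_apply, hv, hw, map_add, AddMonoidHom.add_apply, add_mul]

theorem repr_eq_zero_iff (v : M) (i : I) : b.repr v i = 0 ↔ q v (b (-i)) = 0 := by
  rw [repr_eq b hM hp hε hqε hA hq]
  refine ⟨fun h => ?_, fun h => by rw [h, zero_mul]⟩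
  have := congrArg (· * ((ε i : ℤ) : A)) h
  simpa only [mul_assoc, ← Int.cast_mul, hε, Int.cast_one, mul_one, zero_mul] using this

theorem part_mem_finDiag {x : AddMonoid.End M} (hx : x ∈ finDiag b) (ξ : ZMod 2) :
    part ℳ ξ x ∈ finDiag b :=
  finDiag_of_subset b hx fun i j h => by
    rw [repr_eq_zero_iff b hM hp hε hqε hA hq] at h ⊢
    rw [part_apply_of_mem ℳ ξ x (hp j), hq.proj_left hA hM _ (hp _), h, map_zero]

theorem mul_idA_mem_osp (a : A) {x : AddMonoid.End M} (hx : x ∈ osp ℳ q) :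
    x * idA M a ∈ osp ℳ q := by
  have := hε
  have := hqε
  revert a
  refine homogeneous_induction 𝒜 (fun α a ha => ?_) fun a c h h' => ?_
  · rw [← part_add_part ℳ x, add_mul]
    have key : ∀ ξ, part ℳ ξ x * idA M a ∈ osp ℳ q := fun ξ => by
      rw [hM.mul_idA (part_mem ℳ ξ x) (hM.part_mem_linEnd hx.1 ξ) ha]
      exact zsmul_mem (idA_mul_mem_osp hA hM hq a (part_mem_osp hA hM hq hx ξ)) _
    exact add_mem (key 0) (key 1)
  · rw [idA_add, mul_add]; exact add_mem h h'

theorem EE_basis_mem_finDiag (i j : I) : EE ℳ q (b i) (b j) ∈ finDiag b := by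
  -- The map only sends `b (-j)` to a multiple of `b i` and `b (-i)` to a multiple of `b j`. Both
  -- entries sit on the diagonal `-i - j`.
  refine Set.Finite.subset (Set.finite_singleton (-(i : ℚ) - j)) ?_
  rintro c ⟨k, l, rfl, h⟩
  rw [Set.mem_singleton_iff]
  by_contra hc
  apply h
  rw [EE_apply_of_mem _ (hp j) (hp l), hqε, hqε, map_sub, map_zsmul, b.repr.map_smul, Finsupp.sub_apply,
    Finsupp.smul_apply, Finsupp.smul_apply]
  have e1 : b.repr (op (if j = -l then ((ε j : ℤ) : A) else 0) • b i) k = 0 := by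
    refine if h1 : j = -l then ?_ else by simp [h1]
    refine repr_op_smul_eq_zero b hM hp _ ?_
    rw [b.repr_self, Finsupp.single_apply, if_neg]
    rintro rfl
    exact hc (by rw [h1]; push_cast; ring)
  have e2 : (if i = -l then ((ε i : ℤ) : A) else 0) • b.repr (b j) k = 0 := by
    refine if h1 : i = -l then ?_ else by simp [h1]
    have h2 : j ≠ k := by
      rintro rfl
      exact hc (by rw [h1]; push_cast; ring)
    rw [b.repr_self, Finsupp.single_apply, if_neg h2, smul_zero]
  rw [e1, e2, smul_zero, sub_zero]

theorem EE_mem_finDiag (m n : M) : EE ℳ q m n ∈ finDiag b := by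
  revert m
  refine basis_induction b hp 𝒜 (fun α a _ i => ?_) fun m m' h h' => ?_
  swap
  · rw [map_add, AddMonoidHom.add_apply]; exact add_mem h h'
  rw [EE_smul_left hA hM hq]
  refine idA_mul_mem_finDiag b a ?_
  revert n
  refine basis_induction b hp 𝒜 (fun β c _ j => ?_) fun n n' h h' => ?_
  swap
  · rw [map_add]; exact add_mem h h'
  obtain ⟨d, hd⟩ := exists_smul_eq_op b hM hp c j
  rw [hd, EE_op_smul_right hM hq]
  exact mul_idA_mem_finDiag b hM hp d (EE_mem_linEnd hM hq _ _)
    (EE_basis_mem_finDiag b hM hp hε hqε hA hq i j)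

theorem isGradedSub_ospFd : IsGradedSub (endDeg ℳ) (ospFd ℳ q b) :=
  isGradedSub_of_part_mem ℳ fun x hx ξ =>
    ⟨part_mem_osp hA hM hq hx.1 ξ, part_mem_finDiag b hM hp hε hqε hA hq hx.2 ξ⟩

theorem isOspSubalgebra_ospFd (ι : K →+* A) : IsOspSubalgebra ℳ q ι (ospFd ℳ q b) where
  le_osp _ hx := hx.1
  eosp_le := by
    refine (AddSubgroup.closure_le _).2 ?_
    rintro _ ⟨m, n, rfl⟩
    exact ⟨EE_mem_osp hA hM hq m n, EE_mem_finDiag b hM hp hε hqε hA hq m n⟩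
  submodule :=
    { graded := isGradedSub_ospFd b hM hp hε hqε hA hq
      smul_mem := fun _ _ hx =>
        ⟨idA_mul_mem_osp hA hM hq _ hx.1, idA_mul_mem_finDiag b _ hx.2⟩
      mul_smul_mem := fun _ _ hx =>
        ⟨mul_idA_mem_osp b hM hp hε hqε hA hq _ hx.1, mul_idA_mem_finDiag b hM hp _ hx.1.1 hx.2⟩ }
  bracket_mem _ hx y hy := by
    have hg := isGradedSub_ospFd b hM hp hε hqε hA hq
    refine hg.induction (P := fun x => sbr ℳ x y ∈ ospFd ℳ q b) (fun ξ x hx hξ => ?_)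
      (fun x x' h h' => by rw [map_add]; exact add_mem h h') hx
    refine hg.induction (P := fun y => sbr ℳ x y ∈ ospFd ℳ q b) (fun η y hy hη => ?_)
      (fun x x' h h' => by rw [map_add]; exact add_mem h h') hy
    refine ⟨bracket_mem_osp hq hx.1 hξ hy.1 hη, ?_⟩
    rw [sbr_of_mem ℳ hξ hη]
    exact sub_mem (mul_mem_finDiag b hM hp hx.1.1 hx.2 hy.2)
      (zsmul_mem (mul_mem_finDiag b hM hp hy.1.1 hy.2 hx.2) _)

end FiniteDiagonals

/-! ### The diagonal weight operator -/

section Degree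

variable (w : I → ℤ)

/-- The diagonal endomorphism with integral eigenvalues `w i`. -/
noncomputable def diagEnd : AddMonoid.End M :=
  (b.constr ℤ fun i => w i • b i).toAddMonoidHom

theorem diagEnd_smul_basis (a : A) (i : I) : diagEnd b w (a • b i) = w i • (a • b i) := by
  change b.constr ℤ (fun i => w i • b i) (a • b i) = _
  rw [map_smul, b.constr_basis, smul_comm]

theorem diagEnd_basis (i : I) : diagEnd b w (b i) = w i • b i := by
  simpa using diagEnd_smul_basis b w 1 i

variable [GradedRing 𝒜] (hM : IsSupermodule 𝒜 ℳ) {p : I → ZMod 2} (hp : ∀ i, b i ∈ ℳ (p i))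

include hp hM

omit hM in
theorem repr_diagEnd (𝒜 : ZMod 2 → AddSubgroup A) [GradedRing 𝒜] (v : M) (i : I) :
    b.repr (diagEnd b w v) i = w i • b.repr v i := by
  revert v
  refine basis_induction b hp 𝒜 (fun α a _ j => ?_) fun v w hv hw => ?_
  · rw [diagEnd_smul_basis, map_zsmul, Finsupp.smul_apply]
    by_cases e : j = i
    · rw [e]
    · simp [Finsupp.single_apply, e]
  · rw [map_add, map_add, Finsupp.add_apply, hv, hw, map_add, Finsupp.add_apply, smul_add]

theorem diagEnd_mem_linEnd : diagEnd b w ∈ linEnd M (RingHom.id A) := fun a => by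
  refine basis_induction b hp 𝒜 (fun α c _ i => ?_) fun v w hv hw => ?_
  · obtain ⟨d, hd⟩ := exists_op_smul_eq b hM hp a i
    rw [RingHom.id_apply, ← smul_comm c (op a), hd, diagEnd_smul_basis, ← mul_smul,
      diagEnd_smul_basis, mul_smul, ← hd, smul_comm c (op a), smul_comm (op a) (w i)]
  · rw [smul_add, map_add, hv, hw, map_add, smul_add]

variable [DirectSum.Decomposition ℳ]

theorem diagEnd_mem_endDeg : diagEnd b w ∈ endDeg ℳ 0 :=
  mem_endDeg_of_basis b hM hp fun α a ha i => by
    rw [diagEnd_smul_basis, zero_add]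
    exact zsmul_mem (hM.smul_mem _ _ a ha _ (hp i)) _

omit hM hp [GradedRing 𝒜] in
theorem diagEnd_mem_finDiag : diagEnd b w ∈ finDiag b := by
  refine Set.Finite.subset (Set.finite_singleton 0) ?_
  rintro c ⟨i, j, rfl, h⟩
  rw [Set.mem_singleton_iff]
  by_contra hc
  apply h
  rw [diagEnd_basis, map_zsmul, Finsupp.smul_apply, b.repr_self, Finsupp.single_apply, if_neg,
    smul_zero]
  rintro rfl
  exact hc (sub_self _)

variable {ε : I → ℤ} 
  (hqε : ∀ i j, q (b i) (b j) = if i = -j then ((ε i : ℤ) : A) else 0)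
  (hA : IsSupercommutative 𝒜) (hq : IsQuadraticForm 𝒜 ℳ q) (hw : ∀ i, w (-i) = -w i)
include hA hq hqε hw

/-- The form pairs index `i` only with `-i`, where the weights are opposite, so the operator is
skew. -/
theorem diagEnd_mem_osp : diagEnd b w ∈ osp ℳ q := by
  refine mem_osp_of_adjoint hq (diagEnd_mem_linEnd b w hM hp) (diagEnd_mem_endDeg b w hM hp)
    fun β m hm γ n hn => ?_
  clear hm hn
  rw [sgn_zero_left, one_smul]
  revert m
  refine basis_induction b hp 𝒜 (fun α a _ i => ?_) fun v w hv hw => ?_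
  swap
  · rw [map_add, map_add, AddMonoidHom.add_apply, hv, hw, map_add, AddMonoidHom.add_apply, neg_add]
  revert n
  refine basis_induction b hp 𝒜 (fun δ c _ j => ?_) fun v w hv hw => ?_
  swap
  · rw [map_add, hv, hw, map_add, map_add, neg_add]
  obtain ⟨d, hd⟩ := exists_smul_eq_op b hM hp c j
  rw [diagEnd_smul_basis, diagEnd_smul_basis, map_zsmul, AddMonoidHom.smul_apply, map_zsmul,
    hq.smul_left hA hM, hd, hq.map_right, hqε]
  by_cases e : i = -j
  · rw [e, hw, neg_smul]
  · simp [e]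

end Degree

/-- Against an even map all Koszul signs are `1`, so the bracket is the plain commutator even when
`x` is not homogeneous. -/
theorem sbr_of_even [DirectSum.Decomposition ℳ] (x : AddMonoid.End M) {y : AddMonoid.End M}
    (hy : y ∈ endDeg ℳ 0) :
    sbr ℳ x y = x * y - y * x := by
  have key : ∀ ξ, sbr ℳ (part ℳ ξ x) y = part ℳ ξ x * y - y * part ℳ ξ x := fun ξ => by
    rw [sbr_of_mem ℳ (part_mem ℳ ξ x) hy, sgn_zero_right, one_smul]
  conv_lhs => rw [← part_add_part ℳ x, map_add, AddMonoidHom.add_apply, key, key]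
  conv_rhs => rw [← part_add_part ℳ x]
  rw [add_mul, mul_add]; abel

/-! ### The normaliser of osp_fd -/

section Normalizer

variable [GradedRing 𝒜] (hM : IsSupermodule 𝒜 ℳ) {p : I → ZMod 2} (hp : ∀ i, b i ∈ ℳ (p i))
  [DirectSum.Decomposition ℳ] {ε : I → ℤ} (hε : ∀ i, ε i * ε i = 1)
  (hqε : ∀ i j, q (b i) (b j) = if i = -j then ((ε i : ℤ) : A) else 0)
  (hA : IsSupercommutative 𝒜) (hq : IsQuadraticForm 𝒜 ℳ q)
  (w : I → ℤ) (hw : ∀ i, (w i : ℚ) = 2 * i)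
  (hZ : ∀ k : ℤ, k ≠ 0 → IsUnit (k : A))
include hp hM hA hq hqε hw

omit hp hM hA hq hqε [GradedRing 𝒜] [DirectSum.Decomposition ℳ] in
theorem weight_neg (i : I) : w (-i) = -w i := by
  have h1 := hw i
  have h2 := hw (-i)
  have : ((w (-i) : ℤ) : ℚ) = ((-w i : ℤ) : ℚ) := by
    push_cast at h2 ⊢
    rw [h1, h2]; ring
  exact_mod_cast this

omit hp hM hA hq hqε [GradedRing 𝒜] [DirectSum.Decomposition ℳ] in
theorem weight_injective : Function.Injective w := fun i j h => by
  have h1 := hw i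
  have h2 := hw j
  rw [h, h2] at h1
  exact Subtype.ext (by linarith)

theorem diagEnd_mem_ospFd : diagEnd b w ∈ ospFd ℳ q b :=
  ⟨diagEnd_mem_osp b w hM hp hqε hA hq (weight_neg w hw), diagEnd_mem_finDiag b w⟩

include hε hZ

theorem normalizer_ospFd : normalizer ℳ q (ospFd ℳ q b) = (ospFd ℳ q b : Set (AddMonoid.End M)) := by
  ext x
  refine ⟨fun ⟨hx, h⟩ => ⟨hx, ?_⟩, fun hx => ⟨hx.1, fun y hy =>
    (isOspSubalgebra_ospFd b hM hp hε hqε hA hq (RingHom.id A)).bracket_mem x hx y hy⟩⟩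
  have hD := (h _ (diagEnd_mem_ospFd b hM hp hqε hA hq w hw)).2
  rw [sbr_of_even x (diagEnd_mem_endDeg b w hM hp)] at hD
  -- The bracket with the weight operator multiplies the `(i, j)` entry by `w j - w i`, an
  -- invertible integer when `i ≠ j`. It loses only the main diagonal, which is added back as `0`.
  refine Set.Finite.subset (Set.Finite.insert 0 hD) ?_
  rintro c ⟨i, j, rfl, h'⟩
  by_cases e : i = j
  · exact Or.inl (by rw [e, sub_self])
  · refine Or.inr ⟨i, j, rfl, fun h0 => h' ?_⟩
    rw [end_sub_apply, end_mul_apply, end_mul_apply, diagEnd_basis, map_zsmul, map_sub, map_zsmul,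
      Finsupp.sub_apply, Finsupp.smul_apply, repr_diagEnd b w hp 𝒜, ← sub_smul,
      ← Int.cast_smul_eq_zsmul A, smul_eq_mul] at h0
    exact (hZ _ fun h1 => e (weight_injective w hw (sub_eq_zero.1 h1)).symm).mul_right_eq_zero.1 h0

end Normalizer

end Modules

/-! ### Lifting derivations of the base to the module -/

section Modules

variable {K A M : Type*} [Ring K] [Ring A] [AddCommGroup M] [Module A M] [Module Aᵐᵒᵖ M]
  [SMulCommClass A Aᵐᵒᵖ M]
  {𝒜 : ZMod 2 → AddSubgroup A} {ℳ : ZMod 2 → AddSubgroup M} {q : M →+ M →+ A}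
  {ι : K →+* A} {I : AddSubgroup ℚ} (b : Module.Basis I A M)

/-- The adjoint action of the zero-degree part determines brackets with `[f, g]`. -/
theorem sbr_sbr_apply [DirectSum.Decomposition ℳ] {α β : ZMod 2} {f g : AddMonoid.End M}
    (hf : f ∈ endDeg ℳ α) (hg : g ∈ endDeg ℳ β) (x : AddMonoid.End M) :
    sbr ℳ (f * g - sgn α β • (g * f)) x =
      sbr ℳ f (sbr ℳ g x) - sgn α β • sbr ℳ g (sbr ℳ f x) := by
  have key : ∀ ξ, sbr ℳ (f * g - sgn α β • (g * f)) (part ℳ ξ x) =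
      sbr ℳ f (sbr ℳ g (part ℳ ξ x)) - sgn α β • sbr ℳ g (sbr ℳ f (part ℳ ξ x)) := fun ξ => by
    rw [← sbr_of_mem ℳ hf hg, sbr_sbr ℳ hf hg (part_mem ℳ ξ x), add_sub_cancel_right]
  rw [← part_add_part ℳ x]
  simp only [map_add]
  rw [key, key, zsmul_add]
  abel

section Base

omit [SMulCommClass A Aᵐᵒᵖ M] in
theorem IsDerivationDeg.map_one {L : AddSubgroup (AddMonoid.End A)}
    [GradedRing 𝒜] {ξ : ZMod 2}
    {Δ : AddMonoid.End A} (h : IsDerivationDeg 𝒜 AddMonoidHom.mul L ξ Δ) : Δ 1 = 0 := by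
  have := h.2.2 0 1 SetLike.GradedOne.one_mem 1
  rw [sgn_zero_right, one_smul] at this
  simpa using this

theorem linEnd_base_apply {Δ : AddMonoid.End A} (h : Δ ∈ linEnd A ι) (a : A) (k : K) :
    Δ (a * ι k) = Δ a * ι k := h k a

theorem IsDerivationDeg.map_algebraMap [GradedRing 𝒜] {ξ : ZMod 2} {Δ : AddMonoid.End A}
    (h : IsDerivationDeg 𝒜 AddMonoidHom.mul (linEnd A ι) ξ Δ) (k : K) : Δ (ι k) = 0 := by
  rw [← one_mul (ι k), linEnd_base_apply h.1, h.map_one, zero_mul]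

end Base

variable (q) in
theorem deltaM_add (Δ Δ' : AddMonoid.End A) :
    deltaM q b (Δ + Δ') = deltaM q b Δ + deltaM q b Δ' := by
  refine end_ext fun m => ?_
  rw [end_add_apply, deltaM_apply, deltaM_apply, deltaM_apply, ← Finsupp.sum_add]
  refine Finsupp.sum_congr fun i _ => ?_
  simp only [end_add_apply, mul_add, add_mul, add_smul]
  abel

variable {ε : I → ℤ} (hqε : ∀ i j, q (b i) (b j) = if i = -j then ((ε i : ℤ) : A) else 0)
include hqε

/-- The values of the form on dual basis vectors are integers, which a map killing `1` annihilates.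
The correction term in `Δ_M` therefore vanishes, and `Δ_M` is `Δ` applied to each left coordinate.
-/
theorem deltaM_smul_basis {Δ : AddMonoid.End A} (h1 : Δ 1 = 0) (a : A) (i : I) :
    deltaM q b Δ (a • b i) = Δ a • b i := by
  have h2 : Δ (q (b i) (b (-i))) = 0 := by
    rw [hqε, if_pos (neg_neg i).symm, ← zsmul_one, map_zsmul, h1, smul_zero]
  rw [deltaM_apply, map_smul, b.repr_self, Finsupp.smul_single, smul_eq_mul, mul_one,
    Finsupp.sum_single_index, h2]
  · simp
  · simp

variable [GradedRing 𝒜] (hM : IsSupermodule 𝒜 ℳ) {p : I → ZMod 2} (hp : ∀ i, b i ∈ ℳ (p i))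
include hp

theorem repr_deltaM (𝒜 : ZMod 2 → AddSubgroup A) [GradedRing 𝒜] {Δ : AddMonoid.End A}
    (h1 : Δ 1 = 0) (v : M) (i : I) : b.repr (deltaM q b Δ v) i = Δ (b.repr v i) := by
  revert v
  refine basis_induction b hp 𝒜 (fun α a _ j => ?_) fun v w hv hw => ?_
  · rw [deltaM_smul_basis b hqε h1]
    by_cases e : j = i
    · simp [e]
    · simp [Finsupp.single_apply, e]
  · rw [map_add, map_add, Finsupp.add_apply, hv, hw, map_add, Finsupp.add_apply, map_add]

theorem deltaM_idA_mul (𝒜 : ZMod 2 → AddSubgroup A) [GradedRing 𝒜] {Δ : AddMonoid.End A}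
    (h1 : Δ 1 = 0) (a : A) : deltaM q b (idA A a * Δ) = idA M a * deltaM q b Δ := by
  refine end_ext (basis_induction b hp 𝒜 (fun α c _ i => ?_) fun v w hv hw => ?_)
  · rw [end_mul_apply, deltaM_smul_basis b hqε h1, deltaM_smul_basis b hqε, end_mul_apply,
      idA_apply, idA_apply, smul_assoc]
    rw [end_mul_apply, h1, map_zero]
  · rw [map_add, hv, hw, map_add]

theorem deltaM_bracket (𝒜 : ZMod 2 → AddSubgroup A) [GradedRing 𝒜] {Δ Δ' : AddMonoid.End A}
    (h1 : Δ 1 = 0) (h1' : Δ' 1 = 0) (s : ℤ) :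
    deltaM q b (Δ * Δ' - s • (Δ' * Δ)) =
      deltaM q b Δ * deltaM q b Δ' - s • (deltaM q b Δ' * deltaM q b Δ) := by
  refine end_ext (basis_induction b hp 𝒜 (fun α c _ i => ?_) fun v w hv hw => ?_)
  · rw [deltaM_smul_basis b hqε, end_sub_apply, end_sub_apply, end_zsmul_apply, end_zsmul_apply,
      end_mul_apply, end_mul_apply, end_mul_apply, end_mul_apply, deltaM_smul_basis b hqε h1,
      deltaM_smul_basis b hqε h1', deltaM_smul_basis b hqε h1, deltaM_smul_basis b hqε h1',
      sub_smul, smul_assoc]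
    rw [end_sub_apply, end_zsmul_apply, end_mul_apply, end_mul_apply, h1, h1']
    simp
  · rw [map_add, hv, hw, map_add]

variable [DirectSum.Decomposition ℳ] (hA : IsSupercommutative 𝒜) (hq : IsQuadraticForm 𝒜 ℳ q)
include hA hM hq

theorem isDifferential_deltaM {ξ : ZMod 2} {Δ : AddMonoid.End A}
    (h : IsDerivationDeg 𝒜 AddMonoidHom.mul (linEnd A ι) ξ Δ) :
    IsDifferential 𝒜 ℳ q ξ (deltaM q b Δ) Δ where
  degree := mem_endDeg_of_basis b hM hp fun α a ha i => by
    rw [deltaM_smul_basis b hqε h.map_one, ← add_assoc]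
    exact hM.smul_mem _ _ _ (h.2.1 _ _ ha) _ (hp i)
  degree_base := h.2.1
  map_smul α a ha := by
    refine basis_induction b hp 𝒜 (fun β c _ i => ?_) fun v w hv hw => ?_
    · rw [← mul_smul, deltaM_smul_basis b hqε h.map_one, deltaM_smul_basis b hqε h.map_one,
        show Δ (a * c) = Δ a * c + sgn ξ α • (a * Δ c) from h.2.2 α a ha c, add_smul, mul_smul,
        smul_assoc, mul_smul]
    · rw [smul_add, map_add, hv, hw, smul_add, map_add, smul_add, smul_add]
      abel
  map_form α m hm n := by
    rw [← proj_same ℳ hm]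
    clear hm
    revert m
    refine basis_induction b hp 𝒜 (fun β a ha i => ?_) fun v w hv hw => ?_
    swap
    · simp only [map_add, AddMonoidHom.add_apply, hv, hw, smul_add]; abel
    by_cases e : β + p i = α
    swap
    · rw [proj_ne ℳ (hM.smul_mem _ _ a ha _ (hp i)) e]; simp
    subst e
    rw [proj_same ℳ (hM.smul_mem _ _ a ha _ (hp i))]
    revert n
    refine basis_induction b hp 𝒜 (fun γ c hc j => ?_) fun v w hv hw => ?_
    swap
    · simp only [map_add, hv, hw, smul_add]; abel
    -- Since the form on basis vectors takes integer values, it is constant for `Δ`, and the Leibniz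
    -- rule for the form reduces to the one for the product of the coefficients.
    obtain ⟨t, ht⟩ : ∃ t : ℤ, q (b i) (b j) = t • (1 : A) := by
      rw [hqε]
      split_ifs
      · exact ⟨ε i, (zsmul_one _).symm⟩
      · exact ⟨0, (zero_smul _ _).symm⟩
    have key : ∀ δ, ∀ a' : A, ∀ c' ∈ 𝒜 δ, q (a' • b i) (c' • b j) =
        (sgn δ (p i) * t) • (a' * c') := fun δ a' c' hc' => by
      rw [hq.smul_left hA hM, hq.smul_right hA hM hc' (hp i), ht, mul_smul_comm, mul_smul_comm,
        mul_smul_comm, mul_one, mul_smul]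
    rw [deltaM_smul_basis b hqε h.map_one, deltaM_smul_basis b hqε h.map_one, key _ _ _ hc,
      key _ _ _ hc, key _ _ _ (h.2.1 _ _ hc), map_zsmul,
      show Δ (a * c) = Δ a * c + sgn ξ β • (a * Δ c) from h.2.2 β a ha c, smul_add, sgn_add_left,
      sgn_add_right, smul_smul, smul_smul]
    congr 2
    rcases sgn_eq_one_or ξ (p i) with h1 | h1 <;> rcases sgn_eq_one_or ξ β with h2 | h2 <;>
      rcases sgn_eq_one_or γ (p i) with h3 | h3 <;> simp [h1, h2, h3]

theorem deltaM_mem_linEnd {𝒦 : ZMod 2 → AddSubgroup K} [GradedRing 𝒦]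
    (hι : ∀ α, ∀ k ∈ 𝒦 α, ι k ∈ 𝒜 α) {ξ : ZMod 2} {Δ : AddMonoid.End A}
    (h : IsDerivationDeg 𝒜 AddMonoidHom.mul (linEnd A ι) ξ Δ) : deltaM q b Δ ∈ linEnd M ι := by
  have := hA
  have := hq
  refine fun k => homogeneous_induction 𝒦
    (P := fun k => ∀ m, deltaM q b Δ (op (ι k) • m) = op (ι k) • deltaM q b Δ m)
    (fun κ k hk => ?_) (fun k k' hk hk' m => ?_) k
  · refine basis_induction b hp 𝒜 (fun α a _ i => ?_) fun v w hv hw => ?_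
    · rw [← smul_comm a, hM.op_smul (hι κ k hk) (hp i), smul_comm a, ← mul_smul, map_zsmul,
        deltaM_smul_basis b hqε h.map_one, deltaM_smul_basis b hqε h.map_one,
        linEnd_base_apply h.1, ← smul_comm (Δ a), hM.op_smul (hι κ k hk) (hp i),
        smul_comm (Δ a), ← mul_smul (Δ a)]
    · rw [smul_add, map_add, hv, hw, map_add, smul_add]
  · rw [map_add, op_add, add_smul, map_add, hk, hk', add_smul]

omit hA hq hp hqε b in
theorem IsDifferential.sbr_idA {ξ : ZMod 2} {S : AddMonoid.End M} {f : AddMonoid.End A}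
    (h : IsDifferential 𝒜 ℳ q ξ S f) (a : A) : sbr ℳ S (idA M a) = idA M (f a) := by
  revert a
  refine homogeneous_induction 𝒜 (fun α a ha => ?_) fun a c ha hc => ?_
  · rw [sbr_of_mem ℳ h.degree (hM.idA_mem ha)]
    refine end_ext fun m => ?_
    rw [end_sub_apply, end_zsmul_apply, end_mul_apply, end_mul_apply, idA_apply, idA_apply,
      h.map_smul α a ha, add_sub_cancel_right, idA_apply]
  · rw [idA_add, map_add, ha, hc, map_add, idA_add]

omit hA hp hqε b in
theorem IsDifferential.sbr_mem_osp {ξ η : ZMod 2} {S x : AddMonoid.End M}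
    {f : AddMonoid.End A} (h : IsDifferential 𝒜 ℳ q ξ S f) (hx : x ∈ osp ℳ q)
    (hη : x ∈ endDeg ℳ η) : sbr ℳ S x ∈ osp ℳ q := by
  have hb := sbr_of_mem ℳ h.degree hη
  refine mem_osp_of_adjoint hq ?_ (sbr_mem_endDeg ℳ h.degree hη) fun β m hm γ n _ => ?_
  · rw [hb]
    refine fun a => homogeneous_induction 𝒜 (P := fun a => ∀ m,
      (S * x - sgn ξ η • (x * S)) (op a • m) = op a • (S * x - sgn ξ η • (x * S)) m)
      (fun α a ha => ?_) (fun a c ha hc m => ?_) a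
    · refine homogeneous_induction ℳ (fun β m hm => ?_) fun m n hm hn => ?_
      · rw [hM.op_smul ha hm, map_zsmul, hM.op_smul ha ((bracket_mem_endDeg ℳ h.degree hη) β m hm),
          end_sub_apply, end_sub_apply, end_zsmul_apply, end_zsmul_apply]
        simp only [end_mul_apply, hM.map_smul hη (linEnd_id_apply hx.1 a) ha,
          h.map_smul α a ha, map_add, map_zsmul,
          hM.map_smul hη (linEnd_id_apply hx.1 (f a)) (h.degree_base α a ha), sgn_add_right,
          smul_add, smul_sub, sgn_comm α ξ, sgn_comm α η, sgn_comm η ξ]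
        rcases sgn_eq_one_or ξ η with h1 | h1 <;> rcases sgn_eq_one_or ξ α with h2 | h2 <;>
          rcases sgn_eq_one_or η α with h3 | h3 <;> rcases sgn_eq_one_or α β with h4 | h4 <;>
          simp only [h1, h2, h3, h4] <;>
          simp only [one_smul, neg_smul, mul_neg, mul_one, neg_neg, sub_neg_eq_add, smul_neg] <;>
          abel
      · rw [smul_add, map_add, hm, hn, map_add, smul_add]
    · rw [op_add, add_smul, map_add, ha, hc, add_smul]
  · rw [hb]
    -- Differentiate the skewness identity of `x` by `f` and expand both sides with the Leibniz rule
    -- for the form. Combined with skewness against `S m` and `S n`, this is the skewness of the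
    -- bracket.
    have e1 := congrArg f (osp_adjoint hq hx hη hm n)
    rw [map_neg, map_zsmul, h.map_form _ _ (hη β m hm), h.map_form _ _ hm,
      osp_adjoint hq hx hη hm (S n)] at e1
    have e2 := osp_adjoint hq hx hη (h.degree β m hm) n
    simp only [end_sub_apply, end_zsmul_apply, end_mul_apply, map_sub, map_zsmul,
      AddMonoidHom.sub_apply, AddMonoidHom.smul_apply, e2]
    rw [← eq_sub_iff_add_eq] at e1
    rw [e1]
    simp only [sgn_add_left, sgn_add_right, sgn_comm η ξ]
    rcases sgn_eq_one_or ξ η with h1 | h1 <;> rcases sgn_eq_one_or ξ β with h2 | h2 <;>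
      rcases sgn_eq_one_or η β with h3 | h3 <;> simp only [h1, h2, h3] <;>
      simp only [one_smul, neg_smul, mul_neg, mul_one, neg_neg, sub_neg_eq_add, smul_neg, smul_add,
        smul_sub] <;> abel

variable (hε : ∀ i, ε i * ε i = 1)
include hε

theorem sbr_deltaM_mem_of_isDerivationDeg {ξ : ZMod 2} {Δ : AddMonoid.End A}
    (h : IsDerivationDeg 𝒜 AddMonoidHom.mul (linEnd A ι) ξ Δ) {x : AddMonoid.End M}
    (hx : x ∈ ospFd ℳ q b) : sbr ℳ (deltaM q b Δ) x ∈ ospFd ℳ q b := by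
  have hd := isDifferential_deltaM b hqε hM hp hA hq h
  refine (isGradedSub_ospFd b hM hp hε hqε hA hq).induction
    (P := fun x => sbr ℳ (deltaM q b Δ) x ∈ ospFd ℳ q b) (fun η x hx hη => ?_)
    (fun x y hx hy => by rw [map_add]; exact add_mem hx hy) hx
  refine ⟨hd.sbr_mem_osp hM hq hx.1 hη, finDiag_of_subset b hx.2 fun i j h0 => ?_⟩
  -- As the lift kills the basis, the matrix of the bracket is `Δ` applied entrywise to the matrix
  -- of `x`, so no new diagonals appear.
  have h1 : deltaM q b Δ (b j) = 0 := by
    simpa [h.map_one] using deltaM_smul_basis b hqε h.map_one 1 j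
  rw [sbr_of_mem ℳ hd.degree hη, end_sub_apply, end_zsmul_apply, end_mul_apply, end_mul_apply, h1,
    map_zero, smul_zero, sub_zero, repr_deltaM b hqε hp 𝒜 h.map_one, h0, map_zero]

theorem sbr_deltaM_mem {Δ : AddMonoid.End A} (h : Δ ∈ derA 𝒜 ι) {x : AddMonoid.End M}
    (hx : x ∈ ospFd ℳ q b) : sbr ℳ (deltaM q b Δ) x ∈ ospFd ℳ q b := by
  obtain ⟨d₀, d₁, h0, h1, rfl⟩ := exists_of_mem_Der h
  rw [deltaM_add, map_add, AddMonoidHom.add_apply]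
  exact add_mem (sbr_deltaM_mem_of_isDerivationDeg b hqε hM hp hA hq hε h0 hx)
    (sbr_deltaM_mem_of_isDerivationDeg b hqε hM hp hA hq hε h1 hx)

omit hε in
theorem sbr_deltaM_idA {Δ : AddMonoid.End A} (h : Δ ∈ derA 𝒜 ι) (a : A) :
    sbr ℳ (deltaM q b Δ) (idA M a) = idA M (Δ a) := by
  obtain ⟨d₀, d₁, h0, h1, rfl⟩ := exists_of_mem_Der h
  rw [deltaM_add, map_add, AddMonoidHom.add_apply, end_add_apply, idA_add,
    (isDifferential_deltaM b hqε hM hp hA hq h0).sbr_idA hM,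
    (isDifferential_deltaM b hqε hM hp hA hq h1).sbr_idA hM]

theorem deltaM_mem_SS {𝒦 : ZMod 2 → AddSubgroup K} [GradedRing 𝒦]
    (hι : ∀ α, ∀ k ∈ 𝒦 α, ι k ∈ 𝒜 α) {ξ : ZMod 2} {Δ : AddMonoid.End A}
    (h : IsDerivationDeg 𝒜 AddMonoidHom.mul (linEnd A ι) ξ Δ) :
    deltaM q b Δ ∈ SS ℳ q ι (ospFd ℳ q b) := by
  have hd := isDifferential_deltaM b hqε hM hp hA hq h
  refine AddSubgroup.subset_closure ⟨deltaM_mem_linEnd b hqε hM hp hA hq hι h, ⟨ξ, hd.degree⟩,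
    fun a => ⟨Δ a, hd.sbr_idA hM a⟩, fun α β m hm n hn => ?_,
    fun x hx => sbr_deltaM_mem_of_isDerivationDeg b hqε hM hp hA hq hε h hx⟩
  rw [hd.sbr_idA hM, hd.map_form _ _ hm, hq.supersymm _ _ _ (hd.degree _ _ hn) _ hm, smul_smul,
    sgn_add_left, sgn_comm β α]
  rcases sgn_eq_one_or α β with h1 | h1 <;> simp [h1]

theorem derAM_le_SS {𝒦 : ZMod 2 → AddSubgroup K} [GradedRing 𝒦]
    (hι : ∀ α, ∀ k ∈ 𝒦 α, ι k ∈ 𝒜 α) : derAM q ι b 𝒜 ≤ SS ℳ q ι (ospFd ℳ q b) := by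
  rintro _ ⟨Δ, hΔ, rfl⟩
  obtain ⟨d₀, d₁, h0, h1, rfl⟩ := exists_of_mem_Der hΔ
  rw [map_add]
  exact add_mem (deltaM_mem_SS b hqε hM hp hA hq hε hι h0)
    (deltaM_mem_SS b hqε hM hp hA hq hε hι h1)

end Modules

/-! ### The complement formed by lifted derivations -/

section Modules

variable {K A M : Type*} [Ring K] [Ring A] [AddCommGroup M] [Module A M] [Module Aᵐᵒᵖ M]
  [SMulCommClass A Aᵐᵒᵖ M]
  {𝒜 : ZMod 2 → AddSubgroup A} {ℳ : ZMod 2 → AddSubgroup M} {q : M →+ M →+ A}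
  {ι : K →+* A} {I : AddSubgroup ℚ} (b : Module.Basis I A M)

include b in
theorem idA_injective : Function.Injective (idA (A := A) M) := fun a c h => by
  have h1 := congrArg (fun f => b.repr (f (b 0)) 0) h
  simpa [idA_apply] using h1

variable {ε : I → ℤ} (hqε : ∀ i j, q (b i) (b j) = if i = -j then ((ε i : ℤ) : A) else 0)
  [GradedRing 𝒜] (hM : IsSupermodule 𝒜 ℳ) {p : I → ZMod 2} (hp : ∀ i, b i ∈ ℳ (p i))
  [DirectSum.Decomposition ℳ] (hA : IsSupercommutative 𝒜) (hq : IsQuadraticForm 𝒜 ℳ q)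
  (hε : ∀ i, ε i * ε i = 1)
  {𝒦 : ZMod 2 → AddSubgroup K} [GradedRing 𝒦] (hι : ∀ α, ∀ k ∈ 𝒦 α, ι k ∈ 𝒜 α)
  (hE : IsOspSubalgebra ℳ q ι (ospFd ℳ q b))
include hqε hM hp hA hq hε

omit hqε hM hp hA hq hε [GradedRing 𝒜] [DirectSum.Decomposition ℳ] in
theorem derA_apply_one [GradedRing 𝒜] {Δ : AddMonoid.End A} (h : Δ ∈ derA 𝒜 ι) : Δ 1 = 0 := by
  obtain ⟨d₀, d₁, h0, h1, rfl⟩ := exists_of_mem_Der h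
  rw [end_add_apply, h0.map_one, h1.map_one, add_zero]

theorem isD_deltaM {Δ : AddMonoid.End A} (h : Δ ∈ derA 𝒜 ι) :
    IsD ℳ (deltaM q b Δ) (diagInf (deltaM q b Δ) Δ
      fun _ => sbr_deltaM_mem b hqε hM hp hA hq hε h) := fun u =>
  ⟨(sbr_deltaM_idA b hqε hM hp hA hq h u.1).symm, rfl, rfl, rfl⟩

/-- The condition on the `A`-component is stated through `A · Id`, and it determines that component
because `A` acts faithfully on a module with a nonempty basis. -/
theorem isD_deltaM_iff {Δ : AddMonoid.End A} (h : Δ ∈ derA 𝒜 ι)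
    {d : AddMonoid.End (EInf A (ospFd ℳ q b))} : IsD ℳ (deltaM q b Δ) d ↔
      d = diagInf (deltaM q b Δ) Δ fun _ => sbr_deltaM_mem b hqε hM hp hA hq hε h := by
  refine ⟨fun hd => end_ext fun u => ?_, fun e => by
    rw [e]; exact isD_deltaM b hqε hM hp hA hq hε h⟩
  obtain ⟨h1, h2, h3, h4⟩ := hd u
  refine eInf_ext (idA_injective b ?_) h2 h3 h4
  rw [h1, sbr_deltaM_idA b hqε hM hp hA hq h]
  rfl

include hι

theorem mem_outer_iff {d : AddMonoid.End (EInf A (ospFd ℳ q b))} :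
    d ∈ outer b 𝒜 hE ↔ ∃ Δ ∈ derA 𝒜 ι, IsD ℳ (deltaM q b Δ) d := by
  constructor
  · rintro ⟨_, _, ⟨Δ, hΔ, rfl⟩, h⟩
    exact ⟨Δ, hΔ, h⟩
  · rintro ⟨Δ, hΔ, h⟩
    exact ⟨_, derAM_le_SS b hqε hM hp hA hq hε hι ⟨Δ, hΔ, rfl⟩, ⟨Δ, hΔ, rfl⟩, h⟩

theorem isDerivationDeg_diagInf_deltaM {ξ : ZMod 2} {Δ : AddMonoid.End A}
    (h : IsDerivationDeg 𝒜 AddMonoidHom.mul (linEnd A ι) ξ Δ) :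
    IsDerivationDeg (gradInf 𝒜 ℳ (ospFd ℳ q b)) (brInf hE) (rsmulLin hE) ξ
      (diagInf (deltaM q b Δ) Δ fun _ => sbr_deltaM_mem b hqε hM hp hA hq hε h.mem_Der) := by
  have hl := deltaM_mem_linEnd b hqε hM hp hA hq hι h
  refine isDerivationDeg_diagInf hE hM hq _ (isDifferential_deltaM b hqε hM hp hA hq h)
    (fun k x hx => ?_) hl h.1
  refine homogeneous_induction 𝒦 (P := fun k => sbr ℳ (deltaM q b Δ) (x * idA M (ι k)) =
    sbr ℳ (deltaM q b Δ) x * idA M (ι k)) (fun κ k hk => ?_) (fun k k' hk hk' => ?_) k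
  · exact sbr_mul_idA_of_commute hM (isDifferential_deltaM b hqε hM hp hA hq h).degree (hι κ k hk)
      (hl k) hx.1.1
  · rw [map_add, idA_add, mul_add, map_add, hk, hk', mul_add]

theorem exists_diagInf_of_mem_outer {d : AddMonoid.End (EInf A (ospFd ℳ q b))}
    (hd : d ∈ outer b 𝒜 hE) : ∃ Δ₀ Δ₁,
      ∃ h0 : IsDerivationDeg 𝒜 AddMonoidHom.mul (linEnd A ι) 0 Δ₀,
      ∃ h1 : IsDerivationDeg 𝒜 AddMonoidHom.mul (linEnd A ι) 1 Δ₁,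
      d = (diagInf (deltaM q b Δ₀) Δ₀ fun _ => sbr_deltaM_mem b hqε hM hp hA hq hε h0.mem_Der)
        + (diagInf (deltaM q b Δ₁) Δ₁ fun _ => sbr_deltaM_mem b hqε hM hp hA hq hε h1.mem_Der) := by
  obtain ⟨Δ, hΔ, hd⟩ := (mem_outer_iff b hqε hM hp hA hq hε hι hE).1 hd
  obtain ⟨d₀, d₁, h0, h1, rfl⟩ := exists_of_mem_Der hΔ
  refine ⟨d₀, d₁, h0, h1, ?_⟩
  rw [(isD_deltaM_iff b hqε hM hp hA hq hε hΔ).1 hd]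
  refine end_ext fun u => eInf_ext rfl ?_ ?_ ?_
  · change deltaM q b (d₀ + d₁) u.2.1 = deltaM q b d₀ u.2.1 + deltaM q b d₁ u.2.1
    rw [deltaM_add, end_add_apply]
  · change deltaM q b (d₀ + d₁) u.2.2.1 = deltaM q b d₀ u.2.2.1 + deltaM q b d₁ u.2.2.1
    rw [deltaM_add, end_add_apply]
  · change sbr ℳ (deltaM q b (d₀ + d₁)) u.2.2.2 =
      sbr ℳ (deltaM q b d₀) u.2.2.2 + sbr ℳ (deltaM q b d₁) u.2.2.2
    rw [deltaM_add, map_add, AddMonoidHom.add_apply]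

theorem diagInf_deltaM_mem_outer {Δ : AddMonoid.End A} (h : Δ ∈ derA 𝒜 ι) :
    (diagInf (deltaM q b Δ) Δ fun _ => sbr_deltaM_mem b hqε hM hp hA hq hε h) ∈ outer b 𝒜 hE :=
  (mem_outer_iff b hqε hM hp hA hq hε hι hE).2 ⟨Δ, h, isD_deltaM b hqε hM hp hA hq hε h⟩

theorem outer_le_derInf : outer b 𝒜 hE ≤ derInf 𝒜 hE := fun d hd => by
  obtain ⟨_, _, h0, h1, rfl⟩ := exists_diagInf_of_mem_outer b hqε hM hp hA hq hε hι hE hd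
  exact add_mem (isDerivationDeg_diagInf_deltaM b hqε hM hp hA hq hε hι hE h0).mem_Der
    (isDerivationDeg_diagInf_deltaM b hqε hM hp hA hq hε hι hE h1).mem_Der

theorem isGradedSub_outer : IsGradedSub (endDeg (gradInf 𝒜 ℳ (ospFd ℳ q b))) (outer b 𝒜 hE) :=
  fun d hd => by
    obtain ⟨_, _, h0, h1, rfl⟩ := exists_diagInf_of_mem_outer b hqε hM hp hA hq hε hι hE hd
    exact add_mem
      (AddSubgroup.mem_iSup_of_mem 0 ⟨diagInf_deltaM_mem_outer b hqε hM hp hA hq hε hι hE h0.mem_Der,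
        (isDerivationDeg_diagInf_deltaM b hqε hM hp hA hq hε hι hE h0).2.1⟩)
      (AddSubgroup.mem_iSup_of_mem 1 ⟨diagInf_deltaM_mem_outer b hqε hM hp hA hq hε hι hE h1.mem_Der,
        (isDerivationDeg_diagInf_deltaM b hqε hM hp hA hq hε hι hE h1).2.1⟩)

theorem exists_of_mem_outer_of_mem_endDeg {d : AddMonoid.End (EInf A (ospFd ℳ q b))} {ξ : ZMod 2}
    (hd : d ∈ outer b 𝒜 hE) (hξ : d ∈ endDeg (gradInf 𝒜 ℳ (ospFd ℳ q b)) ξ) : ∃ Δ,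
      ∃ h : IsDerivationDeg 𝒜 AddMonoidHom.mul (linEnd A ι) ξ Δ,
      d = diagInf (deltaM q b Δ) Δ fun _ => sbr_deltaM_mem b hqε hM hp hA hq hε h.mem_Der := by
  obtain ⟨Δ, hΔ, hd⟩ := (mem_outer_iff b hqε hM hp hA hq hε hι hE).1 hd
  have e := (isD_deltaM_iff b hqε hM hp hA hq hε hΔ).1 hd
  refine ⟨Δ, isDerivationDeg_of_mem_Der (fun f h0 h1 =>
    end_eq_zero_of_mem_mem 𝒜 (by decide) h0 h1) hΔ fun α a ha => ?_, e⟩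
  -- The map `d` restricts to `Δ` on `A`, so `Δ` inherits its degree and is then a homogeneous
  -- derivation.
  have := (hξ α (a, 0, 0, 0) ⟨ha, zero_mem _, zero_mem _, zero_mem _⟩).1
  rw [e] at this
  exact this

omit hqε hM hp hq hε [DirectSum.Decomposition ℳ] b in
theorem idA_mul_mem_derA (k : K) {Δ : AddMonoid.End A} (hΔ : Δ ∈ derA 𝒜 ι) :
    idA A (ι k) * Δ ∈ derA 𝒜 ι := by
  have key : ∀ ξ, ∀ Δ : AddMonoid.End A, IsDerivationDeg 𝒜 AddMonoidHom.mul (linEnd A ι) ξ Δ →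
      idA A (ι k) * Δ ∈ derA 𝒜 ι := by
    intro ξ Δ h
    refine homogeneous_induction 𝒦 (P := fun k => idA A (ι k) * Δ ∈ derA 𝒜 ι) (fun κ k hk => ?_)
      (fun k k' hk hk' => by rw [map_add, idA_add, add_mul]; exact add_mem hk hk') k
    refine IsDerivationDeg.mem_Der (α := κ + ξ) ⟨fun c a => ?_, fun α a ha => ?_, fun α a ha c => ?_⟩
    · change ι k * Δ (a * ι c) = ι k * Δ a * ι c
      rw [linEnd_base_apply h.1, mul_assoc]
    · rw [add_assoc]
      exact SetLike.GradedMul.mul_mem (hι κ k hk) (h.2.1 α a ha)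
    · change ι k * Δ (a * c) = ι k * Δ a * c + sgn (κ + ξ) α • (a * (ι k * Δ c))
      rw [show Δ (a * c) = Δ a * c + sgn ξ α • (a * Δ c) from h.2.2 α a ha c, mul_add,
        mul_smul_comm, ← mul_assoc, ← mul_assoc, ← mul_assoc, hA _ _ _ (hι κ k hk) a ha,
        smul_mul_assoc, smul_smul, sgn_add_left, mul_comm (sgn ξ α)]
  obtain ⟨d₀, d₁, h0, h1, rfl⟩ := exists_of_mem_Der hΔ
  rw [mul_add]
  exact add_mem (key _ _ h0) (key _ _ h1)

theorem lsmul_mul_mem_outer (k : K) {d : AddMonoid.End (EInf A (ospFd ℳ q b))}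
    (hd : d ∈ outer b 𝒜 hE) : lsmulInf hE k * d ∈ outer b 𝒜 hE := by
  obtain ⟨Δ, hΔ, hd⟩ := (mem_outer_iff b hqε hM hp hA hq hε hι hE).1 hd
  refine (mem_outer_iff b hqε hM hp hA hq hε hι hE).2
    ⟨_, idA_mul_mem_derA hA hι k hΔ, fun u => ?_⟩
  rw [deltaM_idA_mul b hqε hp 𝒜 (derA_apply_one hΔ)]
  obtain ⟨h1, h2, h3, h4⟩ := hd u
  refine ⟨?_, ?_, ?_, ?_⟩
  · rw [sbr_idA_mul hM _ (idA_mem_linEnd u.1), ← h1, ← idA_mul]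
    rfl
  · rw [end_mul_apply _ _ u.2.1, ← h2]; rfl
  · rw [end_mul_apply _ _ u.2.2.1, ← h3]; rfl
  · rw [sbr_idA_mul hM _ u.2.2.2.2.1.1, ← h4]; rfl

/-- A `K`-derivation kills the image of `K`, so the induced derivation passes a homogeneous scalar
up to sign. Stability under scalars on the right thus follows from stability on the left. -/
theorem diagInf_mul_lsmul {ξ κ : ZMod 2} {Δ : AddMonoid.End A}
    (h : IsDerivationDeg 𝒜 AddMonoidHom.mul (linEnd A ι) ξ Δ) {k : K} (hk : k ∈ 𝒦 κ) :
    (diagInf (deltaM q b Δ) Δ fun _ => sbr_deltaM_mem b hqε hM hp hA hq hε h.mem_Der) *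
      lsmulInf hE k = sgn ξ κ • (lsmulInf hE k *
      diagInf (deltaM q b Δ) Δ fun _ => sbr_deltaM_mem b hqε hM hp hA hq hε h.mem_Der) := by
  have hd := isDifferential_deltaM b hqε hM hp hA hq h
  have hS : ∀ m, deltaM q b Δ (ι k • m) = sgn ξ κ • (ι k • deltaM q b Δ m) := fun m => by
    rw [hd.map_smul κ _ (hι κ k hk), h.map_algebraMap, zero_smul, zero_add]
  refine end_ext fun u => eInf_ext ?_ (hS _) (hS _) ?_
  · change Δ (ι k * u.1) = sgn ξ κ • (ι k * Δ u.1)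
    rw [show Δ (ι k * u.1) = Δ (ι k) * u.1 + sgn ξ κ • (ι k * Δ u.1) from
      h.2.2 κ _ (hι κ k hk) u.1, h.map_algebraMap, zero_mul, zero_add]
  · change sbr ℳ (deltaM q b Δ) (idA M (ι k) * u.2.2.2) =
      sgn ξ κ • (idA M (ι k) * sbr ℳ (deltaM q b Δ) u.2.2.2)
    have e : deltaM q b Δ * idA M (ι k) = sgn ξ κ • (idA M (ι k) * deltaM q b Δ) := end_ext hS
    have hi := hM.idA_mem (hι κ k hk)
    refine linEnd_induction hM (P := fun x => sbr ℳ (deltaM q b Δ) (idA M (ι k) * x) =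
      sgn ξ κ • (idA M (ι k) * sbr ℳ (deltaM q b Δ) x)) (fun η x _ hη => ?_)
      (fun x y h h' => by rw [mul_add, map_add, h, h', map_add, mul_add, zsmul_add])
      u.2.2.2.2.1.1
    rw [sbr_of_mem ℳ hd.degree hη, sbr_of_mem ℳ hd.degree (mul_mem_endDeg ℳ hi hη), ← mul_assoc, e,
      sgn_add_right, mul_sub, mul_smul_comm, smul_mul_assoc, mul_assoc, mul_assoc, zsmul_sub,
      mul_smul]

theorem mul_lsmul_mem_outer (k : K) {d : AddMonoid.End (EInf A (ospFd ℳ q b))}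
    (hd : d ∈ outer b 𝒜 hE) : d * lsmulInf hE k ∈ outer b 𝒜 hE := by
  have key : ∀ ξ, ∀ Δ : AddMonoid.End A,
      ∀ h : IsDerivationDeg 𝒜 AddMonoidHom.mul (linEnd A ι) ξ Δ,
      (diagInf (deltaM q b Δ) Δ fun _ => sbr_deltaM_mem b hqε hM hp hA hq hε h.mem_Der) *
        lsmulInf hE k ∈ outer b 𝒜 hE := by
    intro ξ Δ h
    refine homogeneous_induction 𝒦 (P := fun k => (diagInf (deltaM q b Δ) Δ fun _ =>
      sbr_deltaM_mem b hqε hM hp hA hq hε h.mem_Der) * lsmulInf hE k ∈ outer b 𝒜 hE)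
      (fun κ k hk => ?_) (fun k k' hk hk' => ?_) k
    · rw [diagInf_mul_lsmul b hqε hM hp hA hq hε hι hE h hk]
      exact zsmul_mem (lsmul_mul_mem_outer b hqε hM hp hA hq hε hι hE k
        (diagInf_deltaM_mem_outer b hqε hM hp hA hq hε hι hE h.mem_Der)) _
    · have e : lsmulInf hE (k + k') = lsmulInf hE k + lsmulInf hE k' := by
        refine end_ext fun u => eInf_ext ?_ ?_ ?_ ?_
        · change ι (k + k') * _ = ι k * _ + ι k' * _
          rw [map_add, add_mul]
        · change ι (k + k') • _ = ι k • _ + ι k' • _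
          rw [map_add, add_smul]
        · change ι (k + k') • _ = ι k • _ + ι k' • _
          rw [map_add, add_smul]
        · change idA M (ι (k + k')) * _ = idA M (ι k) * _ + idA M (ι k') * _
          rw [map_add, idA_add, add_mul]
      rw [e, mul_add]
      exact add_mem hk hk'
  obtain ⟨_, _, h0, h1, rfl⟩ := exists_diagInf_of_mem_outer b hqε hM hp hA hq hε hι hE hd
  rw [add_mul]
  exact add_mem (key _ _ h0) (key _ _ h1)

theorem isSubsupermodule_outer :
    IsSubsupermodule (gradInf 𝒜 ℳ (ospFd ℳ q b)) (lsmulInf hE) (outer b 𝒜 hE) where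
  graded := isGradedSub_outer b hqε hM hp hA hq hε hι hE
  smul_mem k _ hd := lsmul_mul_mem_outer b hqε hM hp hA hq hε hι hE k hd
  mul_smul_mem k _ hd := mul_lsmul_mem_outer b hqε hM hp hA hq hε hι hE k hd

/-- Lifting `Δ ↦ Δ_M` respects brackets because both sides act coordinatewise; on `𝓔` the Jacobi
identity for endomorphisms gives the rest. -/
theorem bracket_mem_outer {α β : ZMod 2} {f g : AddMonoid.End (EInf A (ospFd ℳ q b))}
    (hf : f ∈ outer b 𝒜 hE ⊓ endDeg (gradInf 𝒜 ℳ (ospFd ℳ q b)) α)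
    (hg : g ∈ outer b 𝒜 hE ⊓ endDeg (gradInf 𝒜 ℳ (ospFd ℳ q b)) β) :
    f * g - sgn α β • (g * f) ∈ outer b 𝒜 hE := by
  obtain ⟨Δ, h, rfl⟩ := exists_of_mem_outer_of_mem_endDeg b hqε hM hp hA hq hε hι hE hf.1 hf.2
  obtain ⟨Δ', h', rfl⟩ := exists_of_mem_outer_of_mem_endDeg b hqε hM hp hA hq hε hι hE hg.1 hg.2
  have hb := h.bracket (fun f hf g hg => fun k a => by
    rw [end_mul_apply, end_mul_apply, hg k a, hf k]) h'
  have e := deltaM_bracket b hqε hp 𝒜 h.map_one h'.map_one (sgn α β)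
  convert diagInf_deltaM_mem_outer b hqε hM hp hA hq hε hι hE hb.mem_Der using 1
  refine end_ext fun u => eInf_ext rfl ?_ ?_ ?_
  · exact (congrArg (fun f : AddMonoid.End M => f u.2.1) e).symm
  · exact (congrArg (fun f : AddMonoid.End M => f u.2.2.1) e).symm
  · refine Eq.trans ?_ (congrArg (fun f : AddMonoid.End M => sbr ℳ f u.2.2.2) e).symm
    exact (sbr_sbr_apply (isDifferential_deltaM b hqε hM hp hA hq h).degree
      (isDifferential_deltaM b hqε hM hp hA hq h').degree _).symm

/-- If `ad (a, m, n, x)` equals the derivation induced by `Δ`, its action on the two copies of `M`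
gives `x + a = Δ_M = x - a`. Adding these on the basis, which `Δ_M` kills, gives `2x = 0`; then `Δ_M
= a = -a` vanishes, and so does `Δ`. -/
theorem disjoint_adInf_outer (h2 : IsUnit (2 : A)) : Disjoint (adInf hE) (outer b 𝒜 hE) := by
  rw [AddSubgroup.disjoint_def]
  intro d hd hd'
  obtain ⟨⟨a, m, n, x⟩, rfl⟩ := exists_eq_brInf hE hd
  obtain ⟨Δ, hΔ, hd'⟩ := (mem_outer_iff b hqε hM hp hA hq hε hι hE).1 hd'
  have e := (isD_deltaM_iff b hqε hM hp hA hq hε hΔ).1 hd'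
  have ev : ∀ v, brInf hE (a, m, n, x) v = diagInf (deltaM q b Δ) Δ
      (fun _ => sbr_deltaM_mem b hqε hM hp hA hq hε hΔ) v := fun v =>
    congrArg (fun f : AddMonoid.End (EInf A (ospFd ℳ q b)) => f v) e
  have hx : (x : AddMonoid.End M) ∈ linEnd M (RingHom.id A) := x.2.1.1
  have hS : ∀ i, deltaM q b Δ (b i) = 0 := fun i => by
    simpa [derA_apply_one hΔ] using deltaM_smul_basis b hqε (derA_apply_one hΔ) 1 i
  have e2 : ∀ m', a • m' + (x : AddMonoid.End M) m' = deltaM q b Δ m' := fun m' => by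
    have : (brInf hE (a, m, n, x) (0, m', 0, 0)).2.1 = deltaM q b Δ m' :=
      congrArg (fun u => u.2.1) (ev (0, m', 0, 0))
    rw [brInf_snd] at this
    simpa using this
  have e3 : ∀ m', -(a • m') + (x : AddMonoid.End M) m' = deltaM q b Δ m' := fun m' => by
    have : (brInf hE (a, m, n, x) (0, 0, m', 0)).2.2.1 = deltaM q b Δ m' :=
      congrArg (fun u => u.2.2.1) (ev (0, 0, m', 0))
    rw [brInf_thd] at this
    simpa using this
  have hx0 : (x : AddMonoid.End M) = 0 := by
    have hxb : ∀ i, (x : AddMonoid.End M) (b i) = 0 := fun i => by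
      have h3 := e2 (b i)
      have h4 := e3 (b i)
      rw [hS] at h3 h4
      have h5 : (2 : A) • (x : AddMonoid.End M) (b i) = 0 := by
        rw [two_smul, ← add_zero (0 : M)]
        nth_rewrite 1 [← h3]
        rw [← h4]
        abel
      exact h2.smul_eq_zero.1 h5
    refine end_ext (basis_induction b hp 𝒜 (fun α c _ i => ?_) fun v w hv hw => ?_)
    · obtain ⟨c', hc⟩ := exists_smul_eq_op b hM hp c i
      rw [hc, linEnd_id_apply hx, hxb, smul_zero]; rfl
    · rw [map_add, hv, hw, map_add]
  have hS0 : deltaM q b Δ = 0 := end_ext fun m' => by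
    have h3 := e2 m'
    have h4 := e3 m'
    rw [hx0, end_zero_apply, add_zero] at h3 h4
    have h5 : (2 : A) • deltaM q b Δ m' = 0 := by
      rw [two_smul]
      nth_rewrite 1 [← h3]
      rw [← h4]
      abel
    exact h2.smul_eq_zero.1 h5
  have hΔ0 : Δ = 0 := end_ext fun c => by
    have := deltaM_smul_basis b hqε (derA_apply_one hΔ) c 0
    rw [hS0, end_zero_apply] at this
    have h3 := congrArg (fun v => b.repr v 0) this
    simpa using h3.symm
  rw [e]
  refine end_ext fun u => eInf_ext ?_ ?_ ?_ ?_
  · change Δ u.1 = 0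
    rw [hΔ0, end_zero_apply]
  · change deltaM q b Δ u.2.1 = 0
    rw [hS0, end_zero_apply]
  · change deltaM q b Δ u.2.2.1 = 0
    rw [hS0, end_zero_apply]
  · change sbr ℳ (deltaM q b Δ) u.2.2.2 = 0
    rw [hS0, map_zero, AddMonoidHom.zero_apply]

end Modules

/-! ### Brackets of elements supported in one or two components -/

section Brackets

variable {K A M : Type*} [Ring K] [Ring A] [AddCommGroup M] [Module A M] [Module Aᵐᵒᵖ M]
  [SMulCommClass A Aᵐᵒᵖ M] {ℳ : ZMod 2 → AddSubgroup M} {q : M →+ M →+ A}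
  [DirectSum.Decomposition ℳ] {ι : K →+* A} {E : AddSubgroup (AddMonoid.End M)}
  (hE : IsOspSubalgebra ℳ q ι E)

theorem brInf_one (v : EInf A E) : brInf hE (1, 0, 0, 0) v = (0, v.2.1, -v.2.2.1, 0) := by
  refine eInf_ext ?_ ?_ ?_ ?_
  · simp [brInf_fst]
  · simp [brInf_snd]
  · simp [brInf_thd]
  · simp [brInf_fth]

theorem brInf_zero_one (m n : M) : brInf hE (0, m, n, 0) (1, 0, 0, 0) = (0, -m, n, 0) := by
  refine eInf_ext ?_ ?_ ?_ ?_
  · simp [brInf_fst]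
  · simp [brInf_snd]
  · simp [brInf_thd]
  · simp [brInf_fth]

theorem brInf_left (a : A) (x : E) (m : M) :
    brInf hE (a, 0, 0, x) (0, m, 0, 0) = (0, a • m + (x : AddMonoid.End M) m, 0, 0) := by
  refine eInf_ext ?_ ?_ ?_ ?_
  · simp [brInf_fst]
  · simp [brInf_snd]
  · simp [brInf_thd]
  · simp [brInf_fth]

theorem brInf_right (a : A) (x : E) (n : M) :
    brInf hE (a, 0, 0, x) (0, 0, n, 0) = (0, 0, -(a • n) + (x : AddMonoid.End M) n, 0) := by
  refine eInf_ext ?_ ?_ ?_ ?_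
  · simp [brInf_fst]
  · simp [brInf_snd]
  · simp [brInf_thd]
  · simp [brInf_fth]

theorem brInf_mid (a c : A) (x y : E) :
    brInf hE (a, 0, 0, x) (c, 0, 0, y) = (0, 0, 0, ⟨sbr ℳ x y, hE.bracket_mem _ x.2 _ y.2⟩) := by
  refine eInf_ext ?_ ?_ ?_ ?_
  · simp [brInf_fst]
  · simp [brInf_snd]
  · simp [brInf_thd]
  · simp [brInf_fth]

theorem brInf_left_right (m n : M) :
    brInf hE (0, m, 0, 0) (0, 0, n, 0) = (q m n, 0, 0, ⟨EE ℳ q m n, EE_mem hE m n⟩) := by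
  refine eInf_ext ?_ ?_ ?_ ?_
  · simp [brInf_fst]
  · simp [brInf_snd]
  · simp [brInf_thd]
  · simp [brInf_fth]

end Brackets

/-! ### Maps commuting with osp_fd up to scalars -/

section Diagonal

variable {K A M : Type*} [Ring K] [Ring A] [AddCommGroup M] [Module A M] [Module Aᵐᵒᵖ M]
  [SMulCommClass A Aᵐᵒᵖ M]
  {𝒜 : ZMod 2 → AddSubgroup A} {ℳ : ZMod 2 → AddSubgroup M} {q : M →+ M →+ A}
  {ι : K →+* A} {I : AddSubgroup ℚ} (b : Module.Basis I A M)
  {ε : I → ℤ} (hqε : ∀ i j, q (b i) (b j) = if i = -j then ((ε i : ℤ) : A) else 0)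
  [GradedRing 𝒜] (hM : IsSupermodule 𝒜 ℳ) {p : I → ZMod 2} (hp : ∀ i, b i ∈ ℳ (p i))
  [DirectSum.Decomposition ℳ] (hA : IsSupercommutative 𝒜) (hq : IsQuadraticForm 𝒜 ℳ q)
  (hε : ∀ i, ε i * ε i = 1)

include hM in
theorem proj_smul_of_mem {β : ZMod 2} {m : M} (hm : m ∈ ℳ β) (α : ZMod 2) (a : A) :
    proj ℳ (α + β) (a • m) = proj 𝒜 α a • m := by
  revert a
  refine homogeneous_induction 𝒜 (fun γ a ha => ?_) fun a c ha hc => ?_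
  · by_cases e : γ = α
    · subst e
      rw [proj_same 𝒜 ha, proj_same ℳ (hM.smul_mem _ _ a ha m hm)]
    · rw [proj_ne 𝒜 ha e, proj_ne ℳ (hM.smul_mem _ _ a ha m hm) (by simpa using e), zero_smul]
  · rw [add_smul, map_add, ha, hc, map_add, add_smul]

include hqε hM hp hA hq in
theorem EE_basis_apply_of_ne {i j : I} (h : i ≠ j) :
    EE ℳ q (b i) (b j) (b (-j)) = ε j • b i := by
  rw [EE_apply_of_mem _ (hp j) (hp _), hqε, hqε, if_pos (neg_neg j).symm, neg_neg, if_neg h,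
    zero_smul, smul_zero, sub_zero, ← zsmul_one, op_smul, op_one, smul_assoc, one_smul]

include hqε hp in
theorem EE_basis_apply_eq_zero {i j k : I} (hi : i ≠ -k) (hj : j ≠ -k) :
    EE ℳ q (b i) (b j) (b k) = 0 := by
  rw [EE_apply_of_mem _ (hp j) (hp _), hqε, hqε, if_neg hi, if_neg hj]
  simp

include hqε hM hp hA hq hε in
theorem eq_zero_of_idA_mem_osp (h2 : IsUnit (2 : A)) {c : A} (hc : idA M c ∈ osp ℳ q) :
    c = 0 := by
  -- Index `0` is its own opposite, so `q (b 0) (b 0)` is a sign. Testing skewness on this vector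
  -- gives twice `c` times a unit equal to zero.
  have h := hc.2 _ _ _ (hp 0) _ (hp (-0))
  rw [neg_zero] at h
  have hs := hq.supersymm _ _ _ (hp 0) _ (hp 0)
  have h00 : q (b 0) (b 0) = ((ε 0 : ℤ) : A) := by rw [hqε, if_pos neg_zero.symm]
  rw [idA_apply, hq.smul_left hA hM, ← mul_smul_comm, ← hs, ← two_mul, h00, h2.mul_right_eq_zero] at h
  have h3 : c * ((ε 0 : ℤ) : A) * ((ε 0 : ℤ) : A) = 0 := by rw [h, zero_mul]
  rwa [mul_assoc, ← Int.cast_mul, hε, Int.cast_one, mul_one] at h3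

variable (w : I → ℤ) (hw : ∀ i, (w i : ℚ) = 2 * i) (hw' : ∀ i j : I, ∃ k, k ≠ i ∧ k ≠ j)
  (hZ : ∀ k : ℤ, k ≠ 0 → IsUnit (k : A))
include hqε hM hp hA hq hε hw hw' hZ

/-- An `A`-linear map which commutes with `osp_fd(q)` up to scalars is a scalar. -/
theorem exists_eq_idA {ρ : ZMod 2} {R : AddMonoid.End M} (hR : R ∈ linEnd M (RingHom.id A))
    (hρ : R ∈ endDeg ℳ ρ) (h : ∀ η, ∀ x ∈ ospFd ℳ q b, x ∈ endDeg ℳ η →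
      ∃ c : A, sbr ℳ R x = idA M c) : ∃ r ∈ 𝒜 ρ, R = idA M r := by
  have hr : ∀ k, ∃ r ∈ 𝒜 ρ, R (b k) = r • b k := fun k => by
    -- The bracket with the weight operator is scalar, so its off-diagonal entries vanish. They are
    -- nonzero integer multiples of those of `R`, hence `R` is diagonal.
    obtain ⟨c, hc⟩ := h 0 _ (diagEnd_mem_ospFd b hM hp hqε hA hq w hw)
      (diagEnd_mem_endDeg b w hM hp)
    rw [sbr_of_even R (diagEnd_mem_endDeg b w hM hp)] at hc
    have e1 : R (b k) = b.repr (R (b k)) k • b k := b.ext_elem fun i => by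
      by_cases e : k = i
      · simp [e]
      · have h1 := congrArg (fun f : AddMonoid.End M => b.repr (f (b k)) i) hc
        simp only [end_sub_apply, end_mul_apply, diagEnd_basis, map_zsmul, map_sub,
          Finsupp.sub_apply, Finsupp.smul_apply, repr_diagEnd b w hp 𝒜, idA_apply, map_smul,
          b.repr_self, Finsupp.single_apply, if_neg e, smul_zero, ← sub_smul] at h1 ⊢
        rw [← Int.cast_smul_eq_zsmul A, smul_eq_mul] at h1
        exact (hZ _ fun h2 => e (weight_injective w hw (sub_eq_zero.1 h2))).mul_right_eq_zero.1 h1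
    -- Since `R (b k)` is homogeneous, its coefficient may be replaced by its component of degree
    -- `ρ`.
    refine ⟨proj 𝒜 ρ (b.repr (R (b k)) k), proj_mem 𝒜 _ _, ?_⟩
    rw [← proj_smul_of_mem hM (hp k), ← e1, proj_same ℳ (hρ _ _ (hp k))]
  choose r hr hRr using hr
  have key : ∀ i j, i ≠ j → r i = r (-j) := fun i j hij => by
    have hEd := EE_mem_endDeg hM hq (hp i) (hp j)
    have hEl := EE_mem_linEnd hM hq (b i) (b j)
    have hEE : EE ℳ q (b i) (b j) ∈ ospFd ℳ q b :=
      ⟨EE_mem_osp hA hM hq _ _, EE_mem_finDiag b hM hp hε hqε hA hq _ _⟩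
    obtain ⟨c, hc⟩ := h _ _ hEE hEd
    rw [sbr_of_mem ℳ hρ hEd] at hc
    have hc0 : c = 0 := by
      -- A basis vector killed by `E_{b i, b j}` and not moved by `R` off its line forces the scalar
      -- `c` to be `0`. Such a vector needs an index other than `-i` and `-j`.
      obtain ⟨k, hk, hk'⟩ := hw' (-i) (-j)
      have hz := EE_basis_apply_eq_zero (ℳ := ℳ) b hqε hp (i := i) (j := j) (k := k)
        (fun e => hk (by rw [e, neg_neg])) (fun e => hk' (by rw [e, neg_neg]))
      have h1 := congrArg (fun f : AddMonoid.End M => f (b k)) hc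
      simp only [end_sub_apply, end_zsmul_apply, end_mul_apply, hz, hRr, map_zero,
        hM.map_smul hEd (linEnd_id_apply hEl _) (hr k), smul_zero, sub_zero, idA_apply] at h1
      have h2 := congrArg (fun v => b.repr v k) h1
      simpa using h2.symm
    rw [hc0, show idA M (0 : A) = 0 from map_zero _] at hc
    -- Now `R` supercommutes with the map, which sends `b (-j)` to `± b i` because `i ≠ j`.
    -- Comparing the diagonal entries of `R` at source and target gives `r i = r (-j)`.
    have h1 := congrArg (fun f : AddMonoid.End M => f (b (-j))) hc
    simp only [end_sub_apply, end_zsmul_apply, end_mul_apply, hRr, map_zsmul,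
      hM.map_smul hEd (linEnd_id_apply hEl _) (hr (-j)),
      EE_basis_apply_of_ne b hqε hM hp hA hq hij, end_zero_apply] at h1
    rw [sgn_comm _ ρ, sgn_smul_smul, smul_comm (r (-j)) (ε j), ← smul_sub, ← sub_smul] at h1
    have h2 := congrArg (fun v => ε j • v) h1
    simp only [smul_smul, hε, one_smul, smul_zero] at h2
    have h3 := congrArg (fun v => b.repr v i) h2
    simpa [sub_eq_zero] using h3
  refine ⟨r 0, hr 0, end_ext (basis_induction b hp 𝒜 (fun α c _ i => ?_) fun v v' hv hv' => ?_)⟩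
  · have e : r i = r 0 := by
      by_cases hi : i = 0
      · rw [hi]
      · simpa using key i 0 hi
    obtain ⟨d, hd⟩ := exists_smul_eq_op b hM hp c i
    rw [hd, linEnd_id_apply hR, hRr, e, idA_apply, smul_comm (r 0)]
  · rw [map_add, hv, hv', map_add]

end Diagonal

/-! ### Components of a derivation with respect to the three-term grading -/

section Components

variable {K A M : Type*} [Ring K] [Ring A] [AddCommGroup M] [Module A M] [Module Aᵐᵒᵖ M]
  [SMulCommClass A Aᵐᵒᵖ M] {𝒜 : ZMod 2 → AddSubgroup A} {ℳ : ZMod 2 → AddSubgroup M}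
  {q : M →+ M →+ A} [DirectSum.Decomposition ℳ] {ι : K →+* A} {E : AddSubgroup (AddMonoid.End M)}
  {hE : IsOspSubalgebra ℳ q ι E}

/-- The map `f : A → A` with `d (a, 0, 0, 0) = (f a, *, *, *)`. -/
def compBase (d : AddMonoid.End (EInf A E)) : AddMonoid.End A :=
  AddMonoidHom.mk' (fun a => (d (a, 0, 0, 0)).1) fun a c => by
    rw [← Prod.fst_add, ← map_add]; simp

/-- The map `S : M → M` with `d (0, m, 0, 0) = (*, S m, *, *)`. -/
def compLeft (d : AddMonoid.End (EInf A E)) : AddMonoid.End M :=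
  AddMonoidHom.mk' (fun m => (d (0, m, 0, 0)).2.1) fun a c => by
    rw [← Prod.fst_add, ← Prod.snd_add, ← map_add]; simp

/-- The map `T : M → M` with `d (0, 0, n, 0) = (*, *, T n, *)`. -/
def compRight (d : AddMonoid.End (EInf A E)) : AddMonoid.End M :=
  AddMonoidHom.mk' (fun n => (d (0, 0, n, 0)).2.2.1) fun a c => by
    rw [← Prod.fst_add, ← Prod.snd_add, ← Prod.snd_add, ← map_add]; simp

theorem base_mem_gradInf {β : ZMod 2} {a : A} (ha : a ∈ 𝒜 β) :
    ((a, 0, 0, 0) : EInf A E) ∈ gradInf 𝒜 ℳ E β := ⟨ha, zero_mem _, zero_mem _, zero_mem _⟩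

theorem left_mem_gradInf {β : ZMod 2} {m : M} (hm : m ∈ ℳ β) :
    ((0, m, 0, 0) : EInf A E) ∈ gradInf 𝒜 ℳ E β := ⟨zero_mem _, hm, zero_mem _, zero_mem _⟩

theorem right_mem_gradInf {β : ZMod 2} {n : M} (hn : n ∈ ℳ β) :
    ((0, 0, n, 0) : EInf A E) ∈ gradInf 𝒜 ℳ E β := ⟨zero_mem _, zero_mem _, hn, zero_mem _⟩

theorem eInf_eq_add (u : EInf A E) :
    u = (u.1, 0, 0, 0) + (0, u.2.1, 0, 0) + (0, 0, u.2.2.1, 0) + (0, 0, 0, u.2.2.2) := by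
  refine eInf_ext ?_ ?_ ?_ ?_ <;> simp

variable [GradedRing 𝒜] {α : ZMod 2} {d : AddMonoid.End (EInf A E)}
  (hd : IsDerivationDeg (gradInf 𝒜 ℳ E) (brInf hE) (rsmulLin hE) α d)
include hd

theorem IsDerivationDeg.apply_brInf_one (v : EInf A E) :
    d (0, v.2.1, -v.2.2.1, 0) =
      brInf hE (d (1, 0, 0, 0)) v + (0, (d v).2.1, -(d v).2.2.1, 0) := by
  have h := hd.2.2 0 _ (base_mem_gradInf (SetLike.GradedOne.one_mem)) v
  rwa [brInf_one, brInf_one, sgn_zero_right, one_smul] at h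

/-- In `d [e, v]` the term `[e, d v]` reproduces the component of `d v` along the copy of `M`
containing `v`, so it cancels. What remains is `a v + x v = 0` on one copy and `-a v + x v = 0` on
the other; hence `2x = 0` and, by faithfulness, `a = 0`. -/
theorem IsDerivationDeg.apply_one_eq_zero (h2 : IsUnit (2 : A))
    (hf : Function.Injective (idA (A := A) M))
    (hm : (d (1, 0, 0, 0)).2.1 = 0) (hn : (d (1, 0, 0, 0)).2.2.1 = 0) :
    d (1, 0, 0, 0) = 0 := by
  obtain ⟨a, x, hax⟩ : ∃ a x, d (1, 0, 0, 0) = (a, 0, 0, x) :=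
    ⟨_, _, eInf_ext rfl hm hn rfl⟩
  have h1 : ∀ m, a • m + (x : AddMonoid.End M) m = 0 := fun m => by
    have h := hd.apply_brInf_one (0, m, 0, 0)
    rw [hax, brInf_left] at h
    have h' := congrArg (fun u : EInf A E => u.2.1) h
    simpa using h'
  have h1' : ∀ m, -(a • m) + (x : AddMonoid.End M) m = 0 := fun m => by
    have h := hd.apply_brInf_one (0, 0, m, 0)
    rw [hax, brInf_right, show ((0, 0, -m, 0) : EInf A E) = -(0, 0, m, 0) by simp, map_neg] at h
    have h' := congrArg (fun u : EInf A E => u.2.2.1) h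
    simpa using h'
  have hx : ∀ m, (x : AddMonoid.End M) m = 0 := fun m => by
    refine h2.smul_eq_zero.1 ?_
    have := congrArg₂ (· + ·) (h1 m) (h1' m)
    simp only [add_zero] at this
    rw [two_smul, ← this]
    abel
  have ha : a = 0 := hf (end_ext fun m => by
    have := h1 m
    rw [hx, add_zero] at this
    rw [idA_apply, idA_apply, this, zero_smul])
  rw [hax]
  exact eInf_ext ha rfl rfl (end_ext hx)

variable (h2 : IsUnit (2 : A)) (h0 : d (1, 0, 0, 0) = 0)
include h0

theorem IsDerivationDeg.apply_mid (a : A) (x : E) :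
    d (a, 0, 0, x) = ((d (a, 0, 0, x)).1, 0, 0, (d (a, 0, 0, x)).2.2.2) := by
  have h := hd.apply_brInf_one (a, 0, 0, x)
  rw [h0, map_zero, AddMonoidHom.zero_apply, zero_add,
    show ((0, 0, -0, 0) : EInf A E) = 0 by simp, map_zero] at h
  refine eInf_ext rfl ?_ ?_ rfl
  · exact (congrArg (fun u : EInf A E => u.2.1) h).symm
  · exact neg_eq_zero.1 (congrArg (fun u : EInf A E => u.2.2.1) h).symm

include h2

/-- Since `d e = 0`, the image of a vector of weight `1` under `ad e` has weight `1`. Components of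
weight `0` vanish at once, and that of weight `-1` because `2` is invertible. -/
theorem IsDerivationDeg.apply_left (m : M) : d (0, m, 0, 0) = (0, compLeft d m, 0, 0) := by
  have h := hd.apply_brInf_one (0, m, 0, 0)
  rw [h0, map_zero, AddMonoidHom.zero_apply, zero_add, neg_zero] at h
  refine eInf_ext (congrArg (fun u : EInf A E => u.1) h :) rfl ?_
    (congrArg (fun u : EInf A E => (u.2.2.2 : AddMonoid.End M)) h :)
  refine h2.smul_eq_zero.1 ?_
  have h3 : (d (0, m, 0, 0)).2.2.1 = -(d (0, m, 0, 0)).2.2.1 :=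
    congrArg (fun u : EInf A E => u.2.2.1) h
  rw [two_smul]
  nth_rewrite 1 [h3]
  abel

theorem IsDerivationDeg.apply_right (n : M) : d (0, 0, n, 0) = (0, 0, compRight d n, 0) := by
  have h := hd.apply_brInf_one (0, 0, n, 0)
  rw [h0, map_zero, AddMonoidHom.zero_apply, zero_add,
    show ((0, 0, -n, 0) : EInf A E) = -(0, 0, n, 0) by simp, map_neg] at h
  refine eInf_ext (neg_eq_zero.1 (congrArg (fun u : EInf A E => u.1) h)) ?_ rfl
    (neg_eq_zero.1 (congrArg (fun u : EInf A E => (u.2.2.2 : AddMonoid.End M)) h))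
  refine h2.smul_eq_zero.1 ?_
  have h3 : -(d (0, 0, n, 0)).2.1 = (d (0, 0, n, 0)).2.1 :=
    congrArg (fun u : EInf A E => u.2.1) h
  rw [two_smul]
  nth_rewrite 1 [← h3]
  abel

theorem IsDerivationDeg.compLeft_mem : compLeft d ∈ endDeg ℳ α := fun β _ hm =>
  (hd.2.1 β _ (left_mem_gradInf hm)).2.1

theorem IsDerivationDeg.compRight_mem : compRight d ∈ endDeg ℳ α := fun β _ hm =>
  (hd.2.1 β _ (right_mem_gradInf hm)).2.2.1

theorem IsDerivationDeg.compLeft_apply {β : ZMod 2} {a : A} (ha : a ∈ 𝒜 β) {x : E}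
    (hx : (x : AddMonoid.End M) ∈ endDeg ℳ β) (m : M) :
    compLeft d (a • m + (x : AddMonoid.End M) m) =
      (d (a, 0, 0, x)).1 • m + ((d (a, 0, 0, x)).2.2.2 : AddMonoid.End M) m +
        sgn α β • (a • compLeft d m + (x : AddMonoid.End M) (compLeft d m)) := by
  have h := hd.2.2 β (a, 0, 0, x) ⟨ha, zero_mem _, zero_mem _, hx⟩ (0, m, 0, 0)
  rw [brInf_left, hd.apply_mid h0, hd.apply_left h2 h0, hd.apply_left h2 h0, brInf_left,
    brInf_left] at h
  simpa using congrArg (fun u : EInf A E => u.2.1) h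

theorem IsDerivationDeg.compRight_apply {β : ZMod 2} {a : A} (ha : a ∈ 𝒜 β) {x : E}
    (hx : (x : AddMonoid.End M) ∈ endDeg ℳ β) (n : M) :
    compRight d (-(a • n) + (x : AddMonoid.End M) n) =
      -((d (a, 0, 0, x)).1 • n) + ((d (a, 0, 0, x)).2.2.2 : AddMonoid.End M) n +
        sgn α β • (-(a • compRight d n) + (x : AddMonoid.End M) (compRight d n)) := by
  have h := hd.2.2 β (a, 0, 0, x) ⟨ha, zero_mem _, zero_mem _, hx⟩ (0, 0, n, 0)
  rw [brInf_right, hd.apply_mid h0, hd.apply_right h2 h0, hd.apply_right h2 h0, brInf_right,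
    brInf_right] at h
  simpa using congrArg (fun u : EInf A E => u.2.2.1) h

theorem IsDerivationDeg.apply_form {β : ZMod 2} {m : M} (hm : m ∈ ℳ β) (n : M) :
    (d (q m n, 0, 0, ⟨EE ℳ q m n, EE_mem hE m n⟩)).1 =
      q (compLeft d m) n + sgn α β • q m (compRight d n) := by
  have h := hd.2.2 β (0, m, 0, 0) (left_mem_gradInf hm) (0, 0, n, 0)
  rw [brInf_left_right, hd.apply_left h2 h0, hd.apply_right h2 h0, brInf_left_right,
    brInf_left_right] at h
  simpa using congrArg (fun u : EInf A E => u.1) h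

omit h2 in
theorem IsDerivationDeg.sbr_apply_base {β : ZMod 2} {a : A} (ha : a ∈ 𝒜 β) (x : E) :
    sbr ℳ (d (a, 0, 0, 0)).2.2.2 x = 0 := by
  have h := hd.2.2 β (a, 0, 0, 0) (base_mem_gradInf ha) (0, 0, 0, x)
  have e : brInf hE (a, 0, 0, 0) (0, 0, 0, x) = 0 := by
    rw [brInf_mid]
    exact eInf_ext rfl rfl rfl (by simp)
  have e' : brInf hE (a, 0, 0, 0) (d (0, 0, 0, x)) = 0 := by
    rw [hd.apply_mid h0, brInf_mid]
    exact eInf_ext rfl rfl rfl (by simp)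
  rw [e, e', map_zero, smul_zero, add_zero, hd.apply_mid h0, brInf_mid] at h
  exact congrArg (fun u : EInf A E => (u.2.2.2 : AddMonoid.End M)) h.symm

end Components

section Linear

variable {A M : Type*} [Ring A] [AddCommGroup M] [Module A M] [Module Aᵐᵒᵖ M]
  [SMulCommClass A Aᵐᵒᵖ M] {𝒜 : ZMod 2 → AddSubgroup A} {ℳ : ZMod 2 → AddSubgroup M}
  [GradedRing 𝒜] [DirectSum.Decomposition ℳ]

theorem IsSupermodule.mem_linEnd (hM : IsSupermodule 𝒜 ℳ) {ρ : ZMod 2} {R : AddMonoid.End M}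
    (hρ : R ∈ endDeg ℳ ρ)
    (h : ∀ β, ∀ a ∈ 𝒜 β, ∀ m, R (a • m) = sgn ρ β • (a • R m)) :
    R ∈ linEnd M (RingHom.id A) := by
  intro a
  refine homogeneous_induction ℳ (fun γ m hm => ?_) fun m n hm hn => by
    rw [smul_add, map_add, hm, hn, map_add, smul_add]
  change R (op a • m) = op a • R m
  revert a
  refine homogeneous_induction 𝒜 (fun β a ha => ?_) fun a c ha hc => by
    rw [op_add, add_smul, map_add, ha, hc, add_smul]
  rw [hM.op_smul ha hm, map_zsmul, h β a ha, hM.op_smul ha (hρ γ m hm), sgn_add_right, smul_smul,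
    mul_comm, sgn_comm ρ β]

end Linear

section Inner

variable {K A M : Type*} [Ring K] [Ring A] [AddCommGroup M] [Module A M] [Module Aᵐᵒᵖ M]
  [SMulCommClass A Aᵐᵒᵖ M] {𝒜 : ZMod 2 → AddSubgroup A} {ℳ : ZMod 2 → AddSubgroup M}
  {q : M →+ M →+ A} [DirectSum.Decomposition ℳ] {ι : K →+* A} {E : AddSubgroup (AddMonoid.End M)}
  (hE : IsOspSubalgebra ℳ q ι E)

theorem diagInf_apply (S : AddMonoid.End M) (f : AddMonoid.End A) (h : ∀ x ∈ E, sbr ℳ S x ∈ E)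
    (u : EInf A E) :
    diagInf S f h u = (f u.1, S u.2.1, S u.2.2.1, ⟨sbr ℳ S u.2.2.2, h _ u.2.2.2.2⟩) := rfl

/-- The inner derivation `ad u`, as an endomorphism. -/
def adEnd (u : EInf A E) : AddMonoid.End (EInf A E) := brInf hE u

theorem adEnd_apply (u v : EInf A E) : adEnd hE u v = brInf hE u v := rfl

theorem adEnd_mem_adInf (u : EInf A E) : adEnd hE u ∈ adInf hE := brInf_mem_adInf hE u

theorem IsDerivationDeg.sub_adEnd [GradedRing 𝒜] (hA : IsSupercommutative 𝒜)
    (hM : IsSupermodule 𝒜 ℳ) (hq : IsQuadraticForm 𝒜 ℳ q) {α : ZMod 2}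
    {d : AddMonoid.End (EInf A E)} {u : EInf A E} (hu : u ∈ gradInf 𝒜 ℳ E α)
    (hd : IsDerivationDeg (gradInf 𝒜 ℳ E) (brInf hE) (rsmulLin hE) α d) :
    IsDerivationDeg (gradInf 𝒜 ℳ E) (brInf hE) (rsmulLin hE) α (d - adEnd hE u) := by
  rw [sub_eq_add_neg]
  exact hd.add (IsDerivationDeg.neg (isDerivationDeg_brInf hE hA hM hq hu))

end Inner

/-! ### Reducing a derivation to an inner one plus a lift -/

section Derivations

variable {K A M : Type*} [Ring K] [Ring A] [AddCommGroup M] [Module A M] [Module Aᵐᵒᵖ M]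
  [SMulCommClass A Aᵐᵒᵖ M]
  {𝒜 : ZMod 2 → AddSubgroup A} {ℳ : ZMod 2 → AddSubgroup M} {q : M →+ M →+ A}
  {ι : K →+* A} {I : AddSubgroup ℚ} (b : Module.Basis I A M)
  {ε : I → ℤ} (hqε : ∀ i j, q (b i) (b j) = if i = -j then ((ε i : ℤ) : A) else 0)
  [GradedRing 𝒜] (hM : IsSupermodule 𝒜 ℳ) {p : I → ZMod 2} (hp : ∀ i, b i ∈ ℳ (p i))
  [DirectSum.Decomposition ℳ] (hA : IsSupercommutative 𝒜) (hq : IsQuadraticForm 𝒜 ℳ q)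
  (hε : ∀ i, ε i * ε i = 1)
  {𝒦 : ZMod 2 → AddSubgroup K} [GradedRing 𝒦] (hι : ∀ α, ∀ k ∈ 𝒦 α, ι k ∈ 𝒜 α)
  {hE : IsOspSubalgebra ℳ q ι (ospFd ℳ q b)}
  (w : I → ℤ) (hw : ∀ i, (w i : ℚ) = 2 * i) (hw' : ∀ i j : I, ∃ k, k ≠ i ∧ k ≠ j)
  (hZ : ∀ k : ℤ, k ≠ 0 → IsUnit (k : A)) (h2 : IsUnit (2 : A))
  {α : ZMod 2} {d : AddMonoid.End (EInf A (ospFd ℳ q b))}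
  (hd : IsDerivationDeg (gradInf 𝒜 ℳ (ospFd ℳ q b)) (brInf hE) (rsmulLin hE) α d)
  (h0 : d (1, 0, 0, 0) = 0)

include hqε hM hp hA hq hε w hw hw' hZ h2 hd h0

theorem apply_base_fth (a : A) : ((d (a, 0, 0, 0)).2.2.2 : AddMonoid.End M) = 0 := by
  revert a
  refine homogeneous_induction 𝒜 (fun β a ha => ?_) fun a c ha hc => ?_
  · have hφ := (d (a, 0, 0, 0)).2.2.2.2
    -- The `𝓔`-component of `d` on `A` centralises `𝓔`, because `A` and `𝓔` commute in the extended
    -- algebra. It is therefore a scalar, and a scalar lying in `osp(q)` is zero.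
    obtain ⟨r, -, hr⟩ := exists_eq_idA b hqε hM hp hA hq hε w hw hw' hZ hφ.1.1
      (hd.2.1 β _ (base_mem_gradInf ha)).2.2.2 fun η x hx _ =>
        ⟨0, (hd.sbr_apply_base h0 ha ⟨x, hx⟩).trans (map_zero _).symm⟩
    rw [hr] at hφ ⊢
    rw [eq_zero_of_idA_mem_osp b hqε hM hp hA hq hε h2 hφ.1]
    exact map_zero _
  · have e : ((a + c, 0, 0, 0) : EInf A (ospFd ℳ q b)) = (a, 0, 0, 0) + (c, 0, 0, 0) := by simp
    rw [e, map_add]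
    change ((d (a, 0, 0, 0)).2.2.2 : AddMonoid.End M) + (d (c, 0, 0, 0)).2.2.2 = 0
    rw [ha, hc, add_zero]

theorem apply_base (a : A) : d (a, 0, 0, 0) = (compBase d a, 0, 0, 0) := by
  rw [hd.apply_mid h0]
  exact eInf_ext rfl rfl rfl (apply_base_fth b hqε hM hp hA hq hε w hw hw' hZ h2 hd h0 a)

theorem compLeft_smul {β : ZMod 2} {a : A} (ha : a ∈ 𝒜 β) (m : M) :
    compLeft d (a • m) = compBase d a • m + sgn α β • (a • compLeft d m) := by
  have h := hd.compLeft_apply h2 h0 ha (x := 0) (zero_mem _) m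
  rw [apply_base b hqε hM hp hA hq hε w hw hw' hZ h2 hd h0] at h
  simpa using h

theorem compRight_smul {β : ZMod 2} {a : A} (ha : a ∈ 𝒜 β) (m : M) :
    compRight d (a • m) = compBase d a • m + sgn α β • (a • compRight d m) := by
  have h := hd.compRight_apply h2 h0 ha (x := 0) (zero_mem _) m
  rw [apply_base b hqε hM hp hA hq hε w hw hw' hZ h2 hd h0] at h
  simp only [AddSubgroup.coe_zero, end_zero_apply, add_zero, map_neg, smul_neg] at h
  rw [← neg_inj, h, neg_add]

/-- The two maps on `M` differ by a scalar. -/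
theorem exists_compLeft_sub_compRight :
    ∃ r ∈ 𝒜 α, compLeft d - compRight d = idA M r := by
  have hS := hd.compLeft_mem h2 h0
  have hT := hd.compRight_mem h2 h0
  have hR := sub_mem hS hT
  refine exists_eq_idA b hqε hM hp hA hq hε w hw hw' hZ (hM.mem_linEnd hR fun β a ha m => ?_) hR
    -- The `A`-component of `d x` acts with opposite signs on the two copies of `M`. Subtracting the
    -- two Leibniz rules doubles it and cancels the `𝓔`-component.
    fun η x hx hη => ⟨2 * (d (0, 0, 0, ⟨x, hx⟩)).1, ?_⟩
  · rw [end_sub_apply, end_sub_apply, compLeft_smul b hqε hM hp hA hq hε w hw hw' hZ h2 hd h0 ha,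
      compRight_smul b hqε hM hp hA hq hε w hw hw' hZ h2 hd h0 ha, smul_sub, smul_sub]
    abel
  · rw [sbr_of_mem ℳ hR hη]
    refine end_ext fun m => ?_
    have h1 := hd.compLeft_apply h2 h0 (zero_mem (𝒜 η)) (x := ⟨x, hx⟩) hη m
    have h3 := hd.compRight_apply h2 h0 (zero_mem (𝒜 η)) (x := ⟨x, hx⟩) hη m
    simp only [zero_smul, zero_add, neg_zero] at h1 h3
    simp only [end_sub_apply, end_mul_apply, end_zsmul_apply, map_sub, h1, h3, idA_apply, two_mul,
      add_smul, smul_sub]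
    abel

variable (hST : compLeft d = compRight d)
include hST

theorem sbr_compLeft (x : ospFd ℳ q b) :
    d (0, 0, 0, x) = (0, 0, 0, (d (0, 0, 0, x)).2.2.2) ∧
      sbr ℳ (compLeft d) x = (d (0, 0, 0, x)).2.2.2 := by
  have hS := hd.compLeft_mem h2 h0
  obtain ⟨x, hx⟩ := x
  refine (IsGradedSub.induction (isGradedSub_ospFd b hM hp hε hqε hA hq)
    (P := fun x => ∃ hx : x ∈ ospFd ℳ q b,
      d (0, 0, 0, ⟨x, hx⟩) = (0, 0, 0, (d (0, 0, 0, ⟨x, hx⟩)).2.2.2) ∧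
      sbr ℳ (compLeft d) x = (d (0, 0, 0, ⟨x, hx⟩)).2.2.2)
    (fun η x hx hη => ⟨hx, ?_⟩) ?_ hx).2
  · have h1 := fun m => hd.compLeft_apply h2 h0 (zero_mem (𝒜 η)) (x := ⟨x, hx⟩) hη m
    have h3 := fun m => hd.compRight_apply h2 h0 (zero_mem (𝒜 η)) (x := ⟨x, hx⟩) hη m
    simp only [zero_smul, zero_add, neg_zero] at h1 h3
    have hg : (d (0, 0, 0, ⟨x, hx⟩)).1 = 0 := by
      refine idA_injective b (end_ext fun m => ?_)
      rw [idA_apply, idA_apply, zero_smul]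
      refine h2.smul_eq_zero.1 ?_
      -- With equal maps on both copies, the two Leibniz rules for `x m` differ only in the sign of
      -- the `A`-component, so twice that component acts as zero.
      have h4 := (h1 m).symm.trans ((congrArg (fun f : AddMonoid.End M => f (x m)) hST).trans (h3 m))
      rw [hST] at h4
      have h5 := add_right_cancel (add_right_cancel h4)
      rw [two_smul]
      nth_rewrite 1 [h5]
      abel
    refine ⟨?_, end_ext fun m => ?_⟩
    · rw [hd.apply_mid h0]
      exact eInf_ext hg rfl rfl rfl
    · rw [sbr_of_mem ℳ hS hη, end_sub_apply, end_zsmul_apply, end_mul_apply, end_mul_apply, h1, hg,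
        zero_smul, zero_add, add_sub_cancel_right]
  · rintro x y ⟨hx, h1, h3⟩ ⟨hy, h1', h3'⟩
    have e : ((0, 0, 0, ⟨x + y, add_mem hx hy⟩) : EInf A (ospFd ℳ q b)) =
      (0, 0, 0, ⟨x, hx⟩) + (0, 0, 0, ⟨y, hy⟩) := by simp
    refine ⟨add_mem hx hy, ?_, ?_⟩
    · rw [e, map_add, h1, h1']
      simp
    · rw [e, map_add, map_add, h3, h3']
      rfl

theorem isDifferential_compLeft : IsDifferential 𝒜 ℳ q α (compLeft d) (compBase d) where
  degree := hd.compLeft_mem h2 h0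
  degree_base β a ha := (hd.2.1 β _ (base_mem_gradInf ha)).1
  map_smul β a ha m := compLeft_smul b hqε hM hp hA hq hε w hw hw' hZ h2 hd h0 ha m
  map_form β m hm n := by
    have h := hd.apply_form h2 h0 hm n
    rw [← hST] at h
    rw [← h]
    -- The bracket of the two copies of `M` has both a form value and an `𝓔`-component. The latter
    -- contributes nothing to `A` under `d`, so the rule for `f` on values of `q` remains.
    have e : ((q m n, 0, 0, ⟨EE ℳ q m n, EE_mem hE m n⟩) : EInf A (ospFd ℳ q b)) =
      (q m n, 0, 0, 0) + (0, 0, 0, ⟨EE ℳ q m n, EE_mem hE m n⟩) := by simp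
    rw [e, map_add, (sbr_compLeft b hqε hM hp hA hq hε w hw hw' hZ h2 hd h0 hST _).1,
      Prod.fst_add, add_zero]
    rfl

theorem isDerivationDeg_compBase :
    IsDerivationDeg 𝒜 AddMonoidHom.mul (linEnd A ι) α (compBase d) := by
  have hS := isDifferential_compLeft b hqε hM hp hA hq hε w hw hw' hZ h2 hd h0 hST
  refine ⟨fun k a => ?_, hS.degree_base, fun β a ha => homogeneous_induction 𝒜
    (fun γ c hc => ?_) fun c c' hc hc' => ?_⟩
  · have h := congrArg (fun u => u.1) (hd.1 k (a, 0, 0, 0))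
    have e : rsmulInf hE k (a, 0, 0, 0) = (a * ι k, 0, 0, 0) :=
      eInf_ext rfl (smul_zero _) (smul_zero _) (zero_mul _)
    rw [e] at h
    exact h
  · have h1 := hS.map_smul _ _ (SetLike.GradedMul.mul_mem ha hc) (b 0)
    rw [mul_smul, hS.map_smul _ _ ha, hS.map_smul _ _ hc, sgn_add_right] at h1
    rw [smul_add, smul_add, smul_comm a (sgn α γ), ← mul_smul a c (compLeft d (b 0)),
      smul_smul (sgn α β), ← add_assoc] at h1
    have h3 := congrArg (fun v => b.repr v 0) (add_right_cancel h1)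
    simpa using h3.symm
  · simp only [map_add, smul_add] at hc hc' ⊢
    rw [hc, hc']
    abel

theorem eq_diagInf : ∃ h : ∀ x ∈ ospFd ℳ q b, sbr ℳ (compLeft d) x ∈ ospFd ℳ q b,
    d = diagInf (compLeft d) (compBase d) h := by
  refine ⟨fun x hx => ?_, end_ext fun u => ?_⟩
  · rw [(sbr_compLeft b hqε hM hp hA hq hε w hw hw' hZ h2 hd h0 hST ⟨x, hx⟩).2]
    exact (d (0, 0, 0, ⟨x, hx⟩)).2.2.2.2
  · have hx := sbr_compLeft b hqε hM hp hA hq hε w hw hw' hZ h2 hd h0 hST u.2.2.2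
    conv_lhs => rw [eInf_eq_add u]
    rw [map_add, map_add, map_add, apply_base b hqε hM hp hA hq hε w hw hw' hZ h2 hd h0,
      hd.apply_left h2 h0, hd.apply_right h2 h0, hx.1, ← hST]
    refine eInf_ext ?_ ?_ ?_ ?_
    · simp [diagInf_apply]
    · simp [diagInf_apply]
    · simp [diagInf_apply]
    · simp [diagInf_apply, hx.2]

include hι in
-- Both maps obey the same Leibniz rules through the same derivation of `A`, so their difference is
-- `A`-linear and skew. Each of them normalises `𝓔`, and `osp_fd(q)` is its own normaliser in
-- `osp(q)`.
theorem compLeft_sub_deltaM_mem : compLeft d - deltaM q b (compBase d) ∈ ospFd ℳ q b := by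
  have hS := isDifferential_compLeft b hqε hM hp hA hq hε w hw hw' hZ h2 hd h0 hST
  have hf := isDerivationDeg_compBase b hqε hM hp hA hq hε w hw hw' hZ h2 hd h0 hST
  have hD := isDifferential_deltaM b hqε hM hp hA hq hf
  obtain ⟨hn, -⟩ := eq_diagInf b hqε hM hp hA hq hε w hw hw' hZ h2 hd h0 hST
  have hdeg := sub_mem hS.degree hD.degree
  have h : compLeft d - deltaM q b (compBase d) ∈ normalizer ℳ q (ospFd ℳ q b) := by
    refine ⟨mem_osp_of_adjoint hq (hM.mem_linEnd hdeg fun β a ha m => ?_) hdeg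
      fun β m hm γ n _ => ?_, fun y hy => ?_⟩
    · rw [end_sub_apply, end_sub_apply, hS.map_smul β a ha, hD.map_smul β a ha, smul_sub, smul_sub]
      abel
    · have h := (hS.map_form β m hm n).symm.trans (hD.map_form β m hm n)
      rw [end_sub_apply, end_sub_apply, map_sub, map_sub, AddMonoidHom.sub_apply, smul_sub,
        eq_neg_iff_add_eq_zero, ← sub_eq_zero.2 h]
      abel
    · rw [map_sub, AddMonoidHom.sub_apply]
      exact sub_mem (hn y hy) (sbr_deltaM_mem b hqε hM hp hA hq hε hf.mem_Der hy)
  rwa [normalizer_ospFd b hM hp hε hqε hA hq w hw hZ] at h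

include hι in
theorem mem_sup_of_compLeft_eq : d ∈ adInf hE ⊔ outer b 𝒜 hE := by
  have hx := compLeft_sub_deltaM_mem b hqε hM hp hA hq hε hι w hw hw' hZ h2 hd h0 hST
  have hf := isDerivationDeg_compBase b hqε hM hp hA hq hε w hw hw' hZ h2 hd h0 hST
  obtain ⟨hn, e⟩ := eq_diagInf b hqε hM hp hA hq hε w hw hw' hZ h2 hd h0 hST
  have e' : d = adEnd hE (0, 0, 0, ⟨_, hx⟩) + diagInf (deltaM q b (compBase d)) (compBase d)
      fun _ => sbr_deltaM_mem b hqε hM hp hA hq hε hf.mem_Der := by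
    refine end_ext fun u => ?_
    conv_lhs => rw [e]
    rw [end_add_apply]
    refine eInf_ext ?_ ?_ ?_ ?_
    · simp [diagInf_apply, adEnd_apply, brInf_fst]
    · simp [diagInf_apply, adEnd_apply, brInf_snd, end_sub_apply]
    · simp [diagInf_apply, adEnd_apply, brInf_thd, end_sub_apply]
    · simp [diagInf_apply, adEnd_apply, brInf_fth]
  rw [e']
  exact add_mem (AddSubgroup.mem_sup_left (adEnd_mem_adInf hE _)) (AddSubgroup.mem_sup_right
    (diagInf_deltaM_mem_outer b hqε hM hp hA hq hε hι hE hf.mem_Der))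

omit hST
omit h0
include hι

theorem mem_sup_of_apply_one_eq_zero (h0 : d (1, 0, 0, 0) = 0) :
    d ∈ adInf hE ⊔ outer b 𝒜 hE := by
  obtain ⟨r, hr, hST⟩ :=
    exists_compLeft_sub_compRight b hqε hM hp hA hq hε w hw hw' hZ h2 hd h0
  obtain ⟨s, hs, hrs⟩ : ∃ s ∈ 𝒜 α, r = s + s := by
    obtain ⟨c, hc⟩ := h2.dvd (a := r)
    -- Projecting keeps half of `r` homogeneous of degree `α`, so that subtracting the inner
    -- derivation does not spoil homogeneity.
    refine ⟨proj 𝒜 α c, proj_mem 𝒜 _ _, ?_⟩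
    rw [← map_add, ← two_mul, ← hc, proj_same 𝒜 hr]
  have hd' := hd.sub_adEnd hE hA hM hq (base_mem_gradInf hs)
  have hmem := mem_sup_of_compLeft_eq b hqε hM hp hA hq hε hι w hw hw' hZ h2 hd' ?_ ?_
  · rw [← sub_add_cancel d (adEnd hE (s, 0, 0, 0))]
    exact add_mem hmem (AddSubgroup.mem_sup_left (adEnd_mem_adInf hE _))
  -- The correction by a scalar does not disturb `d e = 0`, since `[s, 1] = 0`.
  · rw [end_sub_apply, adEnd_apply, h0, brInf_mid, zero_sub, neg_eq_zero]
    exact eInf_ext rfl rfl rfl (by simp)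
  · refine end_ext fun m => ?_
    have h1 : compLeft (d - adEnd hE (s, 0, 0, 0)) m = compLeft d m - s • m := by
      change (d (0, m, 0, 0)).2.1 - (brInf hE (s, 0, 0, 0) (0, m, 0, 0)).2.1 = _
      rw [brInf_left]
      simp only [zero_add, add_zero, neg_zero, sub_neg_eq_add, map_zero, smul_zero,
        AddSubgroup.coe_zero, end_zero_apply]
      rfl
    have h3 : compRight (d - adEnd hE (s, 0, 0, 0)) m = compRight d m + s • m := by
      change (d (0, 0, m, 0)).2.2.1 - (brInf hE (s, 0, 0, 0) (0, 0, m, 0)).2.2.1 = _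
      rw [brInf_right]
      simp only [zero_add, add_zero, neg_zero, sub_neg_eq_add, map_zero, smul_zero,
        AddSubgroup.coe_zero, end_zero_apply]
      rfl
    have h4 := congrArg (fun f : AddMonoid.End M => f m) hST
    simp only [end_sub_apply, idA_apply, hrs, add_smul] at h4
    rw [h1, h3, sub_eq_iff_eq_add, add_assoc, ← h4]
    abel

theorem mem_sup_of_isDerivationDeg : d ∈ adInf hE ⊔ outer b 𝒜 hE := by
  have h1 : ((1, 0, 0, 0) : EInf A (ospFd ℳ q b)) ∈ gradInf 𝒜 ℳ (ospFd ℳ q b) 0 :=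
    base_mem_gradInf SetLike.GradedOne.one_mem
  have hw1 := hd.2.1 0 _ h1
  rw [add_zero] at hw1
  -- Since `[(0, m, n, 0), e] = (0, -m, n, 0)`, the signs of this element are chosen so that its
  -- bracket with `e` equals the `M`-components of `d e`.
  have hu : ((0, -(d (1, 0, 0, 0)).2.1, (d (1, 0, 0, 0)).2.2.1, 0) : EInf A (ospFd ℳ q b)) ∈
      gradInf 𝒜 ℳ (ospFd ℳ q b) α := ⟨zero_mem _, neg_mem hw1.2.1, hw1.2.2.1, zero_mem _⟩
  have hd' := hd.sub_adEnd hE hA hM hq hu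
  have hmem := mem_sup_of_apply_one_eq_zero b hqε hM hp hA hq hε hι w hw hw' hZ h2 hd'
    (hd'.apply_one_eq_zero h2 (idA_injective b) ?_ ?_)
  · rw [← sub_add_cancel d (adEnd hE _)]
    exact add_mem hmem (AddSubgroup.mem_sup_left (adEnd_mem_adInf hE _))
  · rw [end_sub_apply, adEnd_apply, brInf_zero_one]
    simp
  · rw [end_sub_apply, adEnd_apply, brInf_zero_one]
    simp

omit hd in
theorem derInf_eq_sup : derInf 𝒜 hE = adInf hE ⊔ outer b 𝒜 hE :=
  le_antisymm ((derInf_eq hE).le.trans (Der_le fun _ _ hd =>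
      mem_sup_of_isDerivationDeg b hqε hM hp hA hq hε hι w hw hw' hZ h2 hd))
    (sup_le (adInf_le_derInf hE hA hM hq) (outer_le_derInf b hqε hM hp hA hq hε hι hE))

end Derivations

/-! ### Integral weights and signs from the explicit form -/

section KacForm

variable {A M : Type*} [Ring A] [AddCommGroup M] [Module A M] [Module Aᵐᵒᵖ M]
  {I : AddSubgroup ℚ}

theorem exists_weight (hI : I = AddSubgroup.zmultiples 1 ∨ I = AddSubgroup.zmultiples (1 / 2)) :
    ∃ w : I → ℤ, ∀ i, (w i : ℚ) = 2 * i := by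
  -- In both index groups `2i` is an integer, so the floor only names that integer.
  refine ⟨fun i => ⌊2 * (i : ℚ)⌋, fun i => ?_⟩
  obtain ⟨i, hi⟩ := i
  have : ∃ w : ℤ, (w : ℚ) = 2 * i := by
    rcases hI with rfl | rfl
    · obtain ⟨k, rfl⟩ := hi
      exact ⟨2 * k, by simp⟩
    · obtain ⟨k, rfl⟩ := hi
      exact ⟨k, by simp; ring⟩
  obtain ⟨w, hw⟩ := this
  simp [← hw]

theorem exists_ne_ne (hI : I = AddSubgroup.zmultiples 1 ∨ I = AddSubgroup.zmultiples (1 / 2))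
    (i j : I) : ∃ k, k ≠ i ∧ k ≠ j := by
  have h1 : (1 : ℚ) ∈ I := by
    rcases hI with rfl | rfl
    · exact ⟨1, by simp⟩
    · exact ⟨2, by simp⟩
  let e : I := ⟨1, h1⟩
  have h : ∀ k l : ℕ, k ≠ l → k • e ≠ l • e := fun k l hkl he => hkl (by
    have := congrArg Subtype.val he
    simpa [e] using this)
  by_contra! hc
  have h0 := hc (0 • e)
  have h1 := hc (1 • e)
  have h2 := hc (2 • e)
  by_cases e0 : 0 • e = i
  · have e1 := h1 fun he => h 0 1 (by decide) (e0.trans he.symm)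
    have e2 := h2 fun he => h 0 2 (by decide) (e0.trans he.symm)
    exact h 1 2 (by decide) (e1.trans e2.symm)
  · have e0 := h0 e0
    by_cases e1 : 1 • e = i
    · exact h 0 2 (by decide) (e0.trans (h2 fun he => h 1 2 (by decide) (e1.trans he.symm)).symm)
    · exact h 0 1 (by decide) (e0.trans (h1 e1).symm)

theorem IsKacForm.exists_sign {b : Module.Basis I A M} {q : M →+ M →+ A} (h : IsKacForm q b)
    {𝒜 : ZMod 2 → AddSubgroup A} {ℳ : ZMod 2 → AddSubgroup M} (hq : IsQuadraticForm 𝒜 ℳ q)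
    {p : I → ZMod 2} (hp : ∀ i, b i ∈ ℳ (p i)) (w : I → ℤ) (hw : ∀ i, (w i : ℚ) = 2 * i) :
    ∃ ε : I → ℤ, (∀ i, ε i * ε i = 1) ∧
      ∀ i j, q (b i) (b j) = if i = -j then ((ε i : ℤ) : A) else 0 := by
  have hneg : ∀ i j : I, i = -j → w i = -w j := fun i j e => by
    have : (w i : ℚ) = -w j := by rw [hw, hw, e]; simp
    exact_mod_cast this
  have hint : ∀ i k, w i = k + k → (i : ℚ) = k := fun i k e => by
    have := hw i
    rw [e] at this
    push_cast at this
    linarith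
  have hhalf : ∀ i k, w i = 2 * k + 1 → (i : ℚ) + 1 / 2 = (k + 1 : ℤ) := fun i k e => by
    have := hw i
    rw [e] at this
    push_cast at this ⊢
    linarith
  have hmix : ∀ i j k l, w i = k + k → w j = 2 * l + 1 → i ≠ -j := fun i j k l hk hl e => by
    have := hneg i j e
    omega
  have hmix' : ∀ i j k l, w i = k + k → w j = 2 * l + 1 → j ≠ -i := fun i j k l hk hl e => by
    have := hneg j i e
    omega
  have hi : ∀ i, ∃ ε : ℤ, ε * ε = 1 ∧ ∀ j, q (b i) (b j) = if i = -j then (ε : A) else 0 := by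
    intro i
    rcases Int.even_or_odd (w i) with ⟨k, hk⟩ | ⟨k, hk⟩
    · refine ⟨k.negOnePow, by rw [← Units.val_mul, Int.units_mul_self]; rfl, fun j => ?_⟩
      rcases Int.even_or_odd (w j) with ⟨l, hl⟩ | ⟨l, hl⟩
      · exact h.int_int i j k l (hint i k hk) (hint j l hl)
      · rw [if_neg (hmix i j k l hk hl)]
        exact h.int_half i j k (l + 1) (hint i k hk) (hhalf j l hl)
    -- For `2i = 2k + 1` the exponent `i + 1/2` equals `k + 1`.
    · refine ⟨(k + 1).negOnePow, by rw [← Units.val_mul, Int.units_mul_self]; rfl, fun j => ?_⟩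
      rcases Int.even_or_odd (w j) with ⟨l, hl⟩ | ⟨l, hl⟩
      -- The vanishing of mixed values is given with the integral index first; supersymmetry
      -- supplies the other order.
      · rw [if_neg (hmix' j i l k hl hk), hq.supersymm _ _ _ (hp i) _ (hp j),
          h.int_half j i l (k + 1) (hint j l hl) (hhalf i k hk), smul_zero]
      · exact h.half_half i j (k + 1) (l + 1) (hhalf i k hk) (hhalf j l hl)
  choose ε hε hqε using hi
  exact ⟨ε, hε, hqε⟩

end KacForm

end Super

theorem corollary4p9 {K A M : Type*} [Ring K] [Ring A] [AddCommGroup M]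
    (𝒦 : ZMod 2 → AddSubgroup K) [GradedRing 𝒦] (hK : Super.IsSupercommutative 𝒦)
    (h2 : IsUnit (2 : K))
    (𝒜 : ZMod 2 → AddSubgroup A) [GradedRing 𝒜] (hA : Super.IsSupercommutative 𝒜)
    (ι : K →+* A) (hι : ∀ α, ∀ k ∈ 𝒦 α, ι k ∈ 𝒜 α)
    [Module A M] [Module Aᵐᵒᵖ M] [SMulCommClass A Aᵐᵒᵖ M]
    (ℳ : ZMod 2 → AddSubgroup M) [DirectSum.Decomposition ℳ] (hM : Super.IsSupermodule 𝒜 ℳ)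
    (I : AddSubgroup ℚ)
    (hI : I = AddSubgroup.zmultiples 1 ∨ I = AddSubgroup.zmultiples (1 / 2))
    (b : Module.Basis I A M) (hb : ∀ i, ∃ α, b i ∈ ℳ α)
    (q : M →+ M →+ A) (hq : Super.IsQuadraticForm 𝒜 ℳ q) (hqb : Super.IsKacForm q b)
    (hZ : ∀ k : ℤ, k ≠ 0 → IsUnit (k : A)) :
    ∃ hE : Super.IsOspSubalgebra ℳ q ι (Super.ospFd ℳ q b),
      Super.normalizer ℳ q (Super.ospFd ℳ q b) = (Super.ospFd ℳ q b : Set (AddMonoid.End M)) ∧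
      Super.derAM q ι b 𝒜 ≤ Super.SS ℳ q ι (Super.ospFd ℳ q b) ∧
      Super.IsSemidirect (Super.gradInf 𝒜 ℳ (Super.ospFd ℳ q b)) (Super.lsmulInf hE)
        (Super.derInf 𝒜 hE) (Super.adInf hE) (Super.outer b 𝒜 hE) := by
  choose p hp using hb
  obtain ⟨w, hw⟩ := Super.exists_weight hI
  obtain ⟨ε, hε, hqε⟩ := hqb.exists_sign hq hp w hw
  have h2A : IsUnit (2 : A) := by exact_mod_cast hZ 2 two_ne_zero
  have hE := Super.isOspSubalgebra_ospFd b hM hp hε hqε hA hq ι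
  exact ⟨hE, Super.normalizer_ospFd b hM hp hε hqε hA hq w hw hZ,
    Super.derAM_le_SS b hqε hM hp hA hq hε hι,
    { subN := Super.isSubsupermodule_adInf hE hA hM hq
      subH := Super.isSubsupermodule_outer b hqε hM hp hA hq hε hι hE
      sup_eq := Super.derInf_eq_sup b hqε hM hp hA hq hε hι w hw (Super.exists_ne_ne hI) hZ h2A
      disjoint := Super.disjoint_adInf_outer b hqε hM hp hA hq hε hι hE h2A
      ideal := fun _ _ _ hf _ hg => Super.adInf_ideal hE hA hM hq hf hg
      subalgebra := fun _ _ _ hf _ hg =>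
        Super.bracket_mem_outer b hqε hM hp hA hq hε hι hE hf hg }⟩
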